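/- **Model.** Fix $p\ge 0$. For every $N$ let a simple undirected graph on $\{1,\dots,N\}$ be given, with adjacency matrix $E$ normalised by $E_{ii}=1$, and put $n_i=\sum_{j\ne i}E_{ij}$; for all large $N$ every $n_i>0$. Let $S_i(V)=n_i^{-1}\sum_{j\neq i}E_{ij}V_j$. The parameter is $\varphi=(\beta,\gamma,\alpha,\sigma_y^2,\sigma_{b^Y}^2,\sigma_m^2,\sigma_{b^M}^2)\in\mathbb R^K$ with $\beta_0,\dots,\beta_4,\gamma_0,\gamma_1,\gamma_2\in\mathbb R$ and $\beta_5,\beta_6,\gamma_3,\gamma_4,\alpha\in\mathbb R^p$. Under the law $P_{N,\varphi}$ (expectation $\mathbb E_\varphi$) the confounders $C=(C_1,\dots,C_N)$, $C_i\in\mathbb R^p$, have a given joint law that does not depend on $\varphi$; given $C$ the exposures $A_i\in\{0,1\}$ are independent with $P(A_i=1\mid C)=\pi(C_i,\alpha)=e^{\alpha^TC_i}/(1+e^{\alpha^TC_i})$; and $$M_i=\gamma_0+\gamma_1A_i+\gamma_2S_i(A)+\gamma_3^TC_i+\gamma_4^TS_i(C)+E_{i\cdot}^Tb^M+\epsilon^M_i,$$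 $$Y_i=\beta_0+\beta_1A_i+\beta_2S_i(A)+\beta_3M_i+\beta_4S_i(M)+\beta_5^TC_i+\beta_6^TS_i(C)+E_{i\cdot}^Tb^Y+\epsilon^Y_i,$$ where $b^M,\epsilon^M,b^Y,\epsilon^Y$ are mutually independent, independent of $(C,A)$, and centred normal in $\mathbb R^N$ with covariances $\sigma_{b^M}^2I,\sigma_m^2I,\sigma_{b^Y}^2I,\sigma_y^2I$. Let $\mu_y,\mu_m$ be the fixed-effects parts of the two equations, $\Sigma_y=\sigma_y^2I+\sigma_{b^Y}^2EE^T$, $\Sigma_m=\sigma_m^2I+\sigma_{b^M}^2EE^T$, and let $$l_N(\varphi)=-N\log(2\pi)-\tfrac12\log|\Sigma_y|-\tfrac12(Y-\mu_y)^T\Sigma_y^{-1}(Y-\mu_y)-\tfrac12\log|\Sigma_m|-\tfrac12(M-\mu_m)^T\Sigma_m^{-1}(M-\mu_m)+\sum_i A_i\log\tfrac{\pi(C_i,\alpha)}{1-\pi(C_i,\alpha)}+\sum_i\log(1-\pi(C_i,\alpha))$$ be the log-likelihood, $J_N(\varphi)=-\nabla^2l_N(\varphi)$ the observed information and $B_N(\varphi)=\mathbb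 E_\varphi J_N(\varphi)$ the Fisher information. For $\Phi=(\varphi_1,\dots,\varphi_K)$ let $J_N(\Phi)$ be the matrix whose $k$-th row is the $k$-th row of $J_N(\varphi_k)$. $\|\cdot\|_F$ is the Frobenius norm, square roots are symmetric, and limits are as $N\to\infty$. Let $\Theta\subset\mathbb R^K$ be compact, with all four variances positive on $\Theta$, and let the true parameter $\varphi_0$ lie in the interior of $\Theta$. Let $\widehat\varphi_N$ be a maximum likelihood estimator, that is, a measurable function of the data that maximises $l_N$ over $\Theta$. **Assumptions on the information matrices.** 1. For all large $N$, $B_N$ is positive definite and continuous on $\Theta$, and $\sup_{\varphi\in\Theta}\|B_N^{-1}(\varphi)\|_F\to0$. 2. $\sup_{\varphi\in\Theta}\mathbb E_\varphi\|B_N^{-1/2}(\varphi)J_N(\varphi)B_N^{-1/2}(\varphi)-I\|_F^2\to0$. 3. For all $\epsilon>0$: $\sup\{\|B_N^{-1/2}(\varphi)B_N^{1/2}(\varphi')-I\|_F:\varphi,\varphi'\in\Theta,\ \|B_N^{1/2}(\varphi)^T(\varphi-\varphi')\|\le\epsilon\}\to0$. 4. For all $\varphi\in\Theta$ and $\epsilon,\eta>0$: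 $P_{N,\varphi}\big[\sup\{\|B_N^{-1/2}(\varphi)(J_N(\Phi)-J_N(\varphi))B_N^{-1/2}(\varphi)\|_F:\varphi_k\in\Theta,\ \|B_N(\varphi)(\varphi-\varphi_k)\|\le\epsilon,\ 1\le k\le K\}>\eta\big]\to0$. **Assumptions on $g$.** Let $g=g_N:\Theta\to\mathbb R$ be real analytic (on a neighbourhood of $\Theta$), possibly depending on $N$, and let $Q_N=\nabla g(\varphi_0)^TB_N^{-1}(\varphi_0)\nabla g(\varphi_0)$. 5. $\nabla g(\varphi_0)\ne0$ for every $N$, $\sup_N\|\nabla g(\varphi_0)\|<\infty$, and $\sup_{N}\sup_{\varphi'}\|\nabla^2g(\varphi')\|_F<\infty$, with $\varphi'$ ranging over the points of $\Theta$ in some $\epsilon$-neighbourhood of $\varphi_0$. 6. Let $\lambda_{N,1}\ge\dots\ge\lambda_{N,K}$ be the eigenvalues of $B_N^{-1}(\varphi_0)$. For some choice of corresponding orthonormal eigenvectors $v_{N,k}$, writing $\nabla g(\varphi_0)=\sum_kz_{N,k}v_{N,k}$, we have $z_{N,k}=O(1)$ and $\lambda_{N,k}=O(N^{-\delta_k})$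 for all $k$, where $\delta_1=\dots=\delta_r<\delta_{r+1}\le\dots\le\delta_K$ for some $1\le r\le K$; and for $k\le r$ the sequence $u_{N,k}=\sqrt{\lambda_{N,k}}\,z_{N,k}v_{N,k}\big/\sqrt{\sum_j\lambda_{N,j}z_{N,j}^2}$ is Cauchy in $N$. 7. With $P_{N,\varphi_0}$-probability tending to one, $J_N(\varphi_0)$ and $J_N(\widehat\varphi_N)$ are positive definite. 8. $\sup_{N}\sup_{\varphi'}\|\nabla^2_{\varphi'}\{\nabla g(\varphi)^T\nabla g(\varphi)\}\|_F<\infty$, with $\varphi'$ ranging over the points of $\Theta$ in some $\epsilon$-neighbourhood of $\varphi_0$. **Conclusion.** The observed-information sandwich estimator is consistent: $$\nabla g(\widehat\varphi_N)^TJ_N^{-1}(\widehat\varphi_N)\nabla g(\widehat\varphi_N)-Q_N\longrightarrow0\quad\text{in }P_{N,\varphi_0}\text{-probability.}$$ -/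

import Mathlib

open MeasureTheory ProbabilityTheory Filter Topology
open scoped Matrix

namespace RENSEM

noncomputable section

/-! ### Parameters

The parameter vector is `φ = (β, γ, α, σ_y², σ_{b^Y}², σ_m², σ_{b^M}²)`, where
`β = (β₀, …, β₄, β₅, β₆)` and `γ = (γ₀, γ₁, γ₂, γ₃, γ₄)` with `β₅, β₆, γ₃, γ₄, α ∈ ℝ^p`. -/

/-- Coordinates of `β`: five scalars, then the vectors `β₅` and `β₆`. -/
abbrev BetaIdx (p : ℕ) : Type := Fin 5 ⊕ (Fin p ⊕ Fin p)

/-- Coordinates of `γ`: three scalars, then the vectors `γ₃` and `γ₄`. -/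
abbrev GammaIdx (p : ℕ) : Type := Fin 3 ⊕ (Fin p ⊕ Fin p)

/-- Coordinates of `φ`; the last four are `σ_y², σ_{b^Y}², σ_m², σ_{b^M}²`. -/
abbrev ParamIdx (p : ℕ) : Type := BetaIdx p ⊕ (GammaIdx p ⊕ (Fin p ⊕ Fin 4))

/-- The number `K` of parameters. -/
abbrev dimParam (p : ℕ) : ℕ := Fintype.card (ParamIdx p)

/-- `ℝ^K` with its Euclidean norm. -/
abbrev Param (p : ℕ) : Type := EuclideanSpace ℝ (ParamIdx p)

variable {p N : ℕ}

def betaS (φ : Param p) (k : Fin 5) : ℝ := φ (Sum.inl (Sum.inl k))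
def beta5 (φ : Param p) : Fin p → ℝ := fun j => φ (Sum.inl (Sum.inr (Sum.inl j)))
def beta6 (φ : Param p) : Fin p → ℝ := fun j => φ (Sum.inl (Sum.inr (Sum.inr j)))
def gammaS (φ : Param p) (k : Fin 3) : ℝ := φ (Sum.inr (Sum.inl (Sum.inl k)))
def gamma3 (φ : Param p) : Fin p → ℝ := fun j => φ (Sum.inr (Sum.inl (Sum.inr (Sum.inl j))))
def gamma4 (φ : Param p) : Fin p → ℝ := fun j => φ (Sum.inr (Sum.inl (Sum.inr (Sum.inr j))))
def alpha (φ : Param p) : Fin p → ℝ := fun j => φ (Sum.inr (Sum.inr (Sum.inl j)))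
/-- The variances: `0 ↦ σ_y²`, `1 ↦ σ_{b^Y}²`, `2 ↦ σ_m²`, `3 ↦ σ_{b^M}²`. -/
def sigmaSq (φ : Param p) (k : Fin 4) : ℝ := φ (Sum.inr (Sum.inr (Sum.inr k)))

/-! ### The network -/

open scoped Classical in
/-- The adjacency matrix `E` of the network, with `E_ii = 1`. -/
def adj (G : SimpleGraph (Fin N)) : Matrix (Fin N) (Fin N) ℝ :=
  Matrix.of fun i j => if i = j ∨ G.Adj i j then 1 else 0

/-- `n_i = ∑_{j ≠ i} E_ij`. -/
def deg (G : SimpleGraph (Fin N)) (i : Fin N) : ℝ :=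
  ∑ j ∈ Finset.univ.erase i, adj G i j

/-- The neighbourhood average `S_{1i}(V) = n_i⁻¹ ∑_{j ≠ i} E_ij V_j`. -/
def nbrAvg (G : SimpleGraph (Fin N)) (V : Fin N → ℝ) (i : Fin N) : ℝ :=
  1 / deg G i * ∑ j ∈ Finset.univ.erase i, adj G i j * V j

/-- `S_{1i}` applied to every column of the matrix of confounders. -/
def nbrAvgVec (G : SimpleGraph (Fin N)) (C : Fin N → Fin p → ℝ) (i : Fin N) : Fin p → ℝ :=
  fun k => nbrAvg G (fun j => C j k) i

/-! ### The model -/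

/-- `P(A_i = 1 | C_i) = π(C_i, α)`, the logistic function of `αᵀ C_i`. -/
def propensity (φ : Param p) (c : Fin p → ℝ) : ℝ :=
  Real.exp (alpha φ ⬝ᵥ c) / (1 + Real.exp (alpha φ ⬝ᵥ c))

/-- The fixed-effects part of the mediator equation. -/
def medMean (G : SimpleGraph (Fin N)) (φ : Param p) (C : Fin N → Fin p → ℝ) (A : Fin N → ℝ)
    (i : Fin N) : ℝ :=
  gammaS φ 0 + gammaS φ 1 * A i + gammaS φ 2 * nbrAvg G A i
    + gamma3 φ ⬝ᵥ C i + gamma4 φ ⬝ᵥ nbrAvgVec G C i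

/-- The fixed-effects part of the outcome equation. -/
def outMean (G : SimpleGraph (Fin N)) (φ : Param p) (C : Fin N → Fin p → ℝ)
    (A M : Fin N → ℝ) (i : Fin N) : ℝ :=
  betaS φ 0 + betaS φ 1 * A i + betaS φ 2 * nbrAvg G A i + betaS φ 3 * M i
    + betaS φ 4 * nbrAvg G M i + beta5 φ ⬝ᵥ C i + beta6 φ ⬝ᵥ nbrAvgVec G C i

/-- Observed data `(C, A, M, Y)` of a network of size `N`. -/
abbrev Data (p N : ℕ) : Type :=
  (Fin N → Fin p → ℝ) × (Fin N → ℝ) × (Fin N → ℝ) × (Fin N → ℝ)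

/-- Exogenous variables `(C, ε^A, b^M, ε^M, b^Y, ε^Y)`. -/
abbrev Latent (p N : ℕ) : Type :=
  (Fin N → Fin p → ℝ) × (Fin N → ℝ) × (Fin N → ℝ) × (Fin N → ℝ) × (Fin N → ℝ) × (Fin N → ℝ)

/-- The normal distribution `MVN(0, v I)` on `ℝ^N`. -/
def gaussVec (N : ℕ) (v : ℝ) : Measure (Fin N → ℝ) :=
  Measure.pi fun _ => gaussianReal 0 v.toNNReal

/-- The uniform distribution on `[0,1]^N`. -/
def unifVec (N : ℕ) : Measure (Fin N → ℝ) :=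
  Measure.pi fun _ => (volume : Measure ℝ).restrict (Set.Icc 0 1)

/-- Joint law of the exogenous variables, which are mutually independent. The confounders have an
arbitrary joint law `ν`; the exposure noise `ε^A` is uniform on `[0,1]^N`; the errors and the random
effects are centred normal. -/
def latentLaw (ν : Measure (Fin N → Fin p → ℝ)) (φ : Param p) : Measure (Latent p N) :=
  ν.prod ((unifVec N).prod ((gaussVec N (sigmaSq φ 3)).prod ((gaussVec N (sigmaSq φ 2)).prod
    ((gaussVec N (sigmaSq φ 1)).prod (gaussVec N (sigmaSq φ 0))))))

/-- `A_i = 1` if `ε^A_i ≤ π(C_i, α)` and `A_i = 0` otherwise: given `C`, the exposures are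
independent Bernoulli variables with success probabilities `π(C_i, α)`. -/
def genA (φ : Param p) (C : Fin N → Fin p → ℝ) (e : Fin N → ℝ) (i : Fin N) : ℝ :=
  if e i ≤ propensity φ (C i) then 1 else 0

/-- `M_i = γ₀ + γ₁ A_i + γ₂ S_{1i}(A) + γ₃ᵀ C_i + γ₄ᵀ S_{1i}(C) + E_{i.}ᵀ b^M + ε^M_i`. -/
def genM (G : SimpleGraph (Fin N)) (φ : Param p) (C : Fin N → Fin p → ℝ) (A b e : Fin N → ℝ)
    (i : Fin N) : ℝ :=
  medMean G φ C A i + adj G i ⬝ᵥ b + e i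

/-- `Y_i = β₀ + β₁ A_i + β₂ S_{1i}(A) + β₃ M_i + β₄ S_{1i}(M) + β₅ᵀ C_i + β₆ᵀ S_{1i}(C)
+ E_{i.}ᵀ b^Y + ε^Y_i`. -/
def genY (G : SimpleGraph (Fin N)) (φ : Param p) (C : Fin N → Fin p → ℝ) (A M b e : Fin N → ℝ)
    (i : Fin N) : ℝ :=
  outMean G φ C A M i + adj G i ⬝ᵥ b + e i

/-- The structural equations: the observed data as a function of the exogenous variables. -/
def generate (G : SimpleGraph (Fin N)) (φ : Param p) : Latent p N → Data p N :=
  fun ⟨C, eA, bM, eM, bY, eY⟩ =>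
    (C, genA φ C eA, genM G φ C (genA φ C eA) bM eM,
      genY G φ C (genA φ C eA) (genM G φ C (genA φ C eA) bM eM) bY eY)

/-- The law `P_{N,φ}` of the data under the parameter `φ`. -/
def dataLaw (G : SimpleGraph (Fin N)) (ν : Measure (Fin N → Fin p → ℝ)) (φ : Param p) :
    Measure (Data p N) :=
  (latentLaw ν φ).map (generate G φ)

theorem measurable_generate (G : SimpleGraph (Fin N)) (φ : Param p) :
    Measurable (generate G φ) := by
  have hA : Measurable fun x : Latent p N => genA φ x.1 x.2.1 := by
    refine measurable_pi_lambda _ fun i => ?_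
    refine Measurable.ite (measurableSet_le ?_ ?_) measurable_const measurable_const
    · fun_prop
    · unfold propensity dotProduct
      fun_prop
  have hM : Measurable fun x : Latent p N =>
      genM G φ x.1 (genA φ x.1 x.2.1) x.2.2.1 x.2.2.2.1 := by
    refine measurable_pi_lambda _ fun i => ?_
    unfold genM medMean nbrAvgVec nbrAvg dotProduct
    fun_prop
  have hY : Measurable fun x : Latent p N =>
      genY G φ x.1 (genA φ x.1 x.2.1) (genM G φ x.1 (genA φ x.1 x.2.1) x.2.2.1 x.2.2.2.1)
        x.2.2.2.2.1 x.2.2.2.2.2 := by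
    refine measurable_pi_lambda _ fun i => ?_
    unfold genY outMean nbrAvgVec nbrAvg dotProduct
    fun_prop
  exact measurable_fst.prodMk (hA.prodMk (hM.prodMk hY))

instance (N : ℕ) (v : ℝ) : IsProbabilityMeasure (gaussVec N v) := by
  unfold gaussVec; infer_instance

instance (N : ℕ) : IsProbabilityMeasure (unifVec N) := by
  have : IsProbabilityMeasure ((volume : Measure ℝ).restrict (Set.Icc 0 1)) := ⟨by simp⟩
  unfold unifVec; infer_instance

instance (ν : Measure (Fin N → Fin p → ℝ)) [IsProbabilityMeasure ν] (φ : Param p) :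
    IsProbabilityMeasure (latentLaw ν φ) := by
  unfold latentLaw; infer_instance

instance (G : SimpleGraph (Fin N)) (ν : Measure (Fin N → Fin p → ℝ)) [IsProbabilityMeasure ν]
    (φ : Param p) : IsProbabilityMeasure (dataLaw G ν φ) :=
  Measure.isProbabilityMeasure_map (measurable_generate G φ).aemeasurable

/-! ### Likelihood and information -/

/-- `Σ_y = σ_y² I + σ_{b^Y}² E Eᵀ`. -/
def SigmaY (G : SimpleGraph (Fin N)) (φ : Param p) : Matrix (Fin N) (Fin N) ℝ :=
  sigmaSq φ 0 • (1 : Matrix (Fin N) (Fin N) ℝ) + sigmaSq φ 1 • (adj G * (adj G)ᵀ)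

/-- `Σ_m = σ_m² I + σ_{b^M}² E Eᵀ`. -/
def SigmaM (G : SimpleGraph (Fin N)) (φ : Param p) : Matrix (Fin N) (Fin N) ℝ :=
  sigmaSq φ 2 • (1 : Matrix (Fin N) (Fin N) ℝ) + sigmaSq φ 3 • (adj G * (adj G)ᵀ)

/-- The log-density of `MVN(μ, S)` at `μ + w`. -/
def gaussLogLik (S : Matrix (Fin N) (Fin N) ℝ) (w : Fin N → ℝ) : ℝ :=
  -(N / 2 : ℝ) * Real.log (2 * Real.pi) - 1 / 2 * Real.log S.det - 1 / 2 * (w ⬝ᵥ (S⁻¹ *ᵥ w))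

/-- The log-likelihood `l = l_y + l_m + l_a` with the random effects integrated out. -/
def logLik (G : SimpleGraph (Fin N)) (x : Data p N) (φ : Param p) : ℝ :=
  let C := x.1
  let A := x.2.1
  let M := x.2.2.1
  let Y := x.2.2.2
  gaussLogLik (SigmaY G φ) (fun i => Y i - outMean G φ C A M i)
    + gaussLogLik (SigmaM G φ) (fun i => M i - medMean G φ C A i)
    + (∑ i, A i * Real.log (propensity φ (C i) / (1 - propensity φ (C i)))
      + ∑ i, Real.log (1 - propensity φ (C i)))

/-- The Hessian matrix of a function of the parameters. -/
def hess (f : Param p → ℝ) (φ : Param p) : Matrix (ParamIdx p) (ParamIdx p) ℝ :=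
  Matrix.of fun k l =>
    fderiv ℝ (fun ψ => fderiv ℝ f ψ (EuclideanSpace.single l 1)) φ (EuclideanSpace.single k 1)

/-- The observed information `J_N(φ)`. -/
def obsInfo (G : SimpleGraph (Fin N)) (x : Data p N) (φ : Param p) :
    Matrix (ParamIdx p) (ParamIdx p) ℝ :=
  -hess (logLik G x) φ

/-- The mosaic matrix `J_N(Φ)`: its `k`-th row is the `k`-th row of `J_N(φ_k)`. -/
def obsInfoMosaic (G : SimpleGraph (Fin N)) (x : Data p N) (Φ : ParamIdx p → Param p) :
    Matrix (ParamIdx p) (ParamIdx p) ℝ :=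
  Matrix.of fun k l => obsInfo G x (Φ k) k l

/-- The Fisher information `B_N(φ) = E_φ J_N(φ)`. -/
def fisherInfo (G : SimpleGraph (Fin N)) (ν : Measure (Fin N → Fin p → ℝ)) (φ : Param p) :
    Matrix (ParamIdx p) (ParamIdx p) ℝ :=
  Matrix.of fun k l => ∫ x, obsInfo G x φ k l ∂(dataLaw G ν φ)

/-! ### Matrices -/

/-- The Frobenius norm `√tr(HᵀH)`. -/
def frob {ι : Type*} [Fintype ι] (H : Matrix ι ι ℝ) : ℝ :=
  Real.sqrt (Hᵀ * H).trace

section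

open scoped MatrixOrder

/-- The positive semidefinite square root `B^{1/2}` of a positive semidefinite matrix. -/
def msqrt {ι : Type*} [Fintype ι] [DecidableEq ι] (B : Matrix ι ι ℝ) : Matrix ι ι ℝ :=
  CFC.sqrt B

end

/-- `B^{-1/2}`. -/
def minvsqrt {ι : Type*} [Fintype ι] [DecidableEq ι] (B : Matrix ι ι ℝ) : Matrix ι ι ℝ :=
  (msqrt B)⁻¹

/-! ### Regularity conditions on the information matrices

Throughout, `G N` is the network of size `N` and `ν N` the law of its confounders. -/

variable (G : ∀ N : ℕ, SimpleGraph (Fin N)) (ν : ∀ N : ℕ, Measure (Fin N → Fin p → ℝ))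

/-- The Fisher information is positive definite and continuous on `Θ` for all large `N`, and its
inverse tends to zero uniformly on `Θ`. -/
def InfoGrowth (Θ : Set (Param p)) : Prop :=
  (∀ᶠ N in atTop, (∀ φ ∈ Θ, (fisherInfo (G N) (ν N) φ).PosDef) ∧
      ContinuousOn (fisherInfo (G N) (ν N)) Θ) ∧
    ∀ η > 0, ∀ᶠ N in atTop, ∀ φ ∈ Θ, frob (fisherInfo (G N) (ν N) φ)⁻¹ ≤ η

/-- `sup_{φ ∈ Θ} E_φ ‖B_N^{-1/2}(φ) J_N(φ) B_N^{-1/2}(φ) - I‖_F² → 0`. -/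
def InfoStable (Θ : Set (Param p)) : Prop :=
  Tendsto (fun N => ⨆ φ ∈ Θ, ∫⁻ x, ENNReal.ofReal
      (frob (minvsqrt (fisherInfo (G N) (ν N) φ) * obsInfo (G N) x φ
        * minvsqrt (fisherInfo (G N) (ν N) φ) - 1) ^ 2) ∂(dataLaw (G N) (ν N) φ))
    atTop (𝓝 0)

/-- For every `ε`, the supremum of `‖B_N^{-1/2}(φ) B_N^{1/2}(φ') - I‖_F` over `φ, φ' ∈ Θ` with
`‖B_N^{1/2}(φ)ᵀ (φ - φ')‖ ≤ ε` tends to zero. -/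
def InfoContinuity (Θ : Set (Param p)) : Prop :=
  ∀ ε > 0, ∀ η > 0, ∀ᶠ N in atTop, ∀ φ ∈ Θ, ∀ φ' ∈ Θ,
    ‖WithLp.toLp 2 ((msqrt (fisherInfo (G N) (ν N) φ))ᵀ *ᵥ (φ - φ').ofLp)‖ ≤ ε →
      frob (minvsqrt (fisherInfo (G N) (ν N) φ) * msqrt (fisherInfo (G N) (ν N) φ') - 1) ≤ η

/-- For every `φ ∈ Θ` and all `ε, η > 0`, the `P_{N,φ}`-probability that
`‖B_N^{-1/2}(φ) (J_N(Φ) - J_N(φ)) B_N^{-1/2}(φ)‖_F > η` for some `Φ = (φ_1, …, φ_K)` with all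
`φ_k ∈ Θ` and `‖B_N(φ) (φ - φ_k)‖ ≤ ε` tends to zero. -/
def ObsInfoContinuity (Θ : Set (Param p)) : Prop :=
  ∀ φ ∈ Θ, ∀ ε > 0, ∀ η > 0, Tendsto (fun N => dataLaw (G N) (ν N) φ
      {x | ∃ Φ : ParamIdx p → Param p,
        (∀ k, Φ k ∈ Θ ∧
          ‖WithLp.toLp 2 (fisherInfo (G N) (ν N) φ *ᵥ (φ - Φ k).ofLp)‖ ≤ ε) ∧
        η < frob (minvsqrt (fisherInfo (G N) (ν N) φ)
          * (obsInfoMosaic (G N) x Φ - obsInfo (G N) x φ)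
          * minvsqrt (fisherInfo (G N) (ν N) φ))})
    atTop (𝓝 0)

/-! ### Conditions on the function of interest -/

/-- The gradient of `f` at `φ` as a plain vector. -/
def grad (f : Param p → ℝ) (φ : Param p) : ParamIdx p → ℝ := (gradient f φ).ofLp

/-- `g_N` is analytic on `Θ`, its gradients at `φ₀` are nonzero and bounded in `N`, and its Hessians
are bounded uniformly in `N` near `φ₀`. -/
def SmoothFunctional (Θ : Set (Param p)) (φ₀ : Param p) (g : ℕ → Param p → ℝ) : Prop :=
  (∀ N, AnalyticOnNhd ℝ (g N) Θ) ∧ (∀ N, grad (g N) φ₀ ≠ 0) ∧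
    (∃ C₁ : ℝ, ∀ N, ‖gradient (g N) φ₀‖ ≤ C₁) ∧
    ∃ ε > 0, ∃ C₂ : ℝ, ∀ N, ∀ φ' ∈ Metric.ball φ₀ ε ∩ Θ, frob (hess (g N) φ') ≤ C₂

/-- Write `lam N 0 ≥ lam N 1 ≥ …` for the eigenvalues of `B_N⁻¹`, `v N k` for corresponding
orthonormal eigenvectors and `d_N = ∑ z N k • v N k`. Then `z N k = O(1)`, `lam N k = O(N^{-δ k})`
with `δ 0 = ⋯ = δ (r-1) < δ r ≤ ⋯`, and the vectors
`u N k = √(lam N k) z N k v N k / √(∑ j, lam N j (z N j)²)`, `k < r`, are Cauchy sequences in `N`. -/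
def SpectralCondition (B : ℕ → Matrix (ParamIdx p) (ParamIdx p) ℝ) (d : ℕ → Param p) : Prop :=
  ∃ (lam z : ℕ → Fin (dimParam p) → ℝ) (v : ℕ → Fin (dimParam p) → Param p)
    (δ : Fin (dimParam p) → ℝ) (r : ℕ),
    (∀ N, Antitone (lam N)) ∧ (∀ N, Orthonormal ℝ (v N)) ∧
    (∀ N k, (B N)⁻¹ *ᵥ (v N k).ofLp = lam N k • (v N k).ofLp) ∧
    (∀ N, d N = ∑ k, z N k • v N k) ∧
    (∀ k, (fun N => z N k) =O[atTop] fun _ => (1 : ℝ)) ∧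
    (∀ k, (fun N => lam N k) =O[atTop] fun N : ℕ => (N : ℝ) ^ (-δ k)) ∧
    Monotone δ ∧ 1 ≤ r ∧ r ≤ dimParam p ∧
    (∀ k l : Fin (dimParam p), (k : ℕ) < r → (l : ℕ) < r → δ k = δ l) ∧
    (∀ k l : Fin (dimParam p), (k : ℕ) < r → r ≤ (l : ℕ) → δ k < δ l) ∧
    ∀ k : Fin (dimParam p), (k : ℕ) < r → CauchySeq fun N =>
      (Real.sqrt (lam N k) * z N k / Real.sqrt (∑ j, lam N j * z N j ^ 2)) • v N k

/-! ### Estimators -/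

/-- A maximum likelihood estimator: a measurable function of the data which maximizes the
log-likelihood over the parameter space. -/
structure IsMLE (G : SimpleGraph (Fin N)) (Θ : Set (Param p)) (φhat : Data p N → Param p) :
    Prop where
  measurable : Measurable φhat
  mem : ∀ x, φhat x ∈ Θ
  isMaxOn : ∀ x, IsMaxOn (logLik G x) Θ (φhat x)

/-- The sandwich variance `Q_N = ∇g(φ₀)ᵀ B_N⁻¹(φ₀) ∇g(φ₀)`. -/
def sandwichVar (G : SimpleGraph (Fin N)) (ν : Measure (Fin N → Fin p → ℝ))
    (g : Param p → ℝ) (φ₀ : Param p) : ℝ :=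
  grad g φ₀ ⬝ᵥ ((fisherInfo G ν φ₀)⁻¹ *ᵥ grad g φ₀)

/-- The sandwich estimator `∇g(φ̂)ᵀ J_N⁻¹(φ̂) ∇g(φ̂)`. -/
def sandwichEst (G : SimpleGraph (Fin N)) (x : Data p N) (g : Param p → ℝ) (φ : Param p) : ℝ :=
  grad g φ ⬝ᵥ ((obsInfo G x φ)⁻¹ *ᵥ grad g φ)

end

end RENSEM

open RENSEM

set_option linter.unusedSectionVars false

/-! Both terms of the difference tend to zero separately. The gradients at `φ₀` are bounded and
`B_N⁻¹(φ₀)` tends to zero, hence so does `Q_N`. For the estimator it suffices that, with probability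
tending to one, the gradient at the maximum likelihood estimator is bounded and `J_N` there
dominates any prescribed multiple of the identity (`abs_dotProduct_inv_mulVec_le`). This is
`eventually_meas_not_mle_local`: every parameter whose likelihood is at least that of `φ₀` is at
bounded distance from `φ₀` in the norm of `B_N(φ₀)`, and there `J_N ≥ c B_N(φ₀)` with an absolute
constant `c`.

Let `b` be the quadratic form of `B_N(φ₀)`. All covariance matrices are functions of `E Eᵀ`, so in
an eigenbasis of `E` the Gaussian likelihood is a sum of scalar terms whose variances are linear in
the parameter, and `b` splits into a mean, a variance and an exposure part (`splits_locLik`).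

Localization (`LocalLik.Splits.b_le_of_diff_nonneg`). The Gaussian log-likelihood ratio is at most a
negative multiple of its share of `b` plus score sums with weights `1 / (1 + L_j v)`. These weights
expand in geometric series with ratios bounded away from one, so a single random series with bounded
mean controls the score by a multiple of `√b` for all parameters at once (`abs_sum_div_variance_le`,
`score_bounds`). The logistic remainder is convex and nonnegative. In a fixed standardized direction
it is close in `L¹` to half its share of `b`: its curvature depends on the confounders alone, whose
law is free of the parameter, so stability of the information at a shifted parameter may be used
under `P_{φ₀}` (`lintegral_abs_logitInfo_sub_le`). Convexity makes the approximation uniform on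
balls (`exists_finset_uniform_of_convexOn`) and forces linear growth outside them, which beats the
score.

Curvature (`LocalLik.Splits.info_ge`). The Gaussian information is a small perturbation of its value
at `φ₀`, because the relative changes of the variances are small. The logistic information cannot be
perturbed termwise, since single logits may move far. Instead, a sum of softplus functions uniformly
close to an affine function plus `r² / 2` must have second derivative bounded below
(`sum_expitDeriv_ge_of_approx`). -/

namespace RENSEM

/-! ### The logistic function -/

/-- The logistic function `eᵗ / (1 + eᵗ)`. -/
noncomputable def expit (t : ℝ) : ℝ := Real.exp t / (1 + Real.exp t)

/-- The derivative of the logistic function. -/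
noncomputable def expitDeriv (t : ℝ) : ℝ := Real.exp t / (1 + Real.exp t) ^ 2

/-- The primitive `log (1 + eᵗ)` of the logistic function. -/
noncomputable def softplus (t : ℝ) : ℝ := Real.log (1 + Real.exp t)

theorem one_add_exp_pos (t : ℝ) : 0 < 1 + Real.exp t := by positivity

theorem hasDerivAt_softplus (t : ℝ) : HasDerivAt softplus (expit t) t := by
  have h := ((Real.hasDerivAt_exp t).const_add 1).log (one_add_exp_pos t).ne'
  exact h

theorem hasDerivAt_expit (t : ℝ) : HasDerivAt expit (expitDeriv t) t := by
  have h := (Real.hasDerivAt_exp t).div ((Real.hasDerivAt_exp t).const_add 1)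
    (one_add_exp_pos t).ne'
  have e : expitDeriv t = (Real.exp t * (1 + Real.exp t) - Real.exp t * Real.exp t)
      / (1 + Real.exp t) ^ 2 := by
    unfold expitDeriv; congr 1; ring
  rw [e]
  exact h

theorem expitDeriv_pos (t : ℝ) : 0 < expitDeriv t := by
  unfold expitDeriv; positivity

theorem expit_nonneg (t : ℝ) : 0 ≤ expit t := by unfold expit; positivity

theorem expit_le_one (t : ℝ) : expit t ≤ 1 := by
  unfold expit
  rw [div_le_one (one_add_exp_pos t)]
  linarith

theorem monotone_expit : Monotone expit :=
  monotone_of_deriv_nonneg (fun t => (hasDerivAt_expit t).differentiableAt) fun t => by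
    rw [(hasDerivAt_expit t).deriv]; exact (expitDeriv_pos t).le

theorem expit_neg (t : ℝ) : expit (-t) = 1 - expit t := by
  unfold expit
  rw [Real.exp_neg]
  have := Real.exp_pos t
  field_simp
  ring

/-- The logarithmic derivative of `expitDeriv` is `1 - 2 expit`, which lies in `(-1, 1)`. This
Harnack-type bound makes the curvature comparable over bounded distances. -/
theorem expitDeriv_le_exp_mul (t r : ℝ) : expitDeriv t ≤ Real.exp |t - r| * expitDeriv r := by
  unfold expitDeriv
  rw [← mul_div_assoc, div_le_div_iff₀ (by positivity) (by positivity)]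
  rcases le_total r t with h | h
  · rw [abs_of_nonneg (by linarith), ← Real.exp_add, sub_add_cancel]
    have : Real.exp r ≤ Real.exp t := Real.exp_le_exp.2 h
    gcongr
  · rw [abs_of_nonpos (by linarith)]
    have e1 : Real.exp (-(t - r)) * Real.exp r * (1 + Real.exp t) ^ 2
        = Real.exp t * (Real.exp (r - t) * (1 + Real.exp t)) ^ 2 := by
      have : Real.exp (-(t-r)) * Real.exp r = Real.exp t * Real.exp (r - t) ^ 2 := by
        rw [← Real.exp_nat_mul, ← Real.exp_add, ← Real.exp_add]; congr 1; push_cast; ring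
      rw [this]; ring
    rw [e1]
    have e2 : Real.exp (r - t) * (1 + Real.exp t) = Real.exp (r - t) + Real.exp r := by
      rw [mul_add, ← Real.exp_add]; simp
    rw [e2]
    have : 1 ≤ Real.exp (r - t) := Real.one_le_exp (by linarith)
    gcongr

theorem convexOn_softplus : ConvexOn ℝ Set.univ softplus := by
  have hd : Differentiable ℝ softplus := fun t => (hasDerivAt_softplus t).differentiableAt
  refine MonotoneOn.convexOn_of_deriv convex_univ hd.continuous.continuousOn
    hd.differentiableOn ?_
  have : deriv softplus = expit := funext fun t => (hasDerivAt_softplus t).deriv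
  rw [this]
  exact monotone_expit.monotoneOn _

/-- The tangent line of a convex differentiable function lies below it. -/
theorem ConvexOn.tangent_le {f : ℝ → ℝ} (hf : ConvexOn ℝ Set.univ f) {f' t : ℝ}
    (h : HasDerivAt f f' t) (r : ℝ) : f t + f' * (r - t) ≤ f r := by
  rcases lt_trichotomy t r with hr | hr | hr
  · have := hf.le_slope_of_hasDerivAt (Set.mem_univ t) (Set.mem_univ r) hr h
    rw [slope_def_field, le_div_iff₀ (by linarith)] at this
    linarith
  · subst hr; simp
  · have := hf.slope_le_of_hasDerivAt (Set.mem_univ r) (Set.mem_univ t) hr h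
    rw [slope_def_field, div_le_iff₀ (by linarith)] at this
    linarith

theorem softplus_tangent (t r : ℝ) : softplus t + expit t * (r - t) ≤ softplus r :=
  ConvexOn.tangent_le convexOn_softplus (hasDerivAt_softplus t) r

/-! A sum of softplus functions which is close to `r² / 2` has curvature bounded below. -/

theorem expit_increment_nonneg (t s : ℝ) {a b : ℝ} (hab : a ≤ b) :
    0 ≤ s * (expit (t + b * s) - expit (t + a * s)) := by
  rcases le_total 0 s with hs | hs
  · exact mul_nonneg hs (sub_nonneg.2 (monotone_expit (by nlinarith)))
  · exact mul_nonneg_of_nonpos_of_nonpos hs (sub_nonpos.2 (monotone_expit (by nlinarith)))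

theorem exp_five_ge : (100 : ℝ) ≤ Real.exp 5 := by
  have h := Real.exp_one_gt_d9
  have e : Real.exp 5 = Real.exp 1 ^ 5 := by rw [← Real.exp_nat_mul]; norm_num
  rw [e]
  calc (100 : ℝ) ≤ (2.7 : ℝ) ^ 5 := by norm_num
    _ ≤ Real.exp 1 ^ 5 := by gcongr; linarith

/-- On the negative half-line `expit` agrees with `exp` up to a factor two, so moving from `t + s/2`
to `t + s` multiplies it by at least `e⁵ / 2 ≥ 50`. One of these fifty units pays for the subtracted
value at `t - 2s`. -/
theorem expit_increment_far_of_neg {t s : ℝ} (hs : 10 ≤ s) (ht : t + s ≤ 0) :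
    49 * (s * (expit (t + 1 / 2 * s) - expit (t + -(1 / 2) * s)))
      ≤ s * (expit (t + 2 * s) - expit (t + -2 * s)) := by
  have h1 : 50 * expit (t + 1 / 2 * s) ≤ expit (t + 1 * s) := by
    unfold expit
    rw [← mul_div_assoc, div_le_div_iff₀ (one_add_exp_pos _) (one_add_exp_pos _)]
    have e : Real.exp (t + 1 * s) = Real.exp (t + 1 / 2 * s) * Real.exp (s / 2) := by
      rw [← Real.exp_add]; congr 1; ring
    have h100 : 100 ≤ Real.exp (s / 2) :=
      exp_five_ge.trans (Real.exp_le_exp.2 (by linarith))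
    have hle : Real.exp (t + 1 * s) ≤ 1 := Real.exp_le_one_iff.2 (by linarith)
    have hp := Real.exp_pos (t + 1 / 2 * s)
    have : Real.exp (t + 1 / 2 * s) * 100 ≤ Real.exp (t + 1 * s) := by rw [e]; gcongr
    have hq := Real.exp_pos (t + 1 * s)
    nlinarith
  have h2 : expit (t + 1 * s) ≤ expit (t + 2 * s) := monotone_expit (by linarith)
  have h3 : expit (t + -2 * s) ≤ expit (t + 1 / 2 * s) := monotone_expit (by linarith)
  have h4 := expit_nonneg (t + -(1 / 2) * s)
  have : 49 * (expit (t + 1 / 2 * s) - expit (t + -(1 / 2) * s))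
      ≤ expit (t + 2 * s) - expit (t + -2 * s) := by linarith
  nlinarith

/-- If `t + s ≤ 0` or `t - s ≥ 0`, the whole inner interval lies in one exponential tail; the second
case reflects to the first. Otherwise the outer interval crosses the transition of `expit`, and its
increment times `s ≥ 10` would be at least `8`. -/
theorem expit_increment_far_of_pos {t s : ℝ} (hs : 10 ≤ s)
    (hinc : s * (expit (t + 2 * s) - expit (t + -2 * s)) ≤ 6) :
    49 * (s * (expit (t + 1 / 2 * s) - expit (t + -(1 / 2) * s)))
      ≤ s * (expit (t + 2 * s) - expit (t + -2 * s)) := by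
  by_cases h1 : t + s ≤ 0
  · exact expit_increment_far_of_neg hs h1
  by_cases h2 : 0 ≤ t - s
  · have h := expit_increment_far_of_neg (t := -t) hs (by linarith)
    have e1 : expit (-t + 1 / 2 * s) = 1 - expit (t + -(1 / 2) * s) := by
      rw [← expit_neg]; congr 1; ring
    have e2 : expit (-t + -(1 / 2) * s) = 1 - expit (t + 1 / 2 * s) := by
      rw [← expit_neg]; congr 1; ring
    have e3 : expit (-t + 2 * s) = 1 - expit (t + -2 * s) := by
      rw [← expit_neg]; congr 1; ring
    have e4 : expit (-t + -2 * s) = 1 - expit (t + 2 * s) := by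
      rw [← expit_neg]; congr 1; ring
    rw [e1, e2, e3, e4] at h
    linarith
  · exfalso
    push Not at h1 h2
    have h5 : (0.9 : ℝ) ≤ expit 5 := by
      unfold expit
      rw [le_div_iff₀ (one_add_exp_pos _)]
      linarith [exp_five_ge]
    have a1 : expit 5 ≤ expit (t + 2 * s) := monotone_expit (by linarith)
    have a2 : expit (t + -2 * s) ≤ expit (-5) := monotone_expit (by linarith)
    rw [expit_neg] at a2
    nlinarith

theorem expit_increment_far {t s : ℝ} (hs : 10 ≤ |s|)
    (hinc : s * (expit (t + 2 * s) - expit (t + -2 * s)) ≤ 6) :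
    49 * (s * (expit (t + 1 / 2 * s) - expit (t + -(1 / 2) * s)))
      ≤ s * (expit (t + 2 * s) - expit (t + -2 * s)) := by
  rcases le_total 0 s with h | h
  · rw [abs_of_nonneg h] at hs
    exact expit_increment_far_of_pos hs hinc
  · rw [abs_of_nonpos h] at hs
    have := expit_increment_far_of_pos (t := t) (s := -s) hs (by
      have e1 : t + 2 * -s = t + -2 * s := by ring
      have e2 : t + -2 * -s = t + 2 * s := by ring
      rw [e1, e2]; linarith)
    have e1 : t + 2 * -s = t + -2 * s := by ring
    have e2 : t + -2 * -s = t + 2 * s := by ring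
    have e3 : t + 1 / 2 * -s = t + -(1 / 2) * s := by ring
    have e4 : t + -(1 / 2) * -s = t + 1 / 2 * s := by ring
    rw [e1, e2, e3, e4] at this
    linarith

/-- The points `t ± s/2` stay within distance `5` of `t`, where the derivative is at most `e⁵` times
its value at `t`. -/
theorem expit_increment_near {t s : ℝ} (hs : |s| ≤ 10) :
    s * (expit (t + 1 / 2 * s) - expit (t + -(1 / 2) * s))
      ≤ Real.exp 5 * (expitDeriv t * s ^ 2) := by
  have hlip : |expit (t + 1 / 2 * s) - expit (t + -(1 / 2) * s)|
      ≤ Real.exp 5 * expitDeriv t * |(t + 1 / 2 * s) - (t + -(1 / 2) * s)| := by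
    have := Convex.norm_image_sub_le_of_norm_hasDerivWithin_le (f := expit) (f' := expitDeriv)
      (s := Metric.closedBall t 5) (C := Real.exp 5 * expitDeriv t)
      (x := t + -(1 / 2) * s) (y := t + 1 / 2 * s)
      (fun x _ => (hasDerivAt_expit x).hasDerivWithinAt) (fun x hx => by
        rw [Real.norm_of_nonneg (expitDeriv_pos x).le]
        refine (expitDeriv_le_exp_mul x t).trans ?_
        have : |x - t| ≤ 5 := by simpa [Real.dist_eq] using hx
        have := (expitDeriv_pos t).le
        gcongr) (convex_closedBall t 5) ?_ ?_
    · simpa using this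
    · simp only [Metric.mem_closedBall, Real.dist_eq]
      rw [show t + -(1 / 2) * s - t = -(1 / 2) * s by ring, abs_mul]
      norm_num; linarith
    · simp only [Metric.mem_closedBall, Real.dist_eq]
      rw [show t + (1 / 2) * s - t = (1 / 2) * s by ring, abs_mul]
      norm_num; linarith
  rw [show (t + 1 / 2 * s) - (t + -(1 / 2) * s) = s by ring] at hlip
  calc _ ≤ |s| * |expit (t + 1 / 2 * s) - expit (t + -(1 / 2) * s)| := by
        rw [← abs_mul]; exact le_abs_self _
    _ ≤ |s| * (Real.exp 5 * expitDeriv t * |s|) := by gcongr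
    _ = Real.exp 5 * (expitDeriv t * |s| ^ 2) := by ring
    _ = _ := by rw [sq_abs]

/-- Uniform closeness of convex functions gives closeness of first derivatives only; the curvature
at `0` is recovered from the shape of `softplus`. The slope must increase by a definite amount over
`[-1/2, 1/2]`. Terms with `|s i| ≥ 10` contribute at most `1/49` of their increment over `[-2, 2]`,
and those increments total at most `6`, so the terms with bounded `s i` carry most of it. For them
an increment is bounded by the curvature at `0`. -/
theorem sum_expitDeriv_ge_of_approx {ι : Type*} [Fintype ι] (t s : ι → ℝ) (a₀ a₁ : ℝ)
    (h : ∀ r : ℝ, |r| ≤ 3 →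
      |∑ i, softplus (t i + r * s i) - (a₀ + a₁ * r + r ^ 2 / 2)| ≤ 1 / 100) :
    Real.exp (-5) / 5 ≤ ∑ i, expitDeriv (t i) * s i ^ 2 := by
  set f : ℝ → ℝ := fun r => ∑ i, softplus (t i + r * s i) with hf
  set D : ℝ → ℝ := fun r => ∑ i, s i * expit (t i + r * s i) with hD
  have htan : ∀ r r', f r + D r * (r' - r) ≤ f r' := fun r r' => by
    simp only [hf, hD, Finset.sum_mul, ← Finset.sum_add_distrib]
    refine Finset.sum_le_sum fun i _ => ?_
    have := softplus_tangent (t i + r * s i) (t i + r' * s i)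
    linarith
  have hap : ∀ r : ℝ, |r| ≤ 3 → |f r - (a₀ + a₁ * r + r ^ 2 / 2)| ≤ 1 / 100 := h
  have v2 := abs_le.1 (hap 2 (by norm_num))
  have v3 := abs_le.1 (hap 3 (by norm_num))
  have w2 := abs_le.1 (hap (-2) (by norm_num))
  have w3 := abs_le.1 (hap (-3) (by norm_num))
  have v0 := abs_le.1 (hap 0 (by norm_num))
  have vh := abs_le.1 (hap (1 / 2) (by norm_num [abs_of_pos]))
  have wh := abs_le.1 (hap (-(1 / 2)) (by norm_num [abs_of_pos]))
  have t1 := htan 2 3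
  have t2 := htan (-2) (-3)
  have t3 := htan (1 / 2) 0
  have t4 := htan (-(1 / 2)) 0
  -- Tangent inequalities and the quadratic model bound the outer slope change by `5.04` and the
  -- inner one from below by `0.42`.
  have hbig : D 2 - D (-2) ≤ 6 := by linarith
  have hsmall : 2 / 5 ≤ D (1 / 2) - D (-(1 / 2)) := by linarith
  set I : ι → ℝ := fun i => s i * (expit (t i + 2 * s i) - expit (t i + -2 * s i)) with hI
  set m : ι → ℝ := fun i =>
    s i * (expit (t i + 1 / 2 * s i) - expit (t i + -(1 / 2) * s i)) with hm
  have hI0 : ∀ i, 0 ≤ I i := fun i => expit_increment_nonneg _ _ (by norm_num)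
  have hIs : ∑ i, I i ≤ 6 := by
    refine le_trans (le_of_eq ?_) hbig
    simp only [hI, hD, ← Finset.sum_sub_distrib]
    exact Finset.sum_congr rfl fun i _ => by ring
  have hms : 2 / 5 ≤ ∑ i, m i := by
    refine hsmall.trans (le_of_eq ?_)
    simp only [hm, hD, ← Finset.sum_sub_distrib]
    exact Finset.sum_congr rfl fun i _ => by ring
  have hI6 : ∀ i, I i ≤ 6 := fun i =>
    (Finset.single_le_sum (fun j _ => hI0 j) (Finset.mem_univ i)).trans hIs
  have hmi : ∀ i, m i ≤ Real.exp 5 * (expitDeriv (t i) * s i ^ 2) + I i / 49 := fun i => by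
    have hnn : 0 ≤ Real.exp 5 * (expitDeriv (t i) * s i ^ 2) := by
      have := (expitDeriv_pos (t i)).le
      positivity
    rcases le_total |s i| 10 with hs | hs
    · have := expit_increment_near (t := t i) hs
      have := hI0 i
      simp only [hm]
      linarith
    · have := expit_increment_far (t := t i) hs (hI6 i)
      simp only [hm, hI]
      linarith
  have := Finset.sum_le_sum fun i (_ : i ∈ Finset.univ) => hmi i
  rw [Finset.sum_add_distrib, ← Finset.mul_sum, ← Finset.sum_div] at this
  have h5 : 1 / 5 ≤ Real.exp 5 * ∑ i, expitDeriv (t i) * s i ^ 2 := by linarith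
  rw [Real.exp_neg]
  have hp := Real.exp_pos 5
  rw [inv_eq_one_div, div_div, div_le_iff₀ (by positivity)]
  linarith

/-! ### Elementary inequalities -/

/-- With `w = √ρ`, the bound `log (1/w) ≤ 1/w - 1` makes the right-hand side at least the perfect
square `(1/w - 1)²`. This is the expected loss from a wrong variance. -/
theorem log_add_inv_sub_one_ge {ρ Λ : ℝ} (hρ : 0 < ρ) (hρΛ : ρ ≤ Λ) (hΛ : 1 ≤ Λ) :
    (ρ - 1) ^ 2 / (Λ * (1 + Λ) ^ 2) ≤ Real.log ρ + 1 / ρ - 1 := by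
  set w := Real.sqrt ρ with hw
  have hw0 : 0 < w := Real.sqrt_pos.2 hρ
  have hww : w ^ 2 = ρ := Real.sq_sqrt hρ.le
  have hwΛ : w ≤ Λ := by
    refine Real.sqrt_le_iff.2 ⟨by linarith, ?_⟩
    nlinarith
  have hlog : Real.log ρ = -2 * Real.log (1 / w) := by
    rw [← hww, Real.log_pow, one_div, Real.log_inv]; push_cast; ring
  have h1 : Real.log (1 / w) ≤ 1 / w - 1 := Real.log_le_sub_one_of_pos (by positivity)
  have h2 : (1 / w - 1) ^ 2 ≤ Real.log ρ + 1 / ρ - 1 := by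
    rw [hlog, ← hww]
    have : (1 / w - 1) ^ 2 = 1 / w ^ 2 - 2 * (1 / w) + 1 := by ring
    rw [this]; linarith
  refine le_trans ?_ h2
  have e : (1 / w - 1) ^ 2 = (ρ - 1) ^ 2 / (ρ * (1 + w) ^ 2) := by
    rw [← hww]; field_simp; ring
  rw [e]
  gcongr

/-- Uniform control of the sums `∑ aᵢ / (1 - c qᵢ)` by the moments of the weights `aᵢ`. -/
theorem abs_sum_div_one_sub_le {ι : Type*} [Fintype ι] (a q : ι → ℝ) {c r M : ℝ}
    (hq0 : ∀ i, 0 ≤ q i) (hq1 : ∀ i, q i ≤ 1) (hc : 0 ≤ c) (hcr : c ≤ r) (hr : r < 1)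
    (hM : 0 ≤ M)
    (h : ∑' n : ℕ, ENNReal.ofReal (r ^ n * |∑ i, a i * q i ^ n|) ≤ ENNReal.ofReal M) :
    |∑ i, a i / (1 - c * q i)| ≤ M := by
  have hcq : ∀ i, c * q i < 1 := fun i => by nlinarith [hq0 i, hq1 i]
  have hs : HasSum (fun n : ℕ => c ^ n * ∑ i, a i * q i ^ n) (∑ i, a i / (1 - c * q i)) := by
    have : (fun n : ℕ => c ^ n * ∑ i, a i * q i ^ n) = fun n => ∑ i, a i * (c * q i) ^ n := by
      ext n
      rw [Finset.mul_sum]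
      exact Finset.sum_congr rfl fun i _ => by rw [mul_pow]; ring
    rw [this]
    refine hasSum_sum fun i _ => ?_
    rw [div_eq_mul_inv]
    exact (hasSum_geometric_of_lt_one (mul_nonneg hc (hq0 i)) (hcq i)).mul_left _
  have hfin : ∀ s : Finset ℕ, ∑ n ∈ s, r ^ n * |∑ i, a i * q i ^ n| ≤ M := fun s => by
    have h0 : ∀ n ∈ s, 0 ≤ r ^ n * |∑ i, a i * q i ^ n| := fun n _ => by
      have : 0 ≤ r := hc.trans hcr
      positivity
    have := (ENNReal.sum_le_tsum (f := fun n : ℕ =>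
      ENNReal.ofReal (r ^ n * |∑ i, a i * q i ^ n|)) s).trans h
    rw [← ENNReal.ofReal_sum_of_nonneg h0] at this
    exact (ENNReal.ofReal_le_ofReal_iff hM).1 this
  refine le_of_tendsto (hs.abs) (Eventually.of_forall fun s => ?_)
  refine (Finset.abs_sum_le_sum_abs _ _).trans ((Finset.sum_le_sum fun n _ => ?_).trans (hfin s))
  rw [abs_mul, abs_of_nonneg (pow_nonneg hc n)]
  gcongr

/-! ### Quadratic forms and the Frobenius norm -/

section Matrices

variable {ι : Type*} [Fintype ι]

/-- The quadratic form `vᵀ A v`. -/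
def qf (A : Matrix ι ι ℝ) (v : ι → ℝ) : ℝ := v ⬝ᵥ (A *ᵥ v)

theorem dotProduct_self_nonneg' (v : ι → ℝ) : 0 ≤ v ⬝ᵥ v :=
  Finset.sum_nonneg fun i _ => mul_self_nonneg (v i)

theorem dotProduct_self_eq_sum_sq (v : ι → ℝ) : v ⬝ᵥ v = ∑ i, v i ^ 2 :=
  Finset.sum_congr rfl fun i _ => (sq (v i)).symm

theorem norm_toLp_sq (v : ι → ℝ) : ‖WithLp.toLp 2 v‖ ^ 2 = v ⬝ᵥ v := by
  rw [EuclideanSpace.norm_sq_eq, dotProduct_self_eq_sum_sq]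
  simp

theorem norm_sq_eq_dotProduct (v : EuclideanSpace ℝ ι) : ‖v‖ ^ 2 = v.ofLp ⬝ᵥ v.ofLp := by
  rw [← norm_toLp_sq]

theorem dotProduct_sq_le (v w : ι → ℝ) : (v ⬝ᵥ w) ^ 2 ≤ (v ⬝ᵥ v) * (w ⬝ᵥ w) := by
  rw [dotProduct_self_eq_sum_sq, dotProduct_self_eq_sum_sq]
  exact Finset.sum_mul_sq_le_sq_mul_sq _ _ _

theorem frob_nonneg (A : Matrix ι ι ℝ) : 0 ≤ frob A := Real.sqrt_nonneg _

theorem frob_sq (A : Matrix ι ι ℝ) : frob A ^ 2 = ∑ i, ∑ j, A i j ^ 2 := by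
  have e : (Aᵀ * A).trace = ∑ j, ∑ i, A i j ^ 2 := by
    simp [Matrix.trace, Matrix.mul_apply, sq]
  unfold frob
  rw [e, Real.sq_sqrt (by positivity), Finset.sum_comm]

theorem frob_transpose (A : Matrix ι ι ℝ) : frob Aᵀ = frob A := by
  refine (pow_left_inj₀ (frob_nonneg _) (frob_nonneg _) two_ne_zero).1 ?_
  rw [frob_sq, frob_sq, Finset.sum_comm]
  rfl

theorem mulVec_dotProduct_self_le (A : Matrix ι ι ℝ) (v : ι → ℝ) :
    (A *ᵥ v) ⬝ᵥ (A *ᵥ v) ≤ frob A ^ 2 * (v ⬝ᵥ v) := by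
  rw [frob_sq, dotProduct_self_eq_sum_sq, dotProduct_self_eq_sum_sq, Finset.sum_mul]
  exact Finset.sum_le_sum fun i _ => Finset.sum_mul_sq_le_sq_mul_sq _ _ _

theorem abs_dotProduct_mulVec_le (A : Matrix ι ι ℝ) (v w : ι → ℝ) :
    |v ⬝ᵥ (A *ᵥ w)| ≤ frob A * Real.sqrt (v ⬝ᵥ v) * Real.sqrt (w ⬝ᵥ w) := by
  have h1 := dotProduct_sq_le v (A *ᵥ w)
  have h2 := mulVec_dotProduct_self_le A w
  have h3 := dotProduct_self_nonneg' v
  have h4 := dotProduct_self_nonneg' w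
  have h5 := frob_nonneg A
  refine abs_le_of_sq_le_sq ?_ (by positivity)
  rw [mul_pow, mul_pow, Real.sq_sqrt h3, Real.sq_sqrt h4]
  calc _ ≤ (v ⬝ᵥ v) * (frob A ^ 2 * (w ⬝ᵥ w)) := h1.trans (by gcongr)
    _ = _ := by ring

theorem abs_qf_le (A : Matrix ι ι ℝ) (v : ι → ℝ) : |qf A v| ≤ frob A * (v ⬝ᵥ v) := by
  refine (abs_dotProduct_mulVec_le A v v).trans (le_of_eq ?_)
  rw [mul_assoc, Real.mul_self_sqrt (dotProduct_self_nonneg' v)]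

theorem qf_sub (A B : Matrix ι ι ℝ) (v : ι → ℝ) : qf (A - B) v = qf A v - qf B v := by
  simp [qf, Matrix.sub_mulVec, dotProduct_sub]

variable [DecidableEq ι]

/-- Put `y = J⁻¹ d`. Then `Λ |y|² ≤ y · d`, and Cauchy–Schwarz gives `(y · d)² ≤ |y|² |d|² ≤ (y · d)
|d|² / Λ`. Symmetry of `J` plays no role, and coercivity supplies invertibility. -/
theorem abs_dotProduct_inv_mulVec_le {J : Matrix ι ι ℝ} {Λ : ℝ} (hΛ : 0 < Λ)
    (h : ∀ v, Λ * (v ⬝ᵥ v) ≤ qf J v) (d : ι → ℝ) :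
    |d ⬝ᵥ (J⁻¹ *ᵥ d)| ≤ (d ⬝ᵥ d) / Λ := by
  have hinj : Function.Injective J.mulVec := by
    intro v w hvw
    have h0 : J *ᵥ (v - w) = 0 := by rw [Matrix.mulVec_sub]; exact sub_eq_zero.2 hvw
    have h1 := h (v - w)
    rw [qf, h0, dotProduct_zero] at h1
    have h2 := dotProduct_self_nonneg' (v - w)
    have h3 : (v - w) ⬝ᵥ (v - w) = 0 := by nlinarith
    exact sub_eq_zero.1 (dotProduct_self_eq_zero.1 h3)
  have hu : IsUnit J := Matrix.mulVec_injective_iff_isUnit.1 hinj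
  set y := J⁻¹ *ᵥ d with hy
  have hJy : J *ᵥ y = d := by
    rw [hy, Matrix.mulVec_mulVec, Matrix.mul_nonsing_inv _ ((Matrix.isUnit_iff_isUnit_det _).1 hu),
      Matrix.one_mulVec]
  have h1 := h y
  rw [qf, hJy] at h1
  have h2 : d ⬝ᵥ y = y ⬝ᵥ d := dotProduct_comm _ _
  have h3 := dotProduct_sq_le y d
  have hyy := dotProduct_self_nonneg' y
  have hdd := dotProduct_self_nonneg' d
  have hnn : 0 ≤ y ⬝ᵥ d := (mul_nonneg hΛ.le hyy).trans h1
  rw [h2, abs_of_nonneg hnn, le_div_iff₀ hΛ]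
  rcases hnn.eq_or_lt with h0 | h0
  · rw [← h0]; simpa using hdd
  · have : (y ⬝ᵥ d) * ((y ⬝ᵥ d) * Λ) ≤ (y ⬝ᵥ d) * (d ⬝ᵥ d) := by
      calc (y ⬝ᵥ d) * ((y ⬝ᵥ d) * Λ) = (y ⬝ᵥ d) ^ 2 * Λ := by ring
        _ ≤ ((y ⬝ᵥ y) * (d ⬝ᵥ d)) * Λ := by gcongr
        _ = (Λ * (y ⬝ᵥ y)) * (d ⬝ᵥ d) := by ring
        _ ≤ _ := by gcongr
    exact le_of_mul_le_mul_left this h0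

/-! ### Square roots and standardization of positive definite matrices. -/

section

open scoped MatrixOrder

theorem posSemidef_msqrt (B : Matrix ι ι ℝ) : (msqrt B).PosSemidef :=
  Matrix.nonneg_iff_posSemidef.1 (CFC.sqrt_nonneg B)

theorem msqrt_mul_self {B : Matrix ι ι ℝ} (hB : B.PosDef) : msqrt B * msqrt B = B :=
  CFC.sqrt_mul_sqrt_self B (Matrix.nonneg_iff_posSemidef.2 hB.posSemidef)

end

theorem transpose_msqrt (B : Matrix ι ι ℝ) : (msqrt B)ᵀ = msqrt B := by
  have := (posSemidef_msqrt B).isHermitian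
  rwa [Matrix.IsHermitian, Matrix.conjTranspose_eq_transpose_of_trivial] at this

theorem isUnit_det_msqrt {B : Matrix ι ι ℝ} (hB : B.PosDef) : IsUnit (msqrt B).det := by
  rw [isUnit_iff_ne_zero]
  intro h
  have := hB.det_pos
  rw [← msqrt_mul_self hB, Matrix.det_mul, h] at this
  simp at this

theorem transpose_minvsqrt (B : Matrix ι ι ℝ) : (minvsqrt B)ᵀ = minvsqrt B := by
  rw [minvsqrt, Matrix.transpose_nonsing_inv, transpose_msqrt]

theorem minvsqrt_mul_msqrt {B : Matrix ι ι ℝ} (hB : B.PosDef) : minvsqrt B * msqrt B = 1 :=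
  Matrix.nonsing_inv_mul _ (isUnit_det_msqrt hB)

theorem msqrt_mul_minvsqrt {B : Matrix ι ι ℝ} (hB : B.PosDef) : msqrt B * minvsqrt B = 1 :=
  Matrix.mul_nonsing_inv _ (isUnit_det_msqrt hB)

theorem minvsqrt_mul_self {B : Matrix ι ι ℝ} (hB : B.PosDef) :
    minvsqrt B * minvsqrt B = B⁻¹ := by
  rw [minvsqrt, ← Matrix.mul_inv_rev, msqrt_mul_self hB]

theorem minvsqrt_mulVec_msqrt {B : Matrix ι ι ℝ} (hB : B.PosDef) (v : ι → ℝ) :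
    minvsqrt B *ᵥ (msqrt B *ᵥ v) = v := by
  rw [Matrix.mulVec_mulVec, minvsqrt_mul_msqrt hB, Matrix.one_mulVec]

theorem msqrt_mulVec_minvsqrt {B : Matrix ι ι ℝ} (hB : B.PosDef) (v : ι → ℝ) :
    msqrt B *ᵥ (minvsqrt B *ᵥ v) = v := by
  rw [Matrix.mulVec_mulVec, msqrt_mul_minvsqrt hB, Matrix.one_mulVec]

omit [DecidableEq ι] in
theorem dotProduct_symm_mulVec {S : Matrix ι ι ℝ} (hS : Sᵀ = S) (v w : ι → ℝ) :
    v ⬝ᵥ (S *ᵥ w) = (S *ᵥ v) ⬝ᵥ w := by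
  rw [Matrix.dotProduct_mulVec, ← Matrix.mulVec_transpose, hS]

theorem qf_eq_msqrt {B : Matrix ι ι ℝ} (hB : B.PosDef) (v : ι → ℝ) :
    qf B v = (msqrt B *ᵥ v) ⬝ᵥ (msqrt B *ᵥ v) := by
  rw [← dotProduct_symm_mulVec (transpose_msqrt B), Matrix.mulVec_mulVec, msqrt_mul_self hB, qf]

theorem qf_nonneg {B : Matrix ι ι ℝ} (hB : B.PosDef) (v : ι → ℝ) : 0 ≤ qf B v := by
  rw [qf_eq_msqrt hB]; exact dotProduct_self_nonneg' _

theorem qf_minvsqrt {B : Matrix ι ι ℝ} (hB : B.PosDef) (u : ι → ℝ) :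
    qf B (minvsqrt B *ᵥ u) = u ⬝ᵥ u := by
  rw [qf_eq_msqrt hB, msqrt_mulVec_minvsqrt hB]

theorem dotProduct_self_le_qf {B : Matrix ι ι ℝ} (hB : B.PosDef) (v : ι → ℝ) :
    v ⬝ᵥ v ≤ frob B⁻¹ * qf B v := by
  rw [qf_eq_msqrt hB]
  set c := msqrt B *ᵥ v with hc
  have hv : v = minvsqrt B *ᵥ c := (minvsqrt_mulVec_msqrt hB v).symm
  have : v ⬝ᵥ v = qf B⁻¹ c := by
    rw [qf, ← minvsqrt_mul_self hB, ← Matrix.mulVec_mulVec,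
      dotProduct_symm_mulVec (transpose_minvsqrt B), ← hv]
  rw [this]
  exact (le_abs_self _).trans (abs_qf_le _ _)

/-- In the coordinates `c = B^{1/2} v` the difference of the two forms is the form of the
standardized error, and `|c|²` is `qf B v`. -/
theorem abs_qf_sub_le_of_standardized {B : Matrix ι ι ℝ} (hB : B.PosDef) (J : Matrix ι ι ℝ)
    (v : ι → ℝ) :
    |qf J v - qf B v| ≤ frob (minvsqrt B * J * minvsqrt B - 1) * qf B v := by
  have e : qf (minvsqrt B * J * minvsqrt B - 1) (msqrt B *ᵥ v) = qf J v - qf B v := by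
    rw [qf_sub]
    congr 1
    · rw [qf, ← Matrix.mulVec_mulVec, ← Matrix.mulVec_mulVec, minvsqrt_mulVec_msqrt hB,
        dotProduct_symm_mulVec (transpose_minvsqrt B), minvsqrt_mulVec_msqrt hB, qf]
    · rw [qf_eq_msqrt hB, qf, Matrix.one_mulVec]
  rw [← e, qf_eq_msqrt hB]
  exact abs_qf_le _ _

/-- Here `B'^{1/2} v = c + Aᵀ c` with `c = B^{1/2} v` and `A` the small matrix of the hypothesis.
Expanding the square costs `2η + η² ≤ 3η`. -/
theorem abs_qf_sub_le_of_msqrt {B B' : Matrix ι ι ℝ} (hB : B.PosDef) (hB' : B'.PosDef)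
    {η : ℝ} (hη1 : η ≤ 1) (h : frob (minvsqrt B * msqrt B' - 1) ≤ η) (v : ι → ℝ) :
    |qf B' v - qf B v| ≤ 3 * η * qf B v := by
  set A := minvsqrt B * msqrt B' - 1 with hA
  set c := msqrt B *ᵥ v with hc
  have hη0 : 0 ≤ η := (frob_nonneg A).trans h
  have e1 : msqrt B' *ᵥ v = c + Aᵀ *ᵥ c := by
    rw [hA, Matrix.transpose_sub, Matrix.transpose_mul, Matrix.transpose_one, transpose_msqrt,
      transpose_minvsqrt, Matrix.sub_mulVec, Matrix.one_mulVec, ← Matrix.mulVec_mulVec, hc,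
      minvsqrt_mulVec_msqrt hB]
    abel
  have e2 : qf B' v - qf B v = 2 * qf Aᵀ c + (Aᵀ *ᵥ c) ⬝ᵥ (Aᵀ *ᵥ c) := by
    rw [qf_eq_msqrt hB', qf_eq_msqrt hB, e1, qf]
    simp only [add_dotProduct, dotProduct_add]
    rw [dotProduct_comm (Aᵀ *ᵥ c) c]
    ring
  have h1 := abs_qf_le Aᵀ c
  have h2 := mulVec_dotProduct_self_le Aᵀ c
  have h3 := dotProduct_self_nonneg' (Aᵀ *ᵥ c)
  have hcc := dotProduct_self_nonneg' c
  rw [frob_transpose] at h1 h2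
  have h4 : frob A * (c ⬝ᵥ c) ≤ η * (c ⬝ᵥ c) := by gcongr
  have h5 : frob A ^ 2 * (c ⬝ᵥ c) ≤ η * (c ⬝ᵥ c) := by
    have : frob A ^ 2 ≤ η := by nlinarith [frob_nonneg A]
    gcongr
  rw [e2, qf_eq_msqrt hB v, ← hc]
  have := abs_le.1 h1
  rw [abs_le]
  constructor <;> linarith

end Matrices

/-! ### Convex functions on Euclidean space -/

/-- A vector of the ball is the average of its `K` coordinate vectors scaled by `K`, and each of
these lies on a segment between two of the test points. -/
theorem exists_bound_of_convexOn {ι : Type*} [Fintype ι] [DecidableEq ι] [Nonempty ι] {r C : ℝ}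
    (hr : 0 ≤ r) {h : EuclideanSpace ℝ ι → ℝ} (hc : ConvexOn ℝ Set.univ h)
    (h1 : ∀ i, h (EuclideanSpace.single i (Fintype.card ι * r)) ≤ C)
    (h2 : ∀ i, h (EuclideanSpace.single i (-(Fintype.card ι * r))) ≤ C)
    {u : EuclideanSpace ℝ ι} (hu : ‖u‖ ≤ r) : h u ≤ C := by
  set K : ℝ := (Fintype.card ι : ℝ) with hK
  have hK0 : 0 < K := by rw [hK]; exact_mod_cast Fintype.card_pos
  have hcoord : ∀ i, h (EuclideanSpace.single i (K * u i)) ≤ C := fun i => by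
    have hui : |u i| ≤ r := (PiLp.norm_apply_le u i).trans hu
    have hab := abs_le.1 hui
    have hmem : EuclideanSpace.single i (K * u i) ∈
        segment ℝ (EuclideanSpace.single i (-(K * r)) : EuclideanSpace ℝ ι)
          (EuclideanSpace.single i (K * r)) := by
      rcases hr.eq_or_lt with h0 | h0
      · have : u i = 0 := by rw [← h0] at hui; simpa using hui
        rw [this, ← h0]; simp
      · refine ⟨(r - u i) / (2 * r), (r + u i) / (2 * r), div_nonneg (by linarith) (by linarith),
          div_nonneg (by linarith) (by linarith), by field_simp; ring, ?_⟩
        ext j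
        by_cases hj : j = i
        · subst hj; simp; field_simp; ring
        · simp [hj]
    exact (hc.le_on_segment (Set.mem_univ _) (Set.mem_univ _) hmem).trans (max_le (h2 i) (h1 i))
  have hsum : u = ∑ i, (1 / K) • (EuclideanSpace.single i (K * u i) : EuclideanSpace ℝ ι) := by
    ext j
    simp [Finset.sum_apply, Pi.single_apply]
    field_simp
  have hw : ∑ _i : ι, 1 / K = 1 := by
    rw [Finset.sum_const, Finset.card_univ, nsmul_eq_mul, ← hK]; field_simp
  calc h u = h (∑ i, (1 / K) • (EuclideanSpace.single i (K * u i) : EuclideanSpace ℝ ι)) := by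
        rw [← hsum]
    _ ≤ ∑ i, (1 / K) • h (EuclideanSpace.single i (K * u i)) :=
        hc.map_sum_le (fun _ _ => by positivity) hw (fun _ _ => Set.mem_univ _)
    _ ≤ ∑ _i : ι, (1 / K) * C := Finset.sum_le_sum fun i _ => by
        rw [smul_eq_mul]; gcongr; exact hcoord i
    _ = C := by rw [← Finset.sum_mul, hw, one_mul]

/-- Two nonnegative convex functions, one of which is at most `‖u‖² / 2`, are uniformly close on a
ball as soon as they are close on a suitable finite set. -/
theorem exists_finset_uniform_of_convexOn (ι : Type*) [Fintype ι] [DecidableEq ι] {R η : ℝ}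
    (hR : 0 < R) (hη : 0 < η) :
    ∃ T : Finset (EuclideanSpace ℝ ι), ∃ η' > 0, ∀ h F : EuclideanSpace ℝ ι → ℝ,
      ConvexOn ℝ Set.univ h → ConvexOn ℝ Set.univ F → (∀ u, 0 ≤ h u) → (∀ u, 0 ≤ F u) →
      (∀ u, F u ≤ ‖u‖ ^ 2 / 2) → (∀ u ∈ T, |h u - F u| ≤ η') →
      ∀ u, ‖u‖ ≤ R → |h u - F u| ≤ η := by
  classical
  rcases isEmpty_or_nonempty ι with hι | hι
  · refine ⟨{0}, η, hη, fun h F _ _ _ _ _ hT u _ => ?_⟩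
    rw [Subsingleton.elim u 0]
    exact hT 0 (by simp)
  set K : ℝ := (Fintype.card ι : ℝ) with hK
  -- A convex function bounded by `C` in absolute value on the ball of radius `r` is `2C`-Lipschitz
  -- on the ball of radius `r - 1 = 2R`, which contains the closed ball of radius `R`.
  set r : ℝ := 2 * R + 1 with hr
  set C : ℝ := (K * r) ^ 2 / 2 + 1 + r ^ 2 with hC
  have hC0 : 0 < C := by positivity
  -- Moving both functions to the nearest net point costs `2Cδ = η/4` each, which leaves `η/2` for
  -- the net points.
  set δ : ℝ := η / (8 * C) with hδ
  have hδ0 : 0 < δ := by positivity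
  obtain ⟨T₁, hT₁sub, hT₁⟩ := (isCompact_closedBall (0 : EuclideanSpace ℝ ι) R).elim_finite_subcover_image
    (b := Metric.closedBall 0 R) (c := fun x => Metric.ball x δ) (fun _ _ => Metric.isOpen_ball)
    (fun x hx => Set.mem_biUnion hx (Metric.mem_ball_self hδ0))
  obtain ⟨hT₁f, hcov⟩ := hT₁
  refine ⟨hT₁f.toFinset
    ∪ (Finset.univ.image fun i : ι => EuclideanSpace.single i (K * r))
    ∪ (Finset.univ.image fun i : ι => EuclideanSpace.single i (-(K * r))), min (η / 2) 1,
    by positivity, fun h F hh hF hh0 hF0 hFle hT u hu => ?_⟩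
  have hr0 : 0 ≤ r := by positivity
  have hle : ∀ v ∈ hT₁f.toFinset
      ∪ (Finset.univ.image fun i : ι => EuclideanSpace.single i (K * r))
      ∪ (Finset.univ.image fun i : ι => EuclideanSpace.single i (-(K * r))),
      h v ≤ ‖v‖ ^ 2 / 2 + 1 := fun v hv => by
    have h1 := (le_abs_self _).trans ((hT v hv).trans (min_le_right _ _))
    linarith [hFle v]
  have hhC : ∀ v : EuclideanSpace ℝ ι, ‖v‖ ≤ r → h v ≤ C := fun v hv => by
    refine exists_bound_of_convexOn hr0 hh (fun i => ?_) (fun i => ?_) hv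
    · refine (hle _ (by simp [hK])).trans ?_
      rw [PiLp.norm_single, Real.norm_eq_abs, sq_abs, ← hK]
      linarith [sq_nonneg r]
    · refine (hle _ (by simp [hK])).trans ?_
      rw [PiLp.norm_single, Real.norm_eq_abs, sq_abs, ← hK, neg_sq]
      linarith [sq_nonneg r]
  have hFC : ∀ v : EuclideanSpace ℝ ι, ‖v‖ ≤ r → F v ≤ C := fun v hv => by
    refine (hFle v).trans ?_
    have : ‖v‖ ^ 2 ≤ r ^ 2 := by gcongr
    have : 0 ≤ (K * r) ^ 2 := sq_nonneg _
    linarith [sq_nonneg r]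
  have hlip : ∀ f : EuclideanSpace ℝ ι → ℝ, ConvexOn ℝ Set.univ f → (∀ v, 0 ≤ f v) →
      (∀ v, ‖v‖ ≤ r → f v ≤ C) → ∀ v w, ‖v‖ ≤ R → ‖w‖ ≤ R → |f v - f w| ≤ 2 * C * ‖v - w‖ := by
    intro f hf hf0 hfC v w hv hw
    have hl := ConvexOn.lipschitzOnWith_of_abs_le (f := f) (x₀ := 0) (r := r) (ε := 1) (M := C)
      (hf.subset (Set.subset_univ _) (convex_ball _ _)) one_pos (fun a ha => by
        rw [abs_of_nonneg (hf0 a)]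
        exact hfC a (by simpa using ha.le))
    have hRr : R < r - 1 := by rw [hr]; linarith
    have := hl.dist_le_mul v (by simpa using hv.trans_lt hRr) w (by simpa using hw.trans_lt hRr)
    rw [Real.dist_eq, dist_eq_norm, div_one, Real.coe_toNNReal _ (by positivity)] at this
    exact this
  have hu' : u ∈ Metric.closedBall (0 : EuclideanSpace ℝ ι) R := by simpa using hu
  obtain ⟨w, hwT, huw⟩ := Set.mem_iUnion₂.1 (hcov hu')
  have hwR : ‖w‖ ≤ R := by simpa using hT₁sub hwT
  have huw' : ‖u - w‖ ≤ δ := by simpa [dist_eq_norm] using (Metric.mem_ball.1 huw).le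
  have e1 := hlip h hh hh0 hhC u w hu hwR
  have e2 := hlip F hF hF0 hFC u w hu hwR
  have e3 := (hT w (by simp [hwT])).trans (min_le_left _ _)
  have e4 : 2 * C * ‖u - w‖ ≤ η / 4 := by
    calc 2 * C * ‖u - w‖ ≤ 2 * C * δ := by gcongr
      _ = η / 4 := by rw [hδ]; field_simp; norm_num
  rw [abs_le] at e1 e2 e3 ⊢
  constructor <;> linarith [e1.1, e1.2, e2.1, e2.2, e3.1, e3.2]

/-! ### Deterministic analysis of a localized log-likelihood

Around the true parameter the log-likelihood is described by linear functionals: `L j` and `x j`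
are the relative change of the `j`-th variance and the standardized change of the `j`-th mean, `ξ j`
is the `j`-th standardized residual, `t i` is the change of the `i`-th logit, `t₀ i` its value at
the true parameter and `a i` the `i`-th logistic residual. -/

structure LocalLik (V ι κ : Type*) [AddCommGroup V] [Module ℝ V] where
  x : ι → V →ₗ[ℝ] ℝ
  L : ι → V →ₗ[ℝ] ℝ
  ξ : ι → ℝ
  t : κ → V →ₗ[ℝ] ℝ
  t₀ : κ → ℝ
  a : κ → ℝ

namespace LocalLik

variable {V ι κ : Type*} [AddCommGroup V] [Module ℝ V] [Fintype ι] [Fintype κ]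
  (m : LocalLik V ι κ)

/-- The Gaussian part of the log-likelihood ratio. -/
noncomputable def gaussDiff (v : V) : ℝ :=
  ∑ j, (-(1 / 2) * Real.log (1 + m.L j v) - 1 / 2 * ((m.ξ j - m.x j v) ^ 2 / (1 + m.L j v))
    + 1 / 2 * m.ξ j ^ 2)

/-- The negative of the nonlinear part of the logistic log-likelihood ratio. -/
noncomputable def logitRem (v : V) : ℝ :=
  ∑ i, (softplus (m.t₀ i + m.t i v) - softplus (m.t₀ i) - expit (m.t₀ i) * m.t i v)

/-- The log-likelihood ratio. -/
noncomputable def diff (v : V) : ℝ :=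
  m.gaussDiff v + ∑ i, m.a i * m.t i v - m.logitRem v

/-- The Gaussian part of the observed information at `w` in the direction `v`. -/
noncomputable def gaussInfo (w v : V) : ℝ :=
  ∑ j, ((m.x j v * (1 / Real.sqrt (1 + m.L j w))
      + m.L j v * (1 / Real.sqrt (1 + m.L j w)) ^ 3 * (m.ξ j - m.x j w)) ^ 2
    - 1 / 2 * (m.L j v ^ 2 * (1 / Real.sqrt (1 + m.L j w)) ^ 4))

/-- The logistic part of the observed information at `w` in the direction `v`. -/
noncomputable def logitInfo (w v : V) : ℝ :=
  ∑ i, expitDeriv (m.t₀ i + m.t i w) * m.t i v ^ 2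

/-- The quadratic form `b` of the expected information splits along the mean coordinates
(projection `Pm`), the variance coordinates and the logit coordinates (projection `Pa`). -/
structure Splits (b : V → ℝ) (Pm Pa : V →ₗ[ℝ] V) : Prop where
  b_nonneg : ∀ v, 0 ≤ b v
  b_quad : ∀ u v, ∃ k, ∀ r : ℝ, b (u + r • v) = b u + r * k + r ^ 2 * b v
  b_split : ∀ v, b v = b (Pm v) + 1 / 2 * ∑ j, m.L j v ^ 2 + b (Pa v)
  L_Pm : ∀ j v, m.L j (Pm v) = 0
  x_Pm : ∀ j v, m.x j (Pm v) = m.x j v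
  t_Pm : ∀ i v, m.t i (Pm v) = 0
  L_Pa : ∀ j v, m.L j (Pa v) = 0
  x_Pa : ∀ j v, m.x j (Pa v) = 0
  t_Pa : ∀ i v, m.t i (Pa v) = m.t i v
  Pm_Pm : ∀ v, Pm (Pm v) = Pm v
  Pa_Pa : ∀ v, Pa (Pa v) = Pa v
  Pm_Pa : ∀ v, Pm (Pa v) = 0
  Pa_Pm : ∀ v, Pa (Pm v) = 0

variable {m}

/-- Writing `ξ² = 1 + (ξ² - 1)` separates each scalar log-ratio into two deterministic losses, for
the variance and for the mean, and two terms whose randomness is centred for fixed `v`. The losses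
are bounded through `ρ ≤ Λ`; the centred terms are kept exactly. -/
theorem gaussDiff_le {v : V} {Λ : ℝ} (hΛ : 1 ≤ Λ) (hpos : ∀ j, 0 < 1 + m.L j v)
    (hle : ∀ j, 1 + m.L j v ≤ Λ) :
    m.gaussDiff v ≤ -(1 / (2 * (Λ * (1 + Λ) ^ 2))) * ∑ j, m.L j v ^ 2
      - 1 / (2 * Λ) * ∑ j, m.x j v ^ 2
      + 1 / 2 * ∑ j, (m.ξ j ^ 2 - 1) * m.L j v / (1 + m.L j v)
      + ∑ j, m.ξ j * m.x j v / (1 + m.L j v) := by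
  unfold gaussDiff
  rw [Finset.mul_sum, Finset.mul_sum, Finset.mul_sum, ← Finset.sum_sub_distrib,
    ← Finset.sum_add_distrib, ← Finset.sum_add_distrib]
  refine Finset.sum_le_sum fun j _ => ?_
  set ρ := 1 + m.L j v with hρ
  have hL : m.L j v = ρ - 1 := by rw [hρ]; ring
  have h1 := log_add_inv_sub_one_ge (hpos j) (hle j) hΛ
  rw [← hρ] at h1
  have hρ0 : 0 < ρ := hpos j
  have h2 : 1 / Λ * m.x j v ^ 2 ≤ 1 / ρ * m.x j v ^ 2 := by
    have := one_div_le_one_div_of_le hρ0 (hle j)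
    gcongr
  have e1 : (m.ξ j - m.x j v) ^ 2 / ρ
      = 1 / ρ * m.ξ j ^ 2 - 2 * (m.ξ j * m.x j v / ρ) + 1 / ρ * m.x j v ^ 2 := by ring
  have e2 : (m.ξ j ^ 2 - 1) * m.L j v / ρ = (m.ξ j ^ 2 - 1) * (1 - 1 / ρ) := by
    rw [hL]; field_simp
  have e3 : -(1 / (2 * (Λ * (1 + Λ) ^ 2))) * m.L j v ^ 2
      = -(1 / 2) * ((ρ - 1) ^ 2 / (Λ * (1 + Λ) ^ 2)) := by
    rw [hL]; field_simp
  have e4 : 1 / (2 * Λ) * m.x j v ^ 2 = 1 / 2 * (1 / Λ * m.x j v ^ 2) := by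
    field_simp
  rw [e1, e2, e3, e4]
  linarith

theorem logitRem_nonneg (v : V) : 0 ≤ m.logitRem v :=
  Finset.sum_nonneg fun i _ => by
    have := softplus_tangent (m.t₀ i) (m.t₀ i + m.t i v)
    linarith

theorem convexOn_logitRem : ConvexOn ℝ Set.univ m.logitRem := by
  refine ⟨convex_univ, fun u _ v _ α β hα hβ hαβ => ?_⟩
  simp only [logitRem, smul_eq_mul, Finset.mul_sum, ← Finset.sum_add_distrib]
  refine Finset.sum_le_sum fun i _ => ?_
  have h := convexOn_softplus.2 (Set.mem_univ (m.t₀ i + m.t i u))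
    (Set.mem_univ (m.t₀ i + m.t i v)) hα hβ hαβ
  simp only [smul_eq_mul] at h
  have e : m.t₀ i + m.t i (α • u + β • v)
      = α * (m.t₀ i + m.t i u) + β * (m.t₀ i + m.t i v) := by
    simp only [map_add, map_smul, smul_eq_mul]
    linear_combination (-m.t₀ i) * hαβ
  rw [e, map_add, map_smul, map_smul, smul_eq_mul, smul_eq_mul]
  have e' : softplus (m.t₀ i) = (α + β) * softplus (m.t₀ i) := by rw [hαβ, one_mul]
  linarith

theorem logitRem_zero : m.logitRem 0 = 0 := by simp [logitRem]

section

variable {b : V → ℝ} {Pm Pa : V →ₗ[ℝ] V} (hs : m.Splits b Pm Pa)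
include hs

/-- The linear coefficient supplied by `b_quad` at the origin must vanish, since otherwise `b` would
be negative at a suitable multiple of `v`. -/
theorem Splits.b_smul (r : ℝ) (v : V) : b (r • v) = r ^ 2 * b v := by
  obtain ⟨k, hk⟩ := hs.b_quad 0 v
  have h0 : b 0 = 0 := by
    obtain ⟨k', hk'⟩ := hs.b_quad 0 0
    have h1 := hk' 1
    have h2 := hk' (-1)
    have h3 := hs.b_nonneg 0
    simp at h1 h2
    linarith
  have hk0 : k = 0 := by
    have h1 : ∀ r : ℝ, 0 ≤ r * k + r ^ 2 * b v := fun r => by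
      have := hk r
      rw [zero_add, h0, zero_add] at this
      rw [← this]; exact hs.b_nonneg _
    by_contra hne
    have hpos := hs.b_nonneg v
    have := h1 (-k / (b v + 1))
    have e : -k / (b v + 1) * k + (-k / (b v + 1)) ^ 2 * b v = -(k / (b v + 1)) ^ 2 := by
      field_simp; ring
    rw [e] at this
    have : 0 < (k / (b v + 1)) ^ 2 := by positivity
    linarith
  have := hk r
  rw [zero_add, h0, hk0] at this
  linarith

theorem Splits.b_zero : b 0 = 0 := by
  have := hs.b_smul 0 0
  simpa using this

theorem Splits.b_add_le (u v : V) : b (u + v) ≤ 2 * b u + 2 * b v := by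
  obtain ⟨k, hk⟩ := hs.b_quad u v
  have h1 := hk 1
  have h2 := hk (-1)
  have h3 := hs.b_nonneg (u + (-1 : ℝ) • v)
  rw [one_smul] at h1
  linarith

theorem Splits.info_Pm (v : V) : m.gaussInfo 0 (Pm v) + m.logitInfo 0 (Pm v)
    = ∑ j, m.x j v ^ 2 := by
  simp [gaussInfo, logitInfo, hs.L_Pm, hs.x_Pm, hs.t_Pm]

theorem Splits.info_sub_Pa (v : V) : m.gaussInfo 0 (v - Pa v) + m.logitInfo 0 (v - Pa v)
    = m.gaussInfo 0 v := by
  simp [gaussInfo, logitInfo, hs.L_Pa, hs.x_Pa, hs.t_Pa]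

theorem Splits.b_sub_Pa (v : V) :
    b (v - Pa v) = b (Pm v) + 1 / 2 * ∑ j, m.L j v ^ 2 := by
  rw [hs.b_split]
  simp [hs.L_Pa, hs.Pm_Pa, hs.Pa_Pa, hs.b_zero]

theorem Splits.logitRem_Pa (v : V) : m.logitRem (Pa v) = m.logitRem v := by
  simp [logitRem, hs.t_Pa]

end

/-- A convex function vanishing at `0` grows at least linearly along rays. On the sphere of radius
`r = 12M + 2` the quadratic model gives at least `r²/2 - 1/100 ≥ 6Mr`, and this slope persists
outside. -/
theorem Splits.mul_sqrt_le_logitRem {b : V → ℝ} {Pm Pa : V →ₗ[ℝ] V} (hs : m.Splits b Pm Pa)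
    {v : V} {M r R : ℝ} (hM : 0 < M) (hr : r = 12 * M + 2) (hR : r ≤ R)
    (hrem : ∀ u, b (Pa u) ≤ R ^ 2 → |m.logitRem u - b (Pa u) / 2| ≤ 1 / 100)
    (hv : r ≤ Real.sqrt (b (Pa v))) : 6 * M * Real.sqrt (b (Pa v)) ≤ m.logitRem v := by
  set z := Real.sqrt (b (Pa v)) with hz
  have hzz : z ^ 2 = b (Pa v) := Real.sq_sqrt (hs.b_nonneg _)
  have hr0 : 0 < r := by rw [hr]; positivity
  have hz1 : 0 < z := by linarith
  have hlam : r / z ≤ 1 := (div_le_one hz1).2 hv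
  have hlam0 : 0 ≤ r / z := by positivity
  have hcv := (m.convexOn_logitRem).2 (Set.mem_univ v) (Set.mem_univ 0) hlam0
    (sub_nonneg.2 hlam) (by ring)
  rw [smul_zero, add_zero, logitRem_zero, smul_zero, add_zero, smul_eq_mul] at hcv
  have hbr : b (Pa ((r / z) • v)) = r ^ 2 := by
    rw [map_smul, hs.b_smul, ← hzz]; field_simp
  have hh := hrem ((r / z) • v) (by rw [hbr]; gcongr)
  rw [hbr] at hh
  have hh' := (abs_le.1 hh).1
  have h4 : r ^ 2 / 2 - 1 / 100 ≤ r / z * m.logitRem v := by linarith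
  have h5 : r * (6 * M) ≤ r / z * m.logitRem v := by
    refine le_trans ?_ h4
    rw [hr]; nlinarith
  have h6 : r * (6 * M * z) ≤ r * m.logitRem v := by
    calc r * (6 * M * z) = r * (6 * M) * z := by ring
      _ ≤ r / z * m.logitRem v * z := by gcongr
      _ = r * m.logitRem v := by field_simp
  exact le_of_mul_le_mul_left h6 hr0

/-- Here `y` is the Gaussian radius, `z` the logistic one. If `z ≥ r`, the growth of `ψ` absorbs the
score in `z`, which gives `z ≤ y` and `c y ≤ 3M`. If `z < r`, either `y ≤ r` or `y` dominates `z`,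
and then `c y ≤ 6M`. -/
theorem radius_le {c M r y z ψ : ℝ} (hc : 0 < c) (hM : 0 < M) (hr : 0 < r)
    (hmain : ψ ≤ -c * y ^ 2 + 3 * M * (y + z)) (hψ0 : 0 ≤ ψ)
    (hψ : r ≤ z → 6 * M * z ≤ ψ) : y ≤ r + 6 * M / c ∧ z ≤ r + 6 * M / c := by
  have hMc : 0 ≤ 6 * M / c := by positivity
  have hcy : 0 ≤ c * y ^ 2 := by positivity
  rcases le_or_gt r z with hrz | hrz
  · have hlow := hψ hrz
    have hzy : z ≤ y := by
      have : 3 * M * z ≤ 3 * M * y := by linarith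
      exact le_of_mul_le_mul_left this (by positivity)
    have hy1 : 0 < y := by linarith
    have hMz : 0 ≤ M * z := by nlinarith
    have h1 : c * y ≤ 3 * M := by
      have : (c * y) * y ≤ 3 * M * y := by linarith
      exact le_of_mul_le_mul_right this hy1
    have : y ≤ 6 * M / c := by
      rw [le_div_iff₀ hc]; linarith
    constructor <;> linarith
  · refine ⟨?_, by linarith⟩
    rcases le_or_gt y r with hyr | hyr
    · linarith
    · have hy1 : 0 < y := by linarith
      have hMyz : M * z ≤ M * y := by nlinarith
      have h1 : c * y ≤ 6 * M := by
        have : (c * y) * y ≤ 6 * M * y := by linarith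
        exact le_of_mul_le_mul_right this hy1
      have : y ≤ 6 * M / c := by
        rw [le_div_iff₀ hc]; linarith
      linarith

/-- A log-likelihood ratio can be nonnegative only at bounded distance, measured in the expected
information, from the true parameter. -/
theorem Splits.b_le_of_diff_nonneg {b : V → ℝ} {Pm Pa : V →ₗ[ℝ] V} (hs : m.Splits b Pm Pa)
    {v : V} {Λ M R κ : ℝ} (hΛ : 1 ≤ Λ) (hM : 0 < M) (hR : 12 * M + 2 ≤ R) (hκ : κ ≤ 1 / 2)
    (hinfo : ∀ u, |m.gaussInfo 0 u + m.logitInfo 0 u - b u| ≤ κ * b u)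
    (hpos : ∀ j, 0 < 1 + m.L j v) (hle : ∀ j, 1 + m.L j v ≤ Λ)
    (h1 : |∑ j, (m.ξ j ^ 2 - 1) * m.L j v / (1 + m.L j v)| ≤ M * Real.sqrt (b v))
    (h2 : |∑ j, m.ξ j * m.x j v / (1 + m.L j v)| ≤ M * Real.sqrt (b v))
    (h3 : |∑ i, m.a i * m.t i v| ≤ M * Real.sqrt (b v))
    (hrem : ∀ u, b (Pa u) ≤ R ^ 2 → |m.logitRem u - b (Pa u) / 2| ≤ 1 / 100)
    (hdiff : 0 ≤ m.diff v) :
    b v ≤ (2 * (12 * M + 2 + 24 * M * (Λ * (1 + Λ) ^ 2))) ^ 2 := by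
  set D := Λ * (1 + Λ) ^ 2 with hD
  have hD0 : 0 < D := by positivity
  -- Chosen so that `2c` is the coefficient of `∑ L²` in `gaussDiff_le` and, as `Λ ≤ D`, at most
  -- that of `∑ x²`; the remaining factor two absorbs `b (Pm v) ≤ 2 ∑ x²`.
  set c := 1 / (4 * D) with hc
  have hc0 : 0 < c := by positivity
  have hg := gaussDiff_le hΛ hpos hle
  set SL := ∑ j, m.L j v ^ 2 with hSL
  set SX := ∑ j, m.x j v ^ 2 with hSX
  have hL0 : 0 ≤ SL := Finset.sum_nonneg fun _ _ => sq_nonneg _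
  have hxx : 0 ≤ SX := Finset.sum_nonneg fun _ _ => sq_nonneg _
  have hbm := hs.b_nonneg (Pm v)
  have hY0 : 0 ≤ b (Pm v) + 1 / 2 * SL := by positivity
  set y := Real.sqrt (b (Pm v) + 1 / 2 * SL) with hy
  set z := Real.sqrt (b (Pa v)) with hz
  have hy0 : 0 ≤ y := Real.sqrt_nonneg _
  have hz0 : 0 ≤ z := Real.sqrt_nonneg _
  have hyy : y ^ 2 = b (Pm v) + 1 / 2 * SL := Real.sq_sqrt hY0
  have hzz : z ^ 2 = b (Pa v) := Real.sq_sqrt (hs.b_nonneg _)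
  have hbv : b v = y ^ 2 + z ^ 2 := by rw [hyy, hzz, hs.b_split v]
  have hsb : Real.sqrt (b v) ≤ y + z := by
    rw [hbv]
    refine Real.sqrt_le_iff.2 ⟨by positivity, ?_⟩
    linarith [mul_nonneg hy0 hz0, add_sq y z]
  have hx : b (Pm v) ≤ 2 * SX := by
    have h4 := abs_le.1 (hinfo (Pm v))
    rw [hs.info_Pm] at h4
    have : κ * b (Pm v) ≤ 1 / 2 * b (Pm v) := by gcongr
    linarith
  have hDΛ : Λ ≤ D := by
    have : 1 ≤ (1 + Λ) ^ 2 := by nlinarith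
    exact le_mul_of_one_le_right (by linarith) this
  have hMb : 0 ≤ M * Real.sqrt (b v) := by positivity
  have hgauss : m.gaussDiff v ≤ -c * y ^ 2 + 2 * (M * Real.sqrt (b v)) := by
    have e1 : 1 / (2 * D) = 2 * c := by rw [hc]; field_simp; norm_num
    have e2 : 2 * c ≤ 1 / (2 * Λ) := by
      rw [← e1]
      gcongr
    have e3 : 2 * c * SX ≤ 1 / (2 * Λ) * SX := by gcongr
    have e4 : c * b (Pm v) ≤ c * (2 * SX) := by gcongr
    have e5 : 0 ≤ c * SL := by positivity
    have a1 := le_of_abs_le h1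
    have a2 := le_of_abs_le h2
    rw [e1] at hg
    rw [hyy]
    linarith
  have hscore := le_of_abs_le h3
  have hM' : M * Real.sqrt (b v) ≤ M * (y + z) := by gcongr
  have hmain : m.logitRem v ≤ -c * y ^ 2 + 3 * M * (y + z) := by
    have : m.diff v = m.gaussDiff v + ∑ i, m.a i * m.t i v - m.logitRem v := rfl
    linarith
  obtain ⟨h5, h6⟩ := radius_le (r := 12 * M + 2) hc0 hM (by positivity) hmain
    (m.logitRem_nonneg v) (hs.mul_sqrt_le_logitRem hM rfl hR hrem)
  have e6 : 6 * M / c = 24 * M * D := by rw [hc]; field_simp; norm_num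
  rw [e6] at h5 h6
  set Q := 12 * M + 2 + 24 * M * D
  have h7 : y ^ 2 ≤ Q ^ 2 := by gcongr
  have h8 : z ^ 2 ≤ Q ^ 2 := by gcongr
  rw [hbv]
  linarith [sq_nonneg Q, mul_pow 2 Q 2]

/-- The information is a sum of squares `(P + δ)²` minus half of a rescaled `∑ L²`, where `P = x + L
ξ` is the value at `w = 0`. The perturbation `δ` is small in `ℓ²` without any bound on a single
residual: `L ξ` is replaced by `P - x`, and `∑ P²` is controlled by the information at `0`. -/
theorem gaussInfo_ge {v w : V} {τ lam R b μ : ℝ} (hb : 0 ≤ b) (hμ0 : 0 < μ) (hμ1 : μ ≤ 1)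
    (hτ : ∀ j, |1 / Real.sqrt (1 + m.L j w) - 1| ≤ τ)
    (hτ3 : ∀ j, |(1 / Real.sqrt (1 + m.L j w)) ^ 3 - 1| ≤ τ) (hτ0 : 0 ≤ τ) (hτ1 : τ ≤ 1)
    (hτ4 : ∀ j, (1 / Real.sqrt (1 + m.L j w)) ^ 4 ≤ 1 + τ)
    (hx : ∑ j, m.x j v ^ 2 ≤ 2 * b) (hL : ∑ j, m.L j v ^ 2 ≤ 2 * b)
    (hinfo : m.gaussInfo 0 v ≤ 2 * b) (hLκ : ∀ j, m.L j v ^ 2 ≤ lam ^ 2 * b)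
    (hxw : ∑ j, m.x j w ^ 2 ≤ 2 * R ^ 2) (hμ : 36 * τ ^ 2 + 24 * lam ^ 2 * R ^ 2 ≤ μ ^ 2) :
    m.gaussInfo 0 v - (4 * μ + τ) * b ≤ m.gaussInfo w v := by
  set α : ι → ℝ := fun j => 1 / Real.sqrt (1 + m.L j w) with hα
  set P : ι → ℝ := fun j => m.x j v + m.L j v * m.ξ j with hP
  set δ : ι → ℝ := fun j => (α j - 1) * m.x j v + (α j ^ 3 - 1) * (m.L j v * m.ξ j)
    - α j ^ 3 * (m.L j v * m.x j w) with hδ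
  have e0 : m.gaussInfo 0 v = ∑ j, P j ^ 2 - 1 / 2 * ∑ j, m.L j v ^ 2 := by
    rw [Finset.mul_sum, ← Finset.sum_sub_distrib]
    simp [gaussInfo, hP]
  have ew : m.gaussInfo w v = ∑ j, (P j + δ j) ^ 2 - 1 / 2 * ∑ j, m.L j v ^ 2 * α j ^ 4 := by
    rw [Finset.mul_sum, ← Finset.sum_sub_distrib]
    refine Finset.sum_congr rfl fun j _ => ?_
    simp only [hP, hδ, hα]
    ring
  have hPs : ∑ j, P j ^ 2 ≤ 3 * b := by linarith
  have hδs : ∑ j, δ j ^ 2 ≤ μ ^ 2 * b := by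
    have hτ0 : ∀ j, (α j - 1) ^ 2 ≤ τ ^ 2 := fun j => by
      rw [← sq_abs]; exact pow_le_pow_left₀ (abs_nonneg _) (hτ j) 2
    have hτ30 : ∀ j, (α j ^ 3 - 1) ^ 2 ≤ τ ^ 2 := fun j => by
      rw [← sq_abs]; exact pow_le_pow_left₀ (abs_nonneg _) (hτ3 j) 2
    have hα3 : ∀ j, (α j ^ 3) ^ 2 ≤ 4 := fun j => by
      have h := abs_le.1 (hτ3 j)
      have h1 : α j ^ 3 ≤ 2 := by linarith [h.2]
      have h2 : -2 ≤ α j ^ 3 := by linarith [h.1]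
      nlinarith
    have hj : ∀ j, δ j ^ 2 ≤ 9 * τ ^ 2 * m.x j v ^ 2 + 6 * τ ^ 2 * P j ^ 2
        + 12 * lam ^ 2 * b * m.x j w ^ 2 := fun j => by
      have t1 : δ j ^ 2 ≤ 3 * ((α j - 1) ^ 2 * m.x j v ^ 2
          + (α j ^ 3 - 1) ^ 2 * (m.L j v * m.ξ j) ^ 2
          + (α j ^ 3) ^ 2 * (m.L j v ^ 2 * m.x j w ^ 2)) := by
        simp only [hδ]
        set A := (α j - 1) * m.x j v
        set B := (α j ^ 3 - 1) * (m.L j v * m.ξ j)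
        set C := α j ^ 3 * (m.L j v * m.x j w)
        have : (A + B - C) ^ 2 ≤ 3 * (A ^ 2 + B ^ 2 + C ^ 2) := by
          nlinarith [sq_nonneg (A - B), sq_nonneg (A + C), sq_nonneg (B + C)]
        refine this.trans (le_of_eq ?_)
        simp only [A, B, C]
        ring
      have t2 : (α j - 1) ^ 2 * m.x j v ^ 2 ≤ τ ^ 2 * m.x j v ^ 2 := by
        have := hτ0 j
        gcongr
      have t3 : (α j ^ 3 - 1) ^ 2 * (m.L j v * m.ξ j) ^ 2
          ≤ τ ^ 2 * (2 * P j ^ 2 + 2 * m.x j v ^ 2) := by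
        have h1 := hτ30 j
        have h2 : (m.L j v * m.ξ j) ^ 2 ≤ 2 * P j ^ 2 + 2 * m.x j v ^ 2 := by
          simp only [hP]
          nlinarith [sq_nonneg (m.x j v + m.L j v * m.ξ j + m.x j v)]
        gcongr
      have t4 : (α j ^ 3) ^ 2 * (m.L j v ^ 2 * m.x j w ^ 2) ≤ 4 * (lam ^ 2 * b * m.x j w ^ 2) := by
        have h1 := hα3 j
        have h2 := hLκ j
        gcongr
      linarith
    calc ∑ j, δ j ^ 2 ≤ ∑ j, (9 * τ ^ 2 * m.x j v ^ 2 + 6 * τ ^ 2 * P j ^ 2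
        + 12 * lam ^ 2 * b * m.x j w ^ 2) := Finset.sum_le_sum fun j _ => hj j
      _ = 9 * τ ^ 2 * ∑ j, m.x j v ^ 2 + 6 * τ ^ 2 * ∑ j, P j ^ 2
        + 12 * lam ^ 2 * b * ∑ j, m.x j w ^ 2 := by
          rw [Finset.sum_add_distrib, Finset.sum_add_distrib, Finset.mul_sum, Finset.mul_sum,
            Finset.mul_sum]
      _ ≤ 9 * τ ^ 2 * (2 * b) + 6 * τ ^ 2 * (3 * b) + 12 * lam ^ 2 * b * (2 * R ^ 2) := by gcongr
      _ = (36 * τ ^ 2 + 24 * lam ^ 2 * R ^ 2) * b := by ring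
      _ ≤ μ ^ 2 * b := by gcongr
  -- Weighted Young inequality: the cross term `2Pδ` is traded for `μ P²` and `δ² / μ`, the latter
  -- at most `μ b` after summation.
  have hPδ : (1 - μ) * ∑ j, P j ^ 2 - μ * b ≤ ∑ j, (P j + δ j) ^ 2 := by
    have hj : ∀ j, (1 - μ) * P j ^ 2 - δ j ^ 2 / μ ≤ (P j + δ j) ^ 2 := fun j => by
      have : 0 ≤ (μ * P j + δ j) ^ 2 / μ := by positivity
      have e : (μ * P j + δ j) ^ 2 / μ = μ * P j ^ 2 + 2 * P j * δ j + δ j ^ 2 / μ := by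
        field_simp
        ring
      nlinarith [sq_nonneg (δ j)]
    have h1 := Finset.sum_le_sum fun j (_ : j ∈ Finset.univ) => hj j
    rw [Finset.sum_sub_distrib, ← Finset.mul_sum, ← Finset.sum_div] at h1
    have h2 : (∑ j, δ j ^ 2) / μ ≤ μ * b := by
      rw [div_le_iff₀ hμ0]; linarith
    linarith
  have hL4 : ∑ j, m.L j v ^ 2 * α j ^ 4 ≤ (1 + τ) * ∑ j, m.L j v ^ 2 := by
    rw [Finset.mul_sum]
    refine Finset.sum_le_sum fun j _ => ?_
    rw [mul_comm]
    have := hτ4 j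
    gcongr
  have h1 : τ * ∑ j, m.L j v ^ 2 ≤ τ * (2 * b) := by gcongr
  have h2 : μ * ∑ j, P j ^ 2 ≤ μ * (3 * b) := by gcongr
  rw [e0, ew]
  linarith

theorem inv_sqrt_bounds {ρ δ : ℝ} (h : |ρ - 1| ≤ δ) (hδ : δ ≤ 1 / 16) :
    |1 / Real.sqrt ρ - 1| ≤ 16 * δ ∧ |(1 / Real.sqrt ρ) ^ 3 - 1| ≤ 16 * δ ∧
      (1 / Real.sqrt ρ) ^ 4 ≤ 1 + 16 * δ := by
  have hab := abs_le.1 h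
  have hδ0 : 0 ≤ δ := (abs_nonneg _).trans h
  have hρ : 15 / 16 ≤ ρ := by linarith
  set w := 1 / Real.sqrt ρ with hw
  have hs : 0 < Real.sqrt ρ := Real.sqrt_pos.2 (by linarith)
  have hw0 : 0 < w := by positivity
  have hw2 : w ^ 2 * ρ = 1 := by
    rw [hw, div_pow, Real.sq_sqrt (by linarith)]; field_simp
  have hw2le : w ^ 2 ≤ 16 / 15 := by nlinarith
  have hwle : w ≤ 17 / 16 := by nlinarith
  have key : |w ^ 2 - 1| ≤ 2 * δ := by
    have e : w ^ 2 - 1 = w ^ 2 * (1 - ρ) := by linear_combination hw2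
    rw [e, abs_mul, abs_of_nonneg (sq_nonneg w), abs_sub_comm]
    nlinarith [abs_nonneg (ρ - 1)]
  have k1 : |w - 1| ≤ 2 * δ := by
    have e : w ^ 2 - 1 = (w - 1) * (w + 1) := by ring
    rw [e, abs_mul, abs_of_nonneg (by linarith : 0 ≤ w + 1)] at key
    nlinarith [abs_nonneg (w - 1)]
  have hk := abs_le.1 k1
  have hkk := abs_le.1 key
  refine ⟨by linarith, ?_, ?_⟩
  · have e : w ^ 3 - 1 = (w - 1) * (w ^ 2 + w + 1) := by ring
    rw [e, abs_mul, abs_of_nonneg (by positivity : 0 ≤ w ^ 2 + w + 1)]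
    have : w ^ 2 + w + 1 ≤ 4 := by linarith
    calc |w - 1| * (w ^ 2 + w + 1) ≤ 2 * δ * 4 := by gcongr
      _ ≤ _ := by linarith
  · have e : w ^ 4 = 1 + (w ^ 2 - 1) * (w ^ 2 + 1) := by ring
    rw [e]
    have : (w ^ 2 - 1) * (w ^ 2 + 1) ≤ 2 * δ * (w ^ 2 + 1) := by
      gcongr; exact hkk.2
    nlinarith

/-- The lower bound on the curvature of the logistic part. -/
noncomputable def curvConst : ℝ := Real.exp (-5) / 5

theorem curvConst_pos : 0 < curvConst := by unfold curvConst; positivity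

theorem curvConst_le : curvConst ≤ 1 / 5 := by
  unfold curvConst
  have : Real.exp (-5) ≤ 1 := Real.exp_le_one_iff.2 (by norm_num)
  linarith

/-- After normalizing `b (Pa v) = 1`, the line `w + r v` with `|r| ≤ 3` stays in the region of
quadratic approximation, because `b` there is at most `2 R₀² + 2 · 3²`. Along it the remainder is a
sum of softplus functions up to an affine term, so `sum_expitDeriv_ge_of_approx` applies. -/
theorem Splits.logitInfo_ge {b : V → ℝ} {Pm Pa : V →ₗ[ℝ] V} (hs : m.Splits b Pm Pa)
    {w v : V} {R₀ R : ℝ} (hw : b (Pa w) ≤ R₀ ^ 2) (hR : 2 * R₀ ^ 2 + 18 ≤ R ^ 2)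
    (hrem : ∀ u, b (Pa u) ≤ R ^ 2 → |m.logitRem u - b (Pa u) / 2| ≤ 1 / 100) :
    curvConst * b (Pa v) ≤ m.logitInfo w v := by
  have hnn : 0 ≤ m.logitInfo w v := Finset.sum_nonneg fun i _ =>
    mul_nonneg (expitDeriv_pos _).le (sq_nonneg _)
  rcases (hs.b_nonneg (Pa v)).eq_or_lt with h0 | h0
  · rw [← h0, mul_zero]; exact hnn
  set β := Real.sqrt (b (Pa v)) with hβ
  have hβ0 : 0 < β := Real.sqrt_pos.2 h0
  have hββ : β ^ 2 = b (Pa v) := Real.sq_sqrt h0.le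
  set v' := (1 / β) • v with hv'
  have hbv' : b (Pa v') = 1 := by
    rw [hv', map_smul, hs.b_smul, ← hββ]; field_simp
  obtain ⟨k, hk⟩ := hs.b_quad (Pa w) (Pa v')
  have key := sum_expitDeriv_ge_of_approx (fun i => m.t₀ i + m.t i w) (fun i => m.t i v')
    (b (Pa w) / 2 + ∑ i, (softplus (m.t₀ i) + expit (m.t₀ i) * m.t i w))
    (k / 2 + ∑ i, expit (m.t₀ i) * m.t i v') (fun r hr => by
      have hb1 : b (Pa (w + r • v')) = b (Pa w) + r * k + r ^ 2 := by
        rw [map_add, map_smul, hk, hbv', mul_one]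
      have hb2 : b (Pa (w + r • v')) ≤ R ^ 2 := by
        rw [map_add]
        refine (hs.b_add_le _ _).trans ?_
        rw [map_smul, hs.b_smul, hbv']
        have hr2 : r ^ 2 ≤ 9 := by
          rw [← sq_abs]
          nlinarith [abs_nonneg r]
        linarith
      have h := hrem _ hb2
      rw [hb1] at h
      convert h using 2
      have e : m.logitRem (w + r • v') = ∑ i, softplus (m.t₀ i + m.t i w + r * m.t i v')
          - ∑ i, (softplus (m.t₀ i) + expit (m.t₀ i) * m.t i w)
          - r * ∑ i, expit (m.t₀ i) * m.t i v' := by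
        rw [Finset.mul_sum, ← Finset.sum_sub_distrib, ← Finset.sum_sub_distrib]
        refine Finset.sum_congr rfl fun i _ => ?_
        rw [map_add, map_smul, smul_eq_mul, ← add_assoc]
        ring
      rw [e]
      ring)
  have e : m.logitInfo w v = β ^ 2 * ∑ i, expitDeriv (m.t₀ i + m.t i w) * m.t i v' ^ 2 := by
    rw [Finset.mul_sum]
    refine Finset.sum_congr rfl fun i _ => ?_
    rw [hv', map_smul, smul_eq_mul]
    field_simp
  rw [e, hββ, mul_comm]
  unfold curvConst
  gcongr

/-- At bounded distance from the true parameter the observed information is at least a fixed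
multiple of the expected information at the true parameter. -/
theorem Splits.info_ge {b : V → ℝ} {Pm Pa : V →ₗ[ℝ] V} (hs : m.Splits b Pm Pa)
    {w : V} {R₀ R κ : ℝ} (hR₀ : 1 ≤ R₀) (hw : b w ≤ R₀ ^ 2) (hR : 2 * R₀ ^ 2 + 18 ≤ R ^ 2)
    (hκ0 : 0 ≤ κ) (hκ : κ * R₀ ≤ 1 / 6400)
    (hinfo : ∀ u, |m.gaussInfo 0 u + m.logitInfo 0 u - b u| ≤ κ * b u)
    (hLκ : ∀ u j, m.L j u ^ 2 ≤ κ ^ 2 * b u)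
    (hrem : ∀ u, b (Pa u) ≤ R ^ 2 → |m.logitRem u - b (Pa u) / 2| ≤ 1 / 100) (v : V) :
    curvConst * b v ≤ m.gaussInfo w v + m.logitInfo w v := by
  have hκ1 : κ ≤ 1 / 6400 := by nlinarith
  have hb := hs.b_nonneg
  have hL0 : ∀ u, 0 ≤ ∑ j, m.L j u ^ 2 := fun u => Finset.sum_nonneg fun _ _ => sq_nonneg _
  have hwa : b (Pa w) ≤ R₀ ^ 2 := by
    have := hs.b_split w
    linarith [hb (Pm w), hL0 w]
  have hwm : b (Pm w) ≤ R₀ ^ 2 := by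
    have := hs.b_split w
    linarith [hb (Pa w), hL0 w]
  have hlog := hs.logitInfo_ge (v := v) hwa hR hrem
  set Y := b (Pm v) + 1 / 2 * ∑ j, m.L j v ^ 2 with hY
  have hY0 : 0 ≤ Y := by have := hb (Pm v); have := hL0 v; positivity
  have hxle : ∀ u, ∑ j, m.x j u ^ 2 ≤ 2 * b (Pm u) := fun u => by
    have h4 := (abs_le.1 (hinfo (Pm u))).2
    rw [hs.info_Pm] at h4
    have := mul_le_mul_of_nonneg_right (show κ ≤ 1 by linarith) (hb (Pm u))
    linarith
  -- Removing the exposure coordinates isolates the Gaussian information, which is thus close to its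
  -- own share `Y` of `b`.
  have hgi := abs_le.1 (hinfo (v - Pa v))
  rw [hs.info_sub_Pa, hs.b_sub_Pa, ← hY] at hgi
  have hκY : κ * Y ≤ 1 / 6400 * Y := by gcongr
  have hδ : ∀ j, |1 + m.L j w - 1| ≤ κ * R₀ := fun j => by
    rw [add_sub_cancel_left]
    refine abs_le_of_sq_le_sq ?_ (by positivity)
    refine (hLκ w j).trans ?_
    rw [mul_pow]
    gcongr
  have hδ1 : κ * R₀ ≤ 1 / 16 := by linarith
  have hδ0 : 0 ≤ κ * R₀ := by positivity
  have hbds := fun j => inv_sqrt_bounds (hδ j) hδ1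
  -- The loss is `4μ + τ ≤ 1/5 + 1/400`, which leaves more than `1/5 ≥ curvConst` of `Y`.
  have hg := gaussInfo_ge (m := m) (v := v) (w := w) (τ := 16 * (κ * R₀)) (lam := κ) (R := R₀)
    (b := Y) (μ := 1 / 20) hY0 (by norm_num) (by norm_num) (fun j => (hbds j).1)
    (fun j => (hbds j).2.1) (by positivity) (by linarith) (fun j => (hbds j).2.2)
    (by linarith [hxle v, hL0 v]) (by linarith [hb (Pm v)]) (by linarith)
    (fun j => by
      have h5 := hLκ (v - Pa v) j
      rwa [hs.b_sub_Pa, ← hY, map_sub, hs.L_Pa, sub_zero] at h5)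
    (by linarith [hxle w])
    (by
      have : (κ * R₀) ^ 2 ≤ (1 / 6400) ^ 2 := by gcongr
      rw [mul_pow] at this
      rw [mul_pow, mul_pow]
      linarith)
  have e : b v = Y + b (Pa v) := hs.b_split v
  have hc := curvConst_le
  have hcY : curvConst * Y ≤ 1 / 5 * Y := by gcongr
  have hκR : 16 * (κ * R₀) * Y ≤ 16 * (1 / 6400) * Y := by gcongr
  rw [e, mul_add]
  linarith

end LocalLik

/-! ### Diagonalization of the adjacency matrix -/

section Spectral

variable {p N : ℕ} (G : SimpleGraph (Fin N))

theorem transpose_adj : (adj G)ᵀ = adj G := by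
  classical
  ext i j
  simp only [adj, Matrix.transpose_apply, Matrix.of_apply]
  by_cases h : i = j
  · subst h; rfl
  · simp [h, Ne.symm h, G.adj_comm j i]

theorem isHermitian_adj : (adj G).IsHermitian := by
  rw [Matrix.IsHermitian, Matrix.conjTranspose_eq_transpose_of_trivial, transpose_adj]

/-- The orthogonal matrix of eigenvectors of the adjacency matrix. -/
noncomputable def eigU : Matrix (Fin N) (Fin N) ℝ := (isHermitian_adj G).eigenvectorUnitary

/-- The eigenvalues of the adjacency matrix. -/
noncomputable def eigVal : Fin N → ℝ := (isHermitian_adj G).eigenvalues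

theorem transpose_eigU_mul : (eigU G)ᵀ * eigU G = 1 := by
  have h := Unitary.coe_star_mul_self (isHermitian_adj G).eigenvectorUnitary
  rwa [Matrix.star_eq_conjTranspose, Matrix.conjTranspose_eq_transpose_of_trivial] at h

theorem eigU_mul_transpose : eigU G * (eigU G)ᵀ = 1 := by
  exact mul_eq_one_comm.1 (transpose_eigU_mul G)

theorem adj_eq : adj G = eigU G * Matrix.diagonal (eigVal G) * (eigU G)ᵀ := by
  have h := (isHermitian_adj G).spectral_theorem
  rw [Unitary.conjStarAlgAut_apply, Matrix.star_eq_conjTranspose,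
    Matrix.conjTranspose_eq_transpose_of_trivial] at h
  exact h

/-- Coordinates with respect to the eigenvectors of the adjacency matrix. -/
noncomputable def rot : (Fin N → ℝ) →ₗ[ℝ] (Fin N → ℝ) := Matrix.mulVecLin (eigU G)ᵀ

theorem rot_apply (w : Fin N → ℝ) : rot G w = (eigU G)ᵀ *ᵥ w := rfl

theorem smul_one_add_smul_adj_eq (a b : ℝ) :
    a • (1 : Matrix (Fin N) (Fin N) ℝ) + b • (adj G * (adj G)ᵀ)
      = eigU G * Matrix.diagonal (fun i => a + b * eigVal G i ^ 2) * (eigU G)ᵀ := by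
  have h1 : adj G * (adj G)ᵀ
      = eigU G * Matrix.diagonal (fun i => eigVal G i ^ 2) * (eigU G)ᵀ := by
    rw [transpose_adj]
    conv_lhs => rw [adj_eq]
    calc eigU G * Matrix.diagonal (eigVal G) * (eigU G)ᵀ
          * (eigU G * Matrix.diagonal (eigVal G) * (eigU G)ᵀ)
        = eigU G * Matrix.diagonal (eigVal G) * ((eigU G)ᵀ * eigU G)
          * Matrix.diagonal (eigVal G) * (eigU G)ᵀ := by simp only [Matrix.mul_assoc]
      _ = _ := by
        rw [transpose_eigU_mul, Matrix.mul_one, Matrix.mul_assoc (eigU G),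
          Matrix.diagonal_mul_diagonal]
        simp only [sq]
  have h2 : Matrix.diagonal (fun i => a + b * eigVal G i ^ 2)
      = a • (1 : Matrix (Fin N) (Fin N) ℝ) + b • Matrix.diagonal (fun i => eigVal G i ^ 2) := by
    ext i j
    by_cases hij : i = j
    · subst hij; simp
    · simp [hij]
  rw [h1, h2, Matrix.mul_add, Matrix.add_mul, Matrix.mul_smul, Matrix.smul_mul, Matrix.mul_one,
    eigU_mul_transpose, Matrix.mul_smul, Matrix.smul_mul]

/-- The eigenvectors of the adjacency matrix diagonalize all the covariance matrices simultaneously,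
so the rotation does not depend on the variance parameters. -/
theorem gaussLogLik_eq (a b : ℝ) (hpos : ∀ i, 0 < a + b * eigVal G i ^ 2) (w : Fin N → ℝ) :
    gaussLogLik (a • (1 : Matrix (Fin N) (Fin N) ℝ) + b • (adj G * (adj G)ᵀ)) w
      = -(N / 2 : ℝ) * Real.log (2 * Real.pi)
        + ∑ i, (-(1 / 2) * Real.log (a + b * eigVal G i ^ 2)
          - 1 / 2 * (rot G w i ^ 2 / (a + b * eigVal G i ^ 2))) := by
  set s : Fin N → ℝ := fun i => a + b * eigVal G i ^ 2 with hs
  have hS := smul_one_add_smul_adj_eq G a b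
  rw [hS]
  have hdet : (eigU G * Matrix.diagonal s * (eigU G)ᵀ).det = ∏ i, s i := by
    rw [Matrix.det_mul, Matrix.det_mul, mul_right_comm, ← Matrix.det_mul, eigU_mul_transpose,
      Matrix.det_one, one_mul, Matrix.det_diagonal]
  have hinv : (eigU G * Matrix.diagonal s * (eigU G)ᵀ)⁻¹
      = eigU G * Matrix.diagonal (fun i => (s i)⁻¹) * (eigU G)ᵀ := by
    refine Matrix.inv_eq_right_inv ?_
    calc eigU G * Matrix.diagonal s * (eigU G)ᵀ
          * (eigU G * Matrix.diagonal (fun i => (s i)⁻¹) * (eigU G)ᵀ)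
        = eigU G * (Matrix.diagonal s * ((eigU G)ᵀ * eigU G)
          * Matrix.diagonal (fun i => (s i)⁻¹)) * (eigU G)ᵀ := by simp only [Matrix.mul_assoc]
      _ = 1 := by
        rw [transpose_eigU_mul, Matrix.mul_one, Matrix.diagonal_mul_diagonal]
        have : (fun i => s i * (s i)⁻¹) = fun _ => (1 : ℝ) :=
          funext fun i => mul_inv_cancel₀ (hpos i).ne'
        rw [this, Matrix.diagonal_one, Matrix.mul_one, eigU_mul_transpose]
  have hq : w ⬝ᵥ ((eigU G * Matrix.diagonal (fun i => (s i)⁻¹) * (eigU G)ᵀ) *ᵥ w)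
      = ∑ i, rot G w i ^ 2 / s i := by
    rw [← Matrix.mulVec_mulVec, ← Matrix.mulVec_mulVec, Matrix.dotProduct_mulVec,
      ← Matrix.mulVec_transpose, ← rot_apply]
    refine Finset.sum_congr rfl fun i _ => ?_
    rw [Matrix.mulVec_diagonal]
    ring
  unfold gaussLogLik
  rw [hdet, hinv, hq, Real.log_prod (fun i _ => (hpos i).ne'), Finset.mul_sum, Finset.mul_sum,
    Finset.sum_sub_distrib]
  simp only [neg_mul, Finset.sum_neg_distrib]
  ring

/-! ### Linear structure of the model -/

/-- Variances of the residuals of the two equations in the eigenbasis; the outcome equation comes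
first. -/
noncomputable def resVar : Fin N ⊕ Fin N → Param p →ₗ[ℝ] ℝ
  | Sum.inl i =>
    { toFun := fun φ => sigmaSq φ 0 + sigmaSq φ 1 * eigVal G i ^ 2
      map_add' := fun φ ψ => by simp only [sigmaSq, PiLp.add_apply]; ring
      map_smul' := fun c φ => by
        simp only [sigmaSq, PiLp.smul_apply, smul_eq_mul, RingHom.id_apply]; ring }
  | Sum.inr i =>
    { toFun := fun φ => sigmaSq φ 2 + sigmaSq φ 3 * eigVal G i ^ 2
      map_add' := fun φ ψ => by simp only [sigmaSq, PiLp.add_apply]; ring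
      map_smul' := fun c φ => by
        simp only [sigmaSq, PiLp.smul_apply, smul_eq_mul, RingHom.id_apply]; ring }

theorem resVar_inl (i : Fin N) (φ : Param p) :
    resVar G (Sum.inl i) φ = sigmaSq φ 0 + sigmaSq φ 1 * eigVal G i ^ 2 := rfl

theorem resVar_inr (i : Fin N) (φ : Param p) :
    resVar G (Sum.inr i) φ = sigmaSq φ 2 + sigmaSq φ 3 * eigVal G i ^ 2 := rfl

theorem resVar_pos {φ : Param p} (h : ∀ k, 0 < sigmaSq φ k) (j : Fin N ⊕ Fin N) :
    0 < resVar G j φ := by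
  rcases j with i | i
  · have h0 := h 0; have h1 := h 1; rw [resVar_inl]; positivity
  · have h0 := h 2; have h1 := h 3; rw [resVar_inr]; positivity

/-- The mean of the outcomes as a linear function of the parameter. -/
noncomputable def outMeanLin (C : Fin N → Fin p → ℝ) (A M : Fin N → ℝ) :
    Param p →ₗ[ℝ] (Fin N → ℝ) where
  toFun φ := outMean G φ C A M
  map_add' φ ψ := by
    ext i
    simp only [outMean, betaS, beta5, beta6, dotProduct, PiLp.add_apply, Pi.add_apply, add_mul,
      Finset.sum_add_distrib]
    ring
  map_smul' c φ := by
    ext i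
    simp only [outMean, betaS, beta5, beta6, dotProduct, PiLp.smul_apply, smul_eq_mul,
      RingHom.id_apply, Pi.smul_apply, mul_assoc, ← Finset.mul_sum]
    ring

/-- The mean of the mediators as a linear function of the parameter. -/
noncomputable def medMeanLin (C : Fin N → Fin p → ℝ) (A : Fin N → ℝ) :
    Param p →ₗ[ℝ] (Fin N → ℝ) where
  toFun φ := medMean G φ C A
  map_add' φ ψ := by
    ext i
    simp only [medMean, gammaS, gamma3, gamma4, dotProduct, PiLp.add_apply, Pi.add_apply, add_mul,
      Finset.sum_add_distrib]
    ring
  map_smul' c φ := by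
    ext i
    simp only [medMean, gammaS, gamma3, gamma4, dotProduct, PiLp.smul_apply, smul_eq_mul,
      RingHom.id_apply, Pi.smul_apply, mul_assoc, ← Finset.mul_sum]
    ring

/-- Means of the two responses in the eigenbasis. -/
noncomputable def rotMean (x : Data p N) : Fin N ⊕ Fin N → Param p →ₗ[ℝ] ℝ
  | Sum.inl i => LinearMap.proj i ∘ₗ rot G ∘ₗ outMeanLin G x.1 x.2.1 x.2.2.1
  | Sum.inr i => LinearMap.proj i ∘ₗ rot G ∘ₗ medMeanLin G x.1 x.2.1

theorem rotMean_inl (x : Data p N) (i : Fin N) (φ : Param p) :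
    rotMean G x (Sum.inl i) φ = rot G (outMean G φ x.1 x.2.1 x.2.2.1) i := rfl

theorem rotMean_inr (x : Data p N) (i : Fin N) (φ : Param p) :
    rotMean G x (Sum.inr i) φ = rot G (medMean G φ x.1 x.2.1) i := rfl

/-- The two responses in the eigenbasis. -/
noncomputable def rotResp (x : Data p N) : Fin N ⊕ Fin N → ℝ
  | Sum.inl i => rot G x.2.2.2 i
  | Sum.inr i => rot G x.2.2.1 i

/-- The logits of the exposure probabilities. -/
noncomputable def logit (C : Fin N → Fin p → ℝ) (i : Fin N) : Param p →ₗ[ℝ] ℝ where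
  toFun φ := alpha φ ⬝ᵥ C i
  map_add' φ ψ := by
    simp only [alpha, dotProduct, PiLp.add_apply, add_mul, Finset.sum_add_distrib]
  map_smul' c φ := by
    simp only [alpha, dotProduct, PiLp.smul_apply, smul_eq_mul, RingHom.id_apply, mul_assoc,
      Finset.mul_sum]

theorem logit_apply (C : Fin N → Fin p → ℝ) (i : Fin N) (φ : Param p) :
    logit C i φ = alpha φ ⬝ᵥ C i := rfl

theorem propensity_eq (C : Fin N → Fin p → ℝ) (i : Fin N) (φ : Param p) :
    propensity φ (C i) = expit (logit C i φ) := rfl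

/-- In this form variances, means and logits are linear in the parameter, and the whole analysis
reduces to scalar terms. Positivity is needed to split the logarithm of the determinant and to
invert the covariances. -/
theorem logLik_eq (x : Data p N) (φ : Param p) (hpos : ∀ j, 0 < resVar G j φ) :
    logLik G x φ = -(N : ℝ) * Real.log (2 * Real.pi)
      + ∑ j, (-(1 / 2) * Real.log (resVar G j φ)
        - 1 / 2 * ((rotResp G x j - rotMean G x j φ) ^ 2 / resVar G j φ))
      + ∑ i, (x.2.1 i * logit x.1 i φ - softplus (logit x.1 i φ)) := by
  have hY := gaussLogLik_eq G (sigmaSq φ 0) (sigmaSq φ 1) (fun i => hpos (Sum.inl i))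
    (fun i => x.2.2.2 i - outMean G φ x.1 x.2.1 x.2.2.1 i)
  have hM := gaussLogLik_eq G (sigmaSq φ 2) (sigmaSq φ 3) (fun i => hpos (Sum.inr i))
    (fun i => x.2.2.1 i - medMean G φ x.1 x.2.1 i)
  have hrY : ∀ i, rot G (fun i => x.2.2.2 i - outMean G φ x.1 x.2.1 x.2.2.1 i) i
      = rotResp G x (Sum.inl i) - rotMean G x (Sum.inl i) φ := fun i => by
    change rot G (x.2.2.2 - outMean G φ x.1 x.2.1 x.2.2.1) i = _
    rw [map_sub]; rfl
  have hrM : ∀ i, rot G (fun i => x.2.2.1 i - medMean G φ x.1 x.2.1 i) i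
      = rotResp G x (Sum.inr i) - rotMean G x (Sum.inr i) φ := fun i => by
    change rot G (x.2.2.1 - medMean G φ x.1 x.2.1) i = _
    rw [map_sub]; rfl
  have hA : ∀ i, x.2.1 i * Real.log (propensity φ (x.1 i) / (1 - propensity φ (x.1 i)))
      + Real.log (1 - propensity φ (x.1 i))
      = x.2.1 i * logit x.1 i φ - softplus (logit x.1 i φ) := fun i => by
    set t := logit x.1 i φ with ht
    have h1 : 1 - propensity φ (x.1 i) = 1 / (1 + Real.exp t) := by
      rw [propensity_eq, ← ht, expit]
      have := one_add_exp_pos t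
      field_simp
      ring
    have h2 : propensity φ (x.1 i) / (1 - propensity φ (x.1 i)) = Real.exp t := by
      rw [h1, propensity_eq, ← ht, expit]
      have := one_add_exp_pos t
      field_simp
    rw [h2, h1, Real.log_exp, one_div, Real.log_inv, softplus]
    ring
  unfold logLik
  simp only
  rw [SigmaY, SigmaM, hY, hM, ← Finset.sum_add_distrib, Finset.sum_congr rfl fun i _ => hA i,
    Fintype.sum_sum_type]
  simp only [hrY, hrM, resVar_inl, resVar_inr]
  ring

end Spectral

/-! ### Second derivatives -/

section Hessian

variable {p : ℕ}

theorem single_sum {ι : Type*} [Fintype ι] [DecidableEq ι] (v : EuclideanSpace ℝ ι) :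
    ∑ k, v k • (EuclideanSpace.single k (1 : ℝ) : EuclideanSpace ℝ ι) = v := by
  ext j
  simp [Finset.sum_apply, Pi.single_apply]

theorem dotProduct_hess_mulVec {f : Param p → ℝ} {φ : Param p} (hf : ContDiffAt ℝ 2 f φ)
    (v w : Param p) : v.ofLp ⬝ᵥ (hess f φ *ᵥ w.ofLp) = fderiv ℝ (fderiv ℝ f) φ v w := by
  have hd : DifferentiableAt ℝ (fderiv ℝ f) φ :=
    (hf.fderiv_right (m := 1) (by norm_num)).differentiableAt (by norm_num)
  have hkl : ∀ k l, hess f φ k l = fderiv ℝ (fderiv ℝ f) φ (EuclideanSpace.single k 1)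
      (EuclideanSpace.single l 1) := fun k l => by
    simp only [hess, Matrix.of_apply]
    rw [fderiv_clm_apply hd (differentiableAt_const _)]
    simp
  set D := fderiv ℝ (fderiv ℝ f) φ with hD
  have h1 : D v w = ∑ k, v k * D (EuclideanSpace.single k 1) w := by
    conv_lhs => rw [← single_sum v, map_sum, sum_apply]
    simp only [map_smul, smul_apply, smul_eq_mul]
  have h2 : ∀ k, D (EuclideanSpace.single k 1) w = ∑ l, hess f φ k l * w l := fun k => by
    conv_lhs => rw [← single_sum w, map_sum]
    simp only [map_smul, smul_eq_mul, ← hkl, mul_comm]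
  rw [h1]
  exact Finset.sum_congr rfl fun k _ => by rw [h2]; rfl

/-- The quadratic form of the Hessian is the second derivative along a line, so the observed
information can be computed by one-variable calculus. -/
theorem qf_hess_eq {f : Param p → ℝ} {φ : Param p} (hf : ContDiffAt ℝ 2 f φ) (v : Param p)
    {f' : ℝ → ℝ} {c : ℝ} (h1 : ∀ᶠ t in 𝓝 (0 : ℝ), HasDerivAt (fun t => f (φ + t • v)) (f' t) t)
    (h2 : HasDerivAt f' c 0) : qf (hess f φ) v.ofLp = c := by
  rw [qf, dotProduct_hess_mulVec hf]
  have hd : DifferentiableAt ℝ (fderiv ℝ f) φ :=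
    (hf.fderiv_right (m := 1) (by norm_num)).differentiableAt (by norm_num)
  have hline : ∀ t : ℝ, HasDerivAt (fun t : ℝ => φ + t • v) v t := fun t => by
    simpa using ((hasDerivAt_id t).smul_const v).const_add φ
  have hev : ∀ᶠ ψ in 𝓝 φ, DifferentiableAt ℝ f ψ :=
    (hf.eventually (by norm_num)).mono fun ψ hψ => hψ.differentiableAt (by norm_num)
  have hcont : Tendsto (fun t : ℝ => φ + t • v) (𝓝 0) (𝓝 φ) := by
    have := (hline 0).continuousAt
    simpa [ContinuousAt] using this
  have hf' : f' =ᶠ[𝓝 0] fun t => fderiv ℝ f (φ + t • v) v := by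
    filter_upwards [h1, hcont.eventually hev] with t ht1 ht2
    exact ht1.unique (ht2.hasFDerivAt.comp_hasDerivAt t (hline t))
  have h3 : HasDerivAt (fun t : ℝ => fderiv ℝ f (φ + t • v) v) (fderiv ℝ (fderiv ℝ f) φ v v) 0 := by
    have hd' : HasFDerivAt (fderiv ℝ f) (fderiv ℝ (fderiv ℝ f) φ) (φ + (0 : ℝ) • v) := by
      simpa using hd.hasFDerivAt
    have := hd'.comp_hasDerivAt (0 : ℝ) (hline 0)
    simpa using this.clm_apply (hasDerivAt_const (0 : ℝ) v)
  exact (h3.congr_of_eventuallyEq hf').unique h2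

theorem hess_symm {f : Param p → ℝ} {φ : Param p} (hf : ContDiffAt ℝ 2 f φ) (k l : ParamIdx p) :
    hess f φ k l = hess f φ l k := by
  have hs := hf.isSymmSndFDerivAt (by simp)
  have h := hs (EuclideanSpace.single k 1) (EuclideanSpace.single l 1)
  rw [← dotProduct_hess_mulVec hf, ← dotProduct_hess_mulVec hf] at h
  simpa using h

end Hessian

/-! ### The log-likelihood near a parameter -/

section Local

variable {p N : ℕ} (G : SimpleGraph (Fin N))

/-- The localization of the log-likelihood at `φ₀`. -/
noncomputable def locLik (φ₀ : Param p) (x : Data p N) :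
    LocalLik (Param p) (Fin N ⊕ Fin N) (Fin N) where
  x j := (1 / Real.sqrt (resVar G j φ₀)) • rotMean G x j
  L j := (1 / resVar G j φ₀) • resVar G j
  ξ j := (rotResp G x j - rotMean G x j φ₀) / Real.sqrt (resVar G j φ₀)
  t i := logit x.1 i
  t₀ i := logit x.1 i φ₀
  a i := x.2.1 i - expit (logit x.1 i φ₀)

variable {G}

theorem locLik_one_add_L {φ₀ : Param p} (x : Data p N) {j : Fin N ⊕ Fin N}
    (h₀ : 0 < resVar G j φ₀) (v : Param p) :
    1 + (locLik G φ₀ x).L j v = resVar G j (φ₀ + v) / resVar G j φ₀ := by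
  simp only [locLik, LinearMap.smul_apply, smul_eq_mul, map_add]
  field_simp

/-- This is an exact identity, not an expansion, and so remains usable far from `φ₀`. -/
theorem logLik_sub_eq_diff {φ₀ v : Param p} (x : Data p N) (h₀ : ∀ j, 0 < resVar G j φ₀)
    (h : ∀ j, 0 < resVar G j (φ₀ + v)) :
    logLik G x (φ₀ + v) - logLik G x φ₀ = (locLik G φ₀ x).diff v := by
  rw [logLik_eq G x _ h, logLik_eq G x _ h₀]
  have hg : (locLik G φ₀ x).gaussDiff v
      = ∑ j, (-(1 / 2) * Real.log (resVar G j (φ₀ + v))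
        - 1 / 2 * ((rotResp G x j - rotMean G x j (φ₀ + v)) ^ 2 / resVar G j (φ₀ + v)))
      - ∑ j, (-(1 / 2) * Real.log (resVar G j φ₀)
        - 1 / 2 * ((rotResp G x j - rotMean G x j φ₀) ^ 2 / resVar G j φ₀)) := by
    rw [← Finset.sum_sub_distrib]
    refine Finset.sum_congr rfl fun j _ => ?_
    rw [locLik_one_add_L x (h₀ j)]
    have hs := Real.sq_sqrt (h₀ j).le
    have hs0 : 0 < Real.sqrt (resVar G j φ₀) := Real.sqrt_pos.2 (h₀ j)
    have hp0 := h₀ j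
    have hp := h j
    rw [Real.log_div hp.ne' hp0.ne']
    have e1 : ((locLik G φ₀ x).ξ j - (locLik G φ₀ x).x j v) ^ 2
        / (resVar G j (φ₀ + v) / resVar G j φ₀)
        = (rotResp G x j - rotMean G x j (φ₀ + v)) ^ 2 / resVar G j (φ₀ + v) := by
      simp only [locLik, LinearMap.smul_apply, smul_eq_mul, map_add (rotMean G x j)]
      have : (rotResp G x j - rotMean G x j φ₀) / Real.sqrt (resVar G j φ₀)
          - 1 / Real.sqrt (resVar G j φ₀) * rotMean G x j v
          = (rotResp G x j - (rotMean G x j φ₀ + rotMean G x j v))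
            / Real.sqrt (resVar G j φ₀) := by field_simp; ring
      rw [this, div_pow, hs]
      field_simp
    have e2 : (locLik G φ₀ x).ξ j ^ 2
        = (rotResp G x j - rotMean G x j φ₀) ^ 2 / resVar G j φ₀ := by
      simp only [locLik]
      rw [div_pow, hs]
    rw [e1, e2]
    ring
  have hl : ∑ i, (locLik G φ₀ x).a i * (locLik G φ₀ x).t i v - (locLik G φ₀ x).logitRem v
      = ∑ i, (x.2.1 i * logit x.1 i (φ₀ + v) - softplus (logit x.1 i (φ₀ + v)))
        - ∑ i, (x.2.1 i * logit x.1 i φ₀ - softplus (logit x.1 i φ₀)) := by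
    unfold LocalLik.logitRem
    rw [← Finset.sum_sub_distrib, ← Finset.sum_sub_distrib]
    refine Finset.sum_congr rfl fun i _ => ?_
    simp only [locLik, map_add]
    ring
  have e : (locLik G φ₀ x).diff v = (locLik G φ₀ x).gaussDiff v
      + (∑ i, (locLik G φ₀ x).a i * (locLik G φ₀ x).t i v - (locLik G φ₀ x).logitRem v) :=
    add_sub_assoc _ _ _
  rw [e, hl, hg]
  ring

theorem contDiff_linearMap (f : Param p →ₗ[ℝ] ℝ) : ContDiff ℝ 2 f :=
  f.toContinuousLinearMap.contDiff

theorem eventually_resVar_pos {φ : Param p} (h : ∀ j, 0 < resVar G j φ) :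
    ∀ᶠ ψ in 𝓝 φ, ∀ j, 0 < resVar G j ψ :=
  eventually_all.2 fun j =>
    (contDiff_linearMap (resVar G j)).continuous.continuousAt.eventually (lt_mem_nhds (h j))

theorem contDiff_softplus : ContDiff ℝ 2 softplus := by
  unfold softplus
  exact (contDiff_const.add Real.contDiff_exp).log fun t => (one_add_exp_pos t).ne'

theorem contDiffAt_logLik (x : Data p N) {φ : Param p} (h : ∀ j, 0 < resVar G j φ) :
    ContDiffAt ℝ 2 (logLik G x) φ := by
  have hev : logLik G x =ᶠ[𝓝 φ] fun φ => -(N : ℝ) * Real.log (2 * Real.pi)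
      + ∑ j, (-(1 / 2) * Real.log (resVar G j φ)
        - 1 / 2 * ((rotResp G x j - rotMean G x j φ) ^ 2 / resVar G j φ))
      + ∑ i, (x.2.1 i * logit x.1 i φ - softplus (logit x.1 i φ)) :=
    (eventually_resVar_pos h).mono fun ψ hψ => logLik_eq G x ψ hψ
  refine ContDiffAt.congr_of_eventuallyEq ?_ hev
  refine (contDiffAt_const.add (ContDiffAt.sum fun j _ => ?_)).add
    (ContDiffAt.sum fun i _ => ?_)
  · have hv := (contDiff_linearMap (resVar G j)).contDiffAt (x := φ)
    have hm := (contDiff_linearMap (rotMean G x j)).contDiffAt (x := φ)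
    exact (contDiffAt_const.mul (hv.log (h j).ne')).sub
      (contDiffAt_const.mul (((contDiffAt_const.sub hm).pow 2).div hv (h j).ne'))
  · have ht := (contDiff_linearMap (logit x.1 i)).contDiffAt (x := φ)
    exact (contDiffAt_const.mul ht).sub (contDiff_softplus.contDiffAt.comp φ ht)

theorem hasDerivAt_gaussTerm (ρ l r k c : ℝ) {t : ℝ} (h : 0 < ρ + t * l) :
    HasDerivAt (fun t => -(1 / 2) * Real.log (ρ + t * l)
        - 1 / 2 * ((r - t * k) ^ 2 / (ρ + t * l)) + c)
      (-(1 / 2) * (l / (ρ + t * l)) + k * (r - t * k) / (ρ + t * l)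
        + 1 / 2 * (l * (r - t * k) ^ 2 / (ρ + t * l) ^ 2)) t := by
  have h1 : HasDerivAt (fun t : ℝ => ρ + t * l) l t := by
    simpa using ((hasDerivAt_id t).mul_const l).const_add ρ
  have h2 : HasDerivAt (fun t : ℝ => r - t * k) (-k) t := by
    simpa using ((hasDerivAt_id t).mul_const k).const_sub r
  have h3 := (((h1.log h.ne').const_mul (-(1 / 2))).sub
    (((h2.pow 2).div h1 h.ne').const_mul (1 / 2))).add_const c
  refine h3.congr_deriv ?_
  simp only [Pi.pow_apply, Nat.cast_ofNat]
  field_simp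
  ring

/-- The second derivative of the quadratic term is minus the perfect square of `k ρ^{-1/2} + l r
ρ^{-3/2}`; the logarithm contributes the other part. -/
theorem hasDerivAt_gaussTerm_deriv (ρ l r k : ℝ) (h : 0 < ρ) :
    HasDerivAt (fun t => -(1 / 2) * (l / (ρ + t * l)) + k * (r - t * k) / (ρ + t * l)
        + 1 / 2 * (l * (r - t * k) ^ 2 / (ρ + t * l) ^ 2))
      (-((k * (1 / Real.sqrt ρ) + l * (1 / Real.sqrt ρ) ^ 3 * r) ^ 2
        - 1 / 2 * (l ^ 2 * (1 / Real.sqrt ρ) ^ 4))) 0 := by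
  have h1 : HasDerivAt (fun t : ℝ => ρ + t * l) l 0 := by
    simpa using ((hasDerivAt_id (0 : ℝ)).mul_const l).const_add ρ
  have h2 : HasDerivAt (fun t : ℝ => r - t * k) (-k) 0 := by
    simpa using ((hasDerivAt_id (0 : ℝ)).mul_const k).const_sub r
  have hne : ρ + 0 * l ≠ 0 := by simpa using h.ne'
  have h3 := ((((hasDerivAt_const (0 : ℝ) l).div h1 hne).const_mul (-(1 / 2))).add
    ((h2.const_mul k).div h1 hne)).add
    ((((h2.pow 2).const_mul l).div (h1.pow 2) (pow_ne_zero 2 hne)).const_mul (1 / 2))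
  refine h3.congr_deriv ?_
  have hw0 : 0 < Real.sqrt ρ := Real.sqrt_pos.2 h
  have hρ : ρ = Real.sqrt ρ ^ 2 := (Real.sq_sqrt h.le).symm
  generalize Real.sqrt ρ = w at hw0 hρ
  subst hρ
  simp only [Pi.pow_apply, zero_mul, add_zero, sub_zero, Nat.cast_ofNat]
  field_simp
  ring

/-- Differentiating the exact log-ratio twice along a line through `φ₀ + w` expresses the
information at any admissible parameter through quantities standardized at `φ₀`. -/
theorem qf_obsInfo {φ₀ w : Param p} (x : Data p N) (h₀ : ∀ j, 0 < resVar G j φ₀)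
    (h : ∀ j, 0 < resVar G j (φ₀ + w)) (v : Param p) :
    qf (obsInfo G x (φ₀ + w)) v.ofLp
      = (locLik G φ₀ x).gaussInfo w v + (locLik G φ₀ x).logitInfo w v := by
  set m := locLik G φ₀ x with hm
  have hρ : ∀ j, 0 < 1 + m.L j w := fun j => by
    rw [hm, locLik_one_add_L x (h₀ j)]; exact div_pos (h j) (h₀ j)
  have hneg : qf (obsInfo G x (φ₀ + w)) v.ofLp = -qf (hess (logLik G x) (φ₀ + w)) v.ofLp := by
    simp [qf, obsInfo, Matrix.neg_mulVec]
  rw [hneg, neg_eq_iff_eq_neg]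
  have hcont : Tendsto (fun t : ℝ => φ₀ + w + t • v) (𝓝 0) (𝓝 (φ₀ + w)) := by
    have : Continuous fun t : ℝ => φ₀ + w + t • v := by fun_prop
    simpa using this.tendsto 0
  have hev := hcont.eventually (eventually_resVar_pos h)
  refine qf_hess_eq (contDiffAt_logLik x h) v
    (f' := fun t => ∑ j, (-(1 / 2) * (m.L j v / (1 + m.L j w + t * m.L j v))
        + m.x j v * (m.ξ j - m.x j w - t * m.x j v) / (1 + m.L j w + t * m.L j v)
        + 1 / 2 * (m.L j v * (m.ξ j - m.x j w - t * m.x j v) ^ 2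
          / (1 + m.L j w + t * m.L j v) ^ 2))
      + (∑ i, m.a i * m.t i v
        - ∑ i, (expit (m.t₀ i + m.t i w + t * m.t i v) * m.t i v
          - expit (m.t₀ i) * m.t i v))) ?_ ?_
  · filter_upwards [hev.eventually_nhds] with t ht
    have heq : (fun t : ℝ => logLik G x (φ₀ + w + t • v)) =ᶠ[𝓝 t] fun t =>
        logLik G x φ₀ + (∑ j, (-(1 / 2) * Real.log (1 + m.L j w + t * m.L j v)
          - 1 / 2 * ((m.ξ j - m.x j w - t * m.x j v) ^ 2 / (1 + m.L j w + t * m.L j v))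
          + 1 / 2 * m.ξ j ^ 2)
        + (∑ i, m.a i * (m.t i w + t * m.t i v)
          - ∑ i, (softplus (m.t₀ i + m.t i w + t * m.t i v) - softplus (m.t₀ i)
            - expit (m.t₀ i) * (m.t i w + t * m.t i v)))) := by
      filter_upwards [ht] with s hs
      have := logLik_sub_eq_diff (v := w + s • v) x h₀ (by rw [← add_assoc]; exact hs)
      rw [add_assoc, sub_eq_iff_eq_add.1 this, ← hm]
      simp only [LocalLik.diff, LocalLik.gaussDiff, LocalLik.logitRem, map_add, map_smul,
        smul_eq_mul, add_assoc, sub_sub, add_sub_assoc]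
      ring
    refine HasDerivAt.congr_of_eventuallyEq ?_ heq
    refine ((HasDerivAt.fun_sum fun j _ => ?_).add ((HasDerivAt.fun_sum fun i _ => ?_).sub
      (HasDerivAt.fun_sum fun i _ => ?_))).const_add _
    · refine hasDerivAt_gaussTerm _ _ _ _ _ ?_
      have := ht.self_of_nhds j
      have e : 1 + m.L j w + t * m.L j v = resVar G j (φ₀ + w + t • v) / resVar G j φ₀ := by
        rw [add_assoc φ₀, ← locLik_one_add_L x (h₀ j), ← hm, map_add, map_smul, smul_eq_mul,
          add_assoc]
      rw [e]
      exact div_pos this (h₀ j)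
    · simpa using (((hasDerivAt_id t).mul_const (m.t i v)).const_add (m.t i w)).const_mul (m.a i)
    · have h1 : HasDerivAt (fun t : ℝ => m.t₀ i + m.t i w + t * m.t i v) (m.t i v) t := by
        simpa using ((hasDerivAt_id t).mul_const (m.t i v)).const_add (m.t₀ i + m.t i w)
      have h2 : HasDerivAt (fun t : ℝ => m.t i w + t * m.t i v) (m.t i v) t := by
        simpa using ((hasDerivAt_id t).mul_const (m.t i v)).const_add (m.t i w)
      exact (((hasDerivAt_softplus _).comp t h1).sub_const _).sub (h2.const_mul _)
  · have hg : HasDerivAt (fun t => ∑ j, (-(1 / 2) * (m.L j v / (1 + m.L j w + t * m.L j v))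
        + m.x j v * (m.ξ j - m.x j w - t * m.x j v) / (1 + m.L j w + t * m.L j v)
        + 1 / 2 * (m.L j v * (m.ξ j - m.x j w - t * m.x j v) ^ 2
          / (1 + m.L j w + t * m.L j v) ^ 2))) (-m.gaussInfo w v) 0 := by
      unfold LocalLik.gaussInfo
      rw [← Finset.sum_neg_distrib]
      exact HasDerivAt.fun_sum fun j _ => hasDerivAt_gaussTerm_deriv _ _ _ _ (hρ j)
    have hl : HasDerivAt (fun t => ∑ i, (expit (m.t₀ i + m.t i w + t * m.t i v) * m.t i v
          - expit (m.t₀ i) * m.t i v)) (m.logitInfo w v) 0 := by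
      refine HasDerivAt.fun_sum fun i _ => ?_
      have h1 : HasDerivAt (fun t : ℝ => m.t₀ i + m.t i w + t * m.t i v) (m.t i v) 0 := by
        simpa using ((hasDerivAt_id (0 : ℝ)).mul_const (m.t i v)).const_add (m.t₀ i + m.t i w)
      have h2 := (((hasDerivAt_expit (m.t₀ i + m.t i w + 0 * m.t i v)).comp (0 : ℝ) h1).mul_const
        (m.t i v)).sub_const (expit (m.t₀ i) * m.t i v)
      refine h2.congr_deriv ?_
      rw [zero_mul, add_zero, sq, mul_assoc]
    rw [neg_add]
    exact hg.add (hl.const_sub _)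

theorem obsInfo_symm (x : Data p N) {φ : Param p} (h : ∀ j, 0 < resVar G j φ)
    (k l : ParamIdx p) : obsInfo G x φ k l = obsInfo G x φ l k := by
  simp only [obsInfo, Matrix.neg_apply]
  rw [hess_symm (contDiffAt_logLik x h)]

/-- Polarization: it transfers integrability from the quadratic form to the entries. -/
theorem obsInfo_apply_eq (x : Data p N) {φ : Param p} (h : ∀ j, 0 < resVar G j φ)
    (k l : ParamIdx p) :
    obsInfo G x φ k l = (qf (obsInfo G x φ) (Pi.single k 1 + Pi.single l 1)
      - qf (obsInfo G x φ) (Pi.single k 1) - qf (obsInfo G x φ) (Pi.single l 1)) / 2 := by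
  simp only [qf, Matrix.mulVec_add, dotProduct_add, add_dotProduct, Matrix.mulVec_single_one,
    single_one_dotProduct, Matrix.col_apply]
  rw [obsInfo_symm x h l k]
  ring

end Local

/-! ### Moments of the exogenous variables -/

section Moments

variable {N : ℕ}

theorem integral_cexp_gaussVec (v : ℝ) (β : Fin N → ℝ) :
    ∫ z, Complex.exp ((β ⬝ᵥ z : ℝ) * Complex.I) ∂(gaussVec N v)
      = Complex.exp ((-(v.toNNReal / 2) * (β ⬝ᵥ β) : ℝ)) := by
  have h := charFun_pi (μ := fun _ : Fin N => gaussianReal 0 v.toNNReal) (WithLp.toLp 2 β)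
  rw [charFun_apply, ← MeasurableEquiv.coe_toLp, integral_map_equiv] at h
  have e1 : ∀ z : Fin N → ℝ, inner ℝ (WithLp.toLp 2 z) (WithLp.toLp 2 β) = β ⬝ᵥ z := fun z => by
    simp [PiLp.inner_apply, dotProduct]
  simp only [MeasurableEquiv.coe_toLp, e1, charFun_gaussianReal] at h
  rw [gaussVec, h, ← Complex.exp_sum]
  congr 1
  simp only [dotProduct, Finset.mul_sum]
  push_cast
  refine Finset.sum_congr rfl fun i _ => ?_
  ring

/-- Characteristic functions are compared. For `c_i = t_i / √(a + b λ_i²)` the exponent is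
`-(a/2)|Uc|² - (b/2)|EUc|²`, and `E U = U diag(λ)` with `U` orthogonal turns it into `-|t|² / 2`. -/
theorem map_rot_noise (G : SimpleGraph (Fin N)) {a b : ℝ} (ha : 0 < a) (hb : 0 < b) :
    Measure.map (fun be : (Fin N → ℝ) × (Fin N → ℝ) => fun i =>
        rot G (fun j => adj G j ⬝ᵥ be.1 + be.2 j) i / Real.sqrt (a + b * eigVal G i ^ 2))
      ((gaussVec N b).prod (gaussVec N a)) = gaussVec N 1 := by
  have hs : ∀ i, 0 < a + b * eigVal G i ^ 2 := fun i => by positivity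
  set T : (Fin N → ℝ) × (Fin N → ℝ) → Fin N → ℝ := fun be i =>
        rot G (fun j => adj G j ⬝ᵥ be.1 + be.2 j) i / Real.sqrt (a + b * eigVal G i ^ 2) with hT
  have hTm : Measurable T := by
    refine measurable_pi_lambda _ fun i => ?_
    simp only [hT, rot_apply, Matrix.mulVec, dotProduct]
    fun_prop
  have : IsProbabilityMeasure (Measure.map T ((gaussVec N b).prod (gaussVec N a))) :=
    Measure.isProbabilityMeasure_map hTm.aemeasurable
  unfold gaussVec at *
  rw [← charFun_eq_pi_iff]
  intro t
  rw [charFun_apply, ← MeasurableEquiv.coe_toLp, integral_map_equiv,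
    integral_map hTm.aemeasurable (by
      refine Measurable.aestronglyMeasurable ?_
      simp only [MeasurableEquiv.coe_toLp, PiLp.inner_apply]
      fun_prop)]
  set c : Fin N → ℝ := fun i => t i / Real.sqrt (a + b * eigVal G i ^ 2) with hc
  set γ := eigU G *ᵥ c with hγ
  set β := adj G *ᵥ γ with hβ
  have e1 : ∀ be : (Fin N → ℝ) × (Fin N → ℝ),
      inner ℝ (WithLp.toLp 2 (T be)) t = β ⬝ᵥ be.1 + γ ⬝ᵥ be.2 := fun be => by
    have h1 : inner ℝ (WithLp.toLp 2 (T be)) t = c ⬝ᵥ rot G (adj G *ᵥ be.1 + be.2) := by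
      simp only [PiLp.inner_apply, dotProduct, hT, hc]
      refine Finset.sum_congr rfl fun i _ => ?_
      simp only [RCLike.inner_apply, conj_trivial]
      have : rot G (fun j => adj G j ⬝ᵥ be.1 + be.2 j) = rot G (adj G *ᵥ be.1 + be.2) := rfl
      rw [show (fun j => ∑ i, adj G j i * be.1 i + be.2 j) = adj G *ᵥ be.1 + be.2 from rfl]
      ring
    rw [h1, rot_apply, Matrix.dotProduct_mulVec, Matrix.vecMul_transpose, ← hγ, dotProduct_add,
      dotProduct_symm_mulVec (transpose_adj G)]
  simp only [MeasurableEquiv.coe_toLp, e1]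
  have e2 : ∀ be : (Fin N → ℝ) × (Fin N → ℝ),
      Complex.exp (((β ⬝ᵥ be.1 + γ ⬝ᵥ be.2 : ℝ) : ℂ) * Complex.I)
      = Complex.exp ((β ⬝ᵥ be.1 : ℝ) * Complex.I) * Complex.exp ((γ ⬝ᵥ be.2 : ℝ) * Complex.I) :=
    fun be => by rw [← Complex.exp_add]; push_cast; ring_nf
  simp only [e2]
  rw [integral_prod_mul (fun x : Fin N → ℝ => Complex.exp ((β ⬝ᵥ x : ℝ) * Complex.I))
    (fun x : Fin N → ℝ => Complex.exp ((γ ⬝ᵥ x : ℝ) * Complex.I))]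
  have i1 := integral_cexp_gaussVec (N := N) b β
  have i2 := integral_cexp_gaussVec (N := N) a γ
  unfold gaussVec at i1 i2
  rw [i1, i2, ← Complex.exp_add]
  simp only [charFun_gaussianReal]
  rw [← Complex.exp_sum]
  congr 1
  have g1 : γ ⬝ᵥ γ = ∑ i, c i ^ 2 := by
    rw [hγ, Matrix.dotProduct_mulVec, Matrix.vecMul_mulVec, transpose_eigU_mul,
      Matrix.vecMul_one, dotProduct_self_eq_sum_sq]
  have g2 : β = eigU G *ᵥ (fun i => eigVal G i * c i) := by
    rw [hβ, hγ]
    conv_lhs => rw [adj_eq]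
    rw [Matrix.mulVec_mulVec, Matrix.mul_assoc, transpose_eigU_mul, Matrix.mul_one,
      ← Matrix.mulVec_mulVec]
    congr 1
    ext i
    rw [Matrix.mulVec_diagonal]
  have g3 : β ⬝ᵥ β = ∑ i, (eigVal G i * c i) ^ 2 := by
    rw [g2, Matrix.dotProduct_mulVec, Matrix.vecMul_mulVec, transpose_eigU_mul,
      Matrix.vecMul_one, dotProduct_self_eq_sum_sq]
  rw [g1, g3, Real.coe_toNNReal _ ha.le, Real.coe_toNNReal _ hb.le]
  have key : -(b / 2) * ∑ i, (eigVal G i * c i) ^ 2 + -(a / 2) * ∑ i, c i ^ 2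
      = ∑ i, -(t i ^ 2 / 2) := by
    rw [Finset.mul_sum, Finset.mul_sum, ← Finset.sum_add_distrib]
    refine Finset.sum_congr rfl fun i _ => ?_
    have hci : c i ^ 2 * (a + b * eigVal G i ^ 2) = t i ^ 2 := by
      rw [hc, div_pow, Real.sq_sqrt (hs i).le]
      have := hs i
      field_simp
    rw [← hci]
    ring
  rw [← Complex.ofReal_add, key]
  push_cast
  refine Finset.sum_congr rfl fun i _ => ?_
  simp

/-- Second moment of a sum of independent centred variables. -/
theorem lintegral_sum_sq_pi {Ω : Type*} [MeasurableSpace Ω] (μ : Measure Ω)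
    [IsProbabilityMeasure μ] (X : Fin N → Ω → ℝ) (hX : ∀ i, MemLp (X i) 2 μ)
    (h0 : ∀ i, ∫ ω, X i ω ∂μ = 0) :
    ∫⁻ z, ENNReal.ofReal ((∑ i, X i (z i)) ^ 2) ∂(Measure.pi fun _ : Fin N => μ)
      = ENNReal.ofReal (∑ i, ∫ ω, X i ω ^ 2 ∂μ) := by
  have hL : ∀ i, MemLp (fun z : Fin N → Ω => X i (z i)) 2 (Measure.pi fun _ => μ) := fun i =>
    (hX i).comp_measurePreserving (measurePreserving_eval _ i)
  have hS : MemLp (fun z : Fin N → Ω => ∑ i, X i (z i)) 2 (Measure.pi fun _ => μ) :=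
    memLp_finsetSum _ fun i _ => hL i
  have hmean : ∀ i, ∫ z : Fin N → Ω, X i (z i) ∂(Measure.pi fun _ => μ) = 0 := fun i => by
    have := (measurePreserving_eval (fun _ : Fin N => μ) i).map_eq
    rw [← h0 i]
    conv_rhs => rw [← this]
    rw [integral_map (measurable_pi_apply i).aemeasurable]
    rw [this]
    exact (hX i).aestronglyMeasurable
  have hmeanS : ∫ z : Fin N → Ω, ∑ i, X i (z i) ∂(Measure.pi fun _ => μ) = 0 := by
    rw [integral_finsetSum _ fun i _ => (hL i).integrable (by norm_num)]
    exact Finset.sum_eq_zero fun i _ => hmean i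
  have hv := variance_sum_pi hX
  have e : (∑ i, fun z : Fin N → Ω => X i (z i)) = fun z => ∑ i, X i (z i) := by
    ext z; simp
  rw [e, variance_of_integral_eq_zero hS.aestronglyMeasurable.aemeasurable hmeanS] at hv
  rw [← ofReal_integral_eq_lintegral_ofReal hS.integrable_sq
    (Eventually.of_forall fun z => sq_nonneg _), hv]
  congr 1
  refine Finset.sum_congr rfl fun i _ => ?_
  rw [variance_of_integral_eq_zero (hX i).aestronglyMeasurable.aemeasurable (h0 i)]

/-- The variance of the square of a standard normal variable. -/
noncomputable def chiVar : ℝ := ∫ z, (z ^ 2 - 1) ^ 2 ∂(gaussianReal 0 1)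

theorem chiVar_nonneg : 0 ≤ chiVar := integral_nonneg fun _ => sq_nonneg _

theorem integral_sq_gaussianReal : ∫ z, z ^ 2 ∂(gaussianReal 0 1) = 1 := by
  have h := variance_fun_id_gaussianReal (μ := 0) (v := 1)
  rw [variance_of_integral_eq_zero aemeasurable_id' integral_id_gaussianReal] at h
  simpa using h

theorem memLp_sq_sub_one : MemLp (fun z : ℝ => z ^ 2 - 1) 2 (gaussianReal 0 1) := by
  have h4 : MemLp (fun z : ℝ => z) 4 (gaussianReal 0 1) :=
    memLp_id_gaussianReal' 4 (by norm_num)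
  have : MemLp (fun z : ℝ => z ^ 2) 2 (gaussianReal 0 1) := by
    have := h4.mul (p := 4) (q := 4) (r := 2) h4 (hpqr := ⟨by
      rw [← ENNReal.toReal_eq_toReal_iff' (by simp) (by simp), ENNReal.toReal_add (by simp) (by simp)]
      simp; norm_num⟩)
    have e : (fun z : ℝ => z ^ 2) = (fun z => z) * fun z => z := by
      ext z; exact sq z
    rw [e]
    exact this
  exact this.sub (memLp_const 1)

theorem lintegral_sum_mul_gaussVec (a : Fin N → ℝ) :
    ∫⁻ z, ENNReal.ofReal ((∑ i, a i * z i) ^ 2) ∂(gaussVec N 1)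
      = ENNReal.ofReal (∑ i, a i ^ 2) := by
  have h := lintegral_sum_sq_pi (gaussianReal 0 1) (fun (i : Fin N) z => a i * z)
    (fun i => (memLp_id_gaussianReal' 2 (by norm_num)).const_mul (a i))
    (fun i => by rw [integral_const_mul, integral_id_gaussianReal, mul_zero])
  rw [gaussVec, Real.toNNReal_one, h]
  congr 1
  refine Finset.sum_congr rfl fun i _ => ?_
  simp only [mul_pow]
  rw [integral_const_mul, integral_sq_gaussianReal, mul_one]

theorem lintegral_sum_mul_chi (a : Fin N → ℝ) :
    ∫⁻ z, ENNReal.ofReal ((∑ i, a i * (z i ^ 2 - 1)) ^ 2) ∂(gaussVec N 1)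
      = ENNReal.ofReal (chiVar * ∑ i, a i ^ 2) := by
  have h := lintegral_sum_sq_pi (gaussianReal 0 1) (fun (i : Fin N) z => a i * (z ^ 2 - 1))
    (fun i => memLp_sq_sub_one.const_mul (a i))
    (fun i => by
      have hsq : Integrable (fun z : ℝ => z ^ 2) (gaussianReal 0 1) :=
        (memLp_id_gaussianReal' 2 (by norm_num)).integrable_sq
      rw [integral_const_mul, integral_sub hsq (integrable_const 1), integral_const,
        integral_sq_gaussianReal]
      simp)
  rw [gaussVec, Real.toNNReal_one, h, Finset.mul_sum]
  congr 1
  refine Finset.sum_congr rfl fun i _ => ?_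
  simp only [mul_pow]
  rw [integral_const_mul, ← chiVar, mul_comm]

theorem lintegral_add_mul_sq_gaussVec (i : Fin N) (x l : ℝ) :
    ∫⁻ z, ENNReal.ofReal ((x + l * z i) ^ 2) ∂(gaussVec N 1)
      = ENNReal.ofReal (x ^ 2 + l ^ 2) := by
  have hmp := measurePreserving_eval (fun _ : Fin N => gaussianReal 0 1) i
  rw [gaussVec, Real.toNNReal_one]
  have e : ∫⁻ z : Fin N → ℝ, ENNReal.ofReal ((x + l * z i) ^ 2)
      ∂(Measure.pi fun _ => gaussianReal 0 1)
      = ∫⁻ y, ENNReal.ofReal ((x + l * y) ^ 2) ∂(gaussianReal 0 1) :=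
    hmp.lintegral_comp (f := fun y => ENNReal.ofReal ((x + l * y) ^ 2)) (by fun_prop)
  have hid : MemLp (fun z : ℝ => z) 2 (gaussianReal 0 1) :=
    memLp_id_gaussianReal' 2 (by norm_num)
  have hint : Integrable (fun z : ℝ => z) (gaussianReal 0 1) := hid.integrable (by norm_num)
  have hL : MemLp (fun y : ℝ => x + l * y) 2 (gaussianReal 0 1) :=
    (memLp_const x).add (hid.const_mul l)
  rw [e, ← ofReal_integral_eq_lintegral_ofReal hL.integrable_sq
    (Eventually.of_forall fun z => sq_nonneg _)]
  congr 1
  have e2 : ∀ y : ℝ, (x + l * y) ^ 2 = x ^ 2 + (2 * x * l * y + l ^ 2 * y ^ 2) := fun y => by ring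
  simp only [e2]
  have h3 : Integrable (fun y : ℝ => 2 * x * l * y + l ^ 2 * y ^ 2) (gaussianReal 0 1) :=
    (hint.const_mul _).add (hid.integrable_sq.const_mul _)
  rw [integral_add (integrable_const _) h3, integral_add (hint.const_mul _) (hid.integrable_sq.const_mul _), integral_const_mul,
    integral_const_mul, integral_id_gaussianReal, integral_sq_gaussianReal]
  simp

theorem lintegral_sum_mul_bernoulli (a π : Fin N → ℝ) (h0 : ∀ i, 0 ≤ π i) (h1 : ∀ i, π i ≤ 1) :
    ∫⁻ e, ENNReal.ofReal ((∑ i, a i * ((if e i ≤ π i then 1 else 0) - π i)) ^ 2) ∂(unifVec N)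
      = ENNReal.ofReal (∑ i, a i ^ 2 * (π i * (1 - π i))) := by
  have : IsProbabilityMeasure ((volume : Measure ℝ).restrict (Set.Icc 0 1)) := ⟨by simp⟩
  have hI : ∀ i, ∫ e : ℝ, (if e ≤ π i then (1 : ℝ) else 0) ∂(volume.restrict (Set.Icc 0 1))
      = π i := fun i => by
    have : (fun e : ℝ => if e ≤ π i then (1 : ℝ) else 0) = (Set.Iic (π i)).indicator 1 := by
      ext e; simp [Set.indicator_apply]
    rw [this, integral_indicator_one measurableSet_Iic, Measure.real,
      Measure.restrict_apply measurableSet_Iic]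
    have e : Set.Iic (π i) ∩ Set.Icc 0 1 = Set.Icc 0 (π i) := by
      ext y; simp only [Set.mem_inter_iff, Set.mem_Iic, Set.mem_Icc]
      have := h1 i
      constructor
      · rintro ⟨h, h', -⟩; exact ⟨h', h⟩
      · rintro ⟨h, h'⟩; exact ⟨h', h, by linarith⟩
    rw [e, Real.volume_Icc, sub_zero, ENNReal.toReal_ofReal (h0 i)]
  have hm : ∀ i, Measurable fun e : ℝ => if e ≤ π i then (1 : ℝ) else 0 := fun i =>
    Measurable.ite measurableSet_Iic measurable_const measurable_const
  have hL : ∀ i, MemLp (fun e : ℝ => if e ≤ π i then (1 : ℝ) else 0) 2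
      (volume.restrict (Set.Icc 0 1)) := fun i =>
    MemLp.of_bound (hm i).aestronglyMeasurable 1 (Eventually.of_forall fun e => by
      split_ifs <;> simp)
  have hint := fun i => (hL i).integrable (by norm_num)
  have h := lintegral_sum_sq_pi (volume.restrict (Set.Icc (0 : ℝ) 1))
    (fun (i : Fin N) e => a i * ((if e ≤ π i then 1 else 0) - π i))
    (fun i => ((hL i).sub (memLp_const (π i))).const_mul (a i))
    (fun i => by
      rw [integral_const_mul, integral_sub (hint i) (integrable_const _), hI]
      simp)
  rw [unifVec, h]
  congr 1
  refine Finset.sum_congr rfl fun i _ => ?_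
  -- An indicator equals its square, so the integrand is affine in the indicator.
  have e : ∀ e : ℝ, (a i * ((if e ≤ π i then 1 else 0) - π i)) ^ 2
      = a i ^ 2 * ((1 - 2 * π i) * (if e ≤ π i then 1 else 0) + π i ^ 2) := fun e => by
    split_ifs <;> ring
  simp only [e]
  rw [integral_const_mul, integral_add ((hint i).const_mul _) (integrable_const _),
    integral_const_mul, hI]
  simp
  left
  ring

end Moments

/-! ### The law of the standardized residuals -/

section Laws

variable {p N : ℕ} {G : SimpleGraph (Fin N)} {ν : Measure (Fin N → Fin p → ℝ)}
  [IsProbabilityMeasure ν] {φ : Param p}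

theorem lintegral_latentLaw {H : Latent p N → ENNReal} (hH : Measurable H) :
    ∫⁻ ω, H ω ∂(latentLaw ν φ) = ∫⁻ C, ∫⁻ eA, ∫⁻ bM, ∫⁻ eM, ∫⁻ bY, ∫⁻ eY,
      H (C, eA, bM, eM, bY, eY) ∂(gaussVec N (sigmaSq φ 0)) ∂(gaussVec N (sigmaSq φ 1))
        ∂(gaussVec N (sigmaSq φ 2)) ∂(gaussVec N (sigmaSq φ 3)) ∂(unifVec N) ∂ν := by
  unfold latentLaw
  rw [lintegral_prod _ hH.aemeasurable]
  refine lintegral_congr fun C => ?_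
  rw [lintegral_prod _ (by fun_prop)]
  refine lintegral_congr fun eA => ?_
  rw [lintegral_prod _ (by fun_prop)]
  refine lintegral_congr fun bM => ?_
  rw [lintegral_prod _ (by fun_prop)]
  refine lintegral_congr fun eM => ?_
  rw [lintegral_prod _ (by fun_prop)]

theorem measurable_rot_apply (i : Fin N) : Measurable fun w : Fin N → ℝ => rot G w i := by
  simp only [rot_apply, Matrix.mulVec, dotProduct]
  fun_prop

theorem measurable_rotMean (j : Fin N ⊕ Fin N) (v : Param p) :
    Measurable fun x : Data p N => rotMean G x j v := by
  rcases j with i | i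
  · simp only [rotMean_inl]
    refine (measurable_rot_apply i).comp (measurable_pi_lambda _ fun k => ?_)
    unfold outMean nbrAvgVec nbrAvg dotProduct
    fun_prop
  · simp only [rotMean_inr]
    refine (measurable_rot_apply i).comp (measurable_pi_lambda _ fun k => ?_)
    unfold medMean nbrAvgVec nbrAvg dotProduct
    fun_prop

theorem measurable_rotResp (j : Fin N ⊕ Fin N) :
    Measurable fun x : Data p N => rotResp G x j := by
  rcases j with i | i
  · exact (measurable_rot_apply i).comp (by fun_prop)
  · exact (measurable_rot_apply i).comp (by fun_prop)

theorem measurable_locLik_x (j : Fin N ⊕ Fin N) (v : Param p) :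
    Measurable fun x : Data p N => (locLik G φ x).x j v :=
  (measurable_rotMean j v).const_mul _

theorem measurable_locLik_ξ (j : Fin N ⊕ Fin N) :
    Measurable fun x : Data p N => (locLik G φ x).ξ j :=
  ((measurable_rotResp j).sub (measurable_rotMean j φ)).div_const _

theorem measurable_logit (i : Fin N) (v : Param p) :
    Measurable fun C : Fin N → Fin p → ℝ => logit C i v := by
  simp only [logit_apply, dotProduct]
  fun_prop

theorem measurable_expit : Measurable expit := by
  unfold expit; fun_prop

theorem measurable_expitDeriv : Measurable expitDeriv := by
  unfold expitDeriv; fun_prop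

theorem measurable_softplus : Measurable softplus := by
  unfold softplus; fun_prop

theorem measurable_locLik_a (i : Fin N) :
    Measurable fun x : Data p N => (locLik G φ x).a i := by
  have h : Measurable fun x : Data p N => expit (logit x.1 i φ) :=
    measurable_expit.comp ((measurable_logit i φ).comp measurable_fst)
  have h' : Measurable fun x : Data p N => x.2.1 i := by fun_prop
  exact h'.sub h

theorem locLik_ξ_generate_inl (ω : Latent p N) (i : Fin N) :
    (locLik G φ (generate G φ ω)).ξ (Sum.inl i)
      = rot G (fun j => adj G j ⬝ᵥ ω.2.2.2.2.1 + ω.2.2.2.2.2 j) i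
        / Real.sqrt (sigmaSq φ 0 + sigmaSq φ 1 * eigVal G i ^ 2) := by
  obtain ⟨C, eA, bM, eM, bY, eY⟩ := ω
  simp only [locLik, resVar_inl]
  congr 1
  simp only [rotResp, rotMean_inl, generate]
  rw [← Pi.sub_apply, ← map_sub]
  refine congrFun (congrArg (rot G) (funext fun j => ?_)) i
  simp only [Pi.sub_apply, genY]
  ring

theorem locLik_ξ_generate_inr (ω : Latent p N) (i : Fin N) :
    (locLik G φ (generate G φ ω)).ξ (Sum.inr i)
      = rot G (fun j => adj G j ⬝ᵥ ω.2.2.1 + ω.2.2.2.1 j) i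
        / Real.sqrt (sigmaSq φ 2 + sigmaSq φ 3 * eigVal G i ^ 2) := by
  obtain ⟨C, eA, bM, eM, bY, eY⟩ := ω
  simp only [locLik, resVar_inr]
  congr 1
  simp only [rotResp, rotMean_inr, generate]
  rw [← Pi.sub_apply, ← map_sub]
  refine congrFun (congrArg (rot G) (funext fun j => ?_)) i
  simp only [Pi.sub_apply, genM]
  ring

theorem lintegral_noise {a b : ℝ} (ha : 0 < a) (hb : 0 < b) {F : (Fin N → ℝ) → ENNReal}
    (hF : Measurable F) :
    ∫⁻ bv, ∫⁻ ev, F (fun i => rot G (fun j => adj G j ⬝ᵥ bv + ev j) i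
        / Real.sqrt (a + b * eigVal G i ^ 2)) ∂(gaussVec N a) ∂(gaussVec N b)
      = ∫⁻ z, F z ∂(gaussVec N 1) := by
  have hT : Measurable fun be : (Fin N → ℝ) × (Fin N → ℝ) => fun i =>
        rot G (fun j => adj G j ⬝ᵥ be.1 + be.2 j) i / Real.sqrt (a + b * eigVal G i ^ 2) := by
    refine measurable_pi_lambda _ fun i => Measurable.div_const ?_ _
    refine (measurable_rot_apply i).comp (measurable_pi_lambda _ fun k => ?_)
    unfold dotProduct
    fun_prop
  rw [← map_rot_noise G ha hb, lintegral_map hF hT]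
  exact (lintegral_prod _ (hF.comp hT).aemeasurable).symm

/-- The outcome noise enters neither `C`, `A` nor `M`. Integrating it first shows that the outcome
residuals are standard normal and independent of these three. -/
theorem lintegral_outcome_noise (hφ : ∀ k, 0 < sigmaSq φ k)
    {F : ((Fin N → Fin p → ℝ) × (Fin N → ℝ) × (Fin N → ℝ)) × (Fin N → ℝ) → ENNReal}
    (hF : Measurable F) :
    ∫⁻ x, F ((x.1, x.2.1, x.2.2.1), fun i => (locLik G φ x).ξ (Sum.inl i)) ∂(dataLaw G ν φ)
      = ∫⁻ x, ∫⁻ z, F ((x.1, x.2.1, x.2.2.1), z) ∂(gaussVec N 1) ∂(dataLaw G ν φ) := by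
  have hξ : Measurable fun x : Data p N => fun i => (locLik G φ x).ξ (Sum.inl i) :=
    measurable_pi_lambda _ fun i => measurable_locLik_ξ _
  have h1 : Measurable fun x : Data p N =>
      F ((x.1, x.2.1, x.2.2.1), fun i => (locLik G φ x).ξ (Sum.inl i)) :=
    hF.comp (Measurable.prodMk (by fun_prop) hξ)
  have h2 : Measurable fun x : Data p N => ∫⁻ z, F ((x.1, x.2.1, x.2.2.1), z) ∂(gaussVec N 1) :=
    (Measurable.lintegral_prod_right' hF).comp
      (g := fun c => ∫⁻ z, F (c, z) ∂(gaussVec N 1)) (f := fun x : Data p N => (x.1, x.2.1, x.2.2.1))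
      (by fun_prop)
  have hg := measurable_generate G φ
  unfold dataLaw
  rw [lintegral_map h1 hg, lintegral_map h2 hg,
    lintegral_latentLaw (H := fun ω => F (((generate G φ ω).1, (generate G φ ω).2.1,
      (generate G φ ω).2.2.1), fun i => (locLik G φ (generate G φ ω)).ξ (Sum.inl i)))
      (h1.comp hg), lintegral_latentLaw (H := fun ω => ∫⁻ z, F (((generate G φ ω).1,
      (generate G φ ω).2.1, (generate G φ ω).2.2.1), z) ∂(gaussVec N 1)) (h2.comp hg)]
  refine lintegral_congr fun C => lintegral_congr fun eA => lintegral_congr fun bM =>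
    lintegral_congr fun eM => ?_
  simp only [locLik_ξ_generate_inl]
  simp only [generate]
  rw [lintegral_noise (hφ 0) (hφ 1) (F := fun z => F ((C, genA φ C eA,
    genM G φ C (genA φ C eA) bM eM), z)) (hF.comp measurable_prodMk_left)]
  simp

/-- Independence holds given `(C, A)` only, as `Y` contains the mediator noise; this suffices
because the mediator means are functions of `(C, A)`. -/
theorem lintegral_mediator_noise (hφ : ∀ k, 0 < sigmaSq φ k)
    {F : ((Fin N → Fin p → ℝ) × (Fin N → ℝ)) × (Fin N → ℝ) → ENNReal}
    (hF : Measurable F) :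
    ∫⁻ x, F ((x.1, x.2.1), fun i => (locLik G φ x).ξ (Sum.inr i)) ∂(dataLaw G ν φ)
      = ∫⁻ x, ∫⁻ z, F ((x.1, x.2.1), z) ∂(gaussVec N 1) ∂(dataLaw G ν φ) := by
  have hξ : Measurable fun x : Data p N => fun i => (locLik G φ x).ξ (Sum.inr i) :=
    measurable_pi_lambda _ fun i => measurable_locLik_ξ _
  have h1 : Measurable fun x : Data p N =>
      F ((x.1, x.2.1), fun i => (locLik G φ x).ξ (Sum.inr i)) :=
    hF.comp (Measurable.prodMk (by fun_prop) hξ)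
  have h2 : Measurable fun x : Data p N => ∫⁻ z, F ((x.1, x.2.1), z) ∂(gaussVec N 1) :=
    (Measurable.lintegral_prod_right' hF).comp
      (g := fun c => ∫⁻ z, F (c, z) ∂(gaussVec N 1)) (f := fun x : Data p N => (x.1, x.2.1))
      (by fun_prop)
  have hg := measurable_generate G φ
  unfold dataLaw
  rw [lintegral_map h1 hg, lintegral_map h2 hg,
    lintegral_latentLaw (H := fun ω => F (((generate G φ ω).1, (generate G φ ω).2.1),
      fun i => (locLik G φ (generate G φ ω)).ξ (Sum.inr i)))
      (h1.comp hg), lintegral_latentLaw (H := fun ω => ∫⁻ z, F (((generate G φ ω).1,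
      (generate G φ ω).2.1), z) ∂(gaussVec N 1)) (h2.comp hg)]
  refine lintegral_congr fun C => lintegral_congr fun eA => ?_
  simp only [locLik_ξ_generate_inr]
  simp only [generate, lintegral_const, measure_univ, mul_one]
  rw [lintegral_noise (hφ 2) (hφ 3) (F := fun z => F ((C, genA φ C eA), z))
    (hF.comp measurable_prodMk_left)]

theorem lintegral_exposure {F : (Fin N → Fin p → ℝ) × (Fin N → ℝ) → ENNReal}
    (hF : Measurable F) :
    ∫⁻ x, F (x.1, x.2.1) ∂(dataLaw G ν φ)
      = ∫⁻ C, ∫⁻ e, F (C, genA φ C e) ∂(unifVec N) ∂ν := by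
  have h1 : Measurable fun x : Data p N => F (x.1, x.2.1) := hF.comp (by fun_prop)
  have hg := measurable_generate G φ
  unfold dataLaw
  rw [lintegral_map h1 hg, lintegral_latentLaw (H := fun ω => F ((generate G φ ω).1,
    (generate G φ ω).2.1)) (h1.comp hg)]
  simp [generate]

/-- The right-hand side does not involve `φ`. This permits changing the parameter of the law for
every statistic of the confounders alone. -/
theorem lintegral_confounder {F : (Fin N → Fin p → ℝ) → ENNReal} (hF : Measurable F) :
    ∫⁻ x, F x.1 ∂(dataLaw G ν φ) = ∫⁻ C, F C ∂ν := by
  rw [lintegral_exposure (F := fun c => F c.1) (hF.comp measurable_fst)]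
  simp

end Laws

/-! ### The Fisher information at the true parameter -/

section Fisher

variable {p N : ℕ}

/-- Restriction of a parameter vector to a set of coordinates. -/
noncomputable def coordRestrict (s : ParamIdx p → Bool) : Param p →ₗ[ℝ] Param p where
  toFun v := WithLp.toLp 2 fun k => if s k then v k else 0
  map_add' u v := by
    ext k
    simp only [PiLp.add_apply]
    split_ifs <;> simp
  map_smul' c v := by
    ext k
    simp only [PiLp.smul_apply, RingHom.id_apply]
    split_ifs <;> simp

theorem coordRestrict_apply (s : ParamIdx p → Bool) (v : Param p) (k : ParamIdx p) :
    coordRestrict s v k = if s k then v k else 0 := rfl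

/-- The coordinates `β` and `γ`. -/
def isMean : ParamIdx p → Bool
  | Sum.inl _ => true
  | Sum.inr (Sum.inl _) => true
  | Sum.inr (Sum.inr _) => false

/-- The coordinates `α`. -/
def isAlpha : ParamIdx p → Bool
  | Sum.inr (Sum.inr (Sum.inl _)) => true
  | _ => false

/-- Restriction to the mean parameters. -/
noncomputable abbrev meanPart : Param p →ₗ[ℝ] Param p := coordRestrict isMean

/-- Restriction to the parameters of the exposure model. -/
noncomputable abbrev alphaPart : Param p →ₗ[ℝ] Param p := coordRestrict isAlpha

variable {G : SimpleGraph (Fin N)}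

theorem sigmaSq_meanPart (v : Param p) (k : Fin 4) : sigmaSq (meanPart v) k = 0 := by
  simp [sigmaSq, coordRestrict_apply, isMean]

theorem sigmaSq_alphaPart (v : Param p) (k : Fin 4) : sigmaSq (alphaPart v) k = 0 := by
  simp [sigmaSq, coordRestrict_apply, isAlpha]

theorem resVar_meanPart (v : Param p) (j : Fin N ⊕ Fin N) : resVar G j (meanPart v) = 0 := by
  rcases j with i | i <;> simp [resVar_inl, resVar_inr, sigmaSq_meanPart]

theorem resVar_alphaPart (v : Param p) (j : Fin N ⊕ Fin N) : resVar G j (alphaPart v) = 0 := by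
  rcases j with i | i <;> simp [resVar_inl, resVar_inr, sigmaSq_alphaPart]

theorem outMean_meanPart (v : Param p) (C : Fin N → Fin p → ℝ) (A M : Fin N → ℝ) :
    outMean G (meanPart v) C A M = outMean G v C A M := by
  ext i
  simp [outMean, betaS, beta5, beta6, coordRestrict_apply, isMean, dotProduct]

theorem medMean_meanPart (v : Param p) (C : Fin N → Fin p → ℝ) (A : Fin N → ℝ) :
    medMean G (meanPart v) C A = medMean G v C A := by
  ext i
  simp [medMean, gammaS, gamma3, gamma4, coordRestrict_apply, isMean, dotProduct]

theorem outMean_eq_zero_of_alphaPart (v : Param p) (C : Fin N → Fin p → ℝ) (A M : Fin N → ℝ) :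
    outMean G (alphaPart v) C A M = 0 := by
  ext i
  simp [outMean, betaS, beta5, beta6, coordRestrict_apply, isAlpha, dotProduct]

theorem medMean_eq_zero_of_alphaPart (v : Param p) (C : Fin N → Fin p → ℝ) (A : Fin N → ℝ) :
    medMean G (alphaPart v) C A = 0 := by
  ext i
  simp [medMean, gammaS, gamma3, gamma4, coordRestrict_apply, isAlpha, dotProduct]

theorem rotMean_meanPart (x : Data p N) (v : Param p) (j : Fin N ⊕ Fin N) :
    rotMean G x j (meanPart v) = rotMean G x j v := by
  rcases j with i | i
  · rw [rotMean_inl, rotMean_inl, outMean_meanPart]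
  · rw [rotMean_inr, rotMean_inr, medMean_meanPart]

theorem rotMean_alphaPart (x : Data p N) (v : Param p) (j : Fin N ⊕ Fin N) :
    rotMean G x j (alphaPart v) = 0 := by
  rcases j with i | i
  · rw [rotMean_inl, outMean_eq_zero_of_alphaPart, map_zero]; rfl
  · rw [rotMean_inr, medMean_eq_zero_of_alphaPart, map_zero]; rfl

theorem logit_meanPart (C : Fin N → Fin p → ℝ) (i : Fin N) (v : Param p) :
    logit C i (meanPart v) = 0 := by
  simp [logit_apply, alpha, coordRestrict_apply, isMean, dotProduct]

theorem logit_alphaPart (C : Fin N → Fin p → ℝ) (i : Fin N) (v : Param p) :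
    logit C i (alphaPart v) = logit C i v := by
  simp [logit_apply, alpha, coordRestrict_apply, isAlpha, dotProduct]

variable {ν : Measure (Fin N → Fin p → ℝ)} [IsProbabilityMeasure ν] {φ : Param p}

theorem memLp_locLik_ξ (hφ : ∀ k, 0 < sigmaSq φ k) (j : Fin N ⊕ Fin N) :
    MemLp (fun x : Data p N => (locLik G φ x).ξ j) 2 (dataLaw G ν φ) := by
  refine (memLp_two_iff_integrable_sq (measurable_locLik_ξ j).aestronglyMeasurable).2
    ⟨((measurable_locLik_ξ j).pow_const 2).aestronglyMeasurable, ?_⟩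
  rw [hasFiniteIntegral_iff_ofReal (Eventually.of_forall fun x => sq_nonneg _)]
  rcases j with i | i
  · have h := lintegral_outcome_noise (G := G) (ν := ν) hφ
      (F := fun c => ENNReal.ofReal ((0 + 1 * c.2 i) ^ 2)) (by fun_prop)
    simp only [lintegral_add_mul_sq_gaussVec, lintegral_const, measure_univ] at h
    simp only [zero_add, one_mul] at h
    rw [h]; simp
  · have h := lintegral_mediator_noise (G := G) (ν := ν) hφ
      (F := fun c => ENNReal.ofReal ((0 + 1 * c.2 i) ^ 2)) (by fun_prop)
    simp only [lintegral_add_mul_sq_gaussVec, lintegral_const, measure_univ] at h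
    simp only [zero_add, one_mul] at h
    rw [h]; simp

/-- The residual is centred with unit variance and independent of the mean `x_j`, so the cross term
drops. Lower integrals make this valid before any integrability of `x_j` is known. -/
theorem lintegral_locLik_x_add_ξ (hφ : ∀ k, 0 < sigmaSq φ k) (j : Fin N ⊕ Fin N) (v : Param p)
    (l : ℝ) :
    ∫⁻ x, ENNReal.ofReal (((locLik G φ x).x j v + l * (locLik G φ x).ξ j) ^ 2)
        ∂(dataLaw G ν φ)
      = ∫⁻ x, ENNReal.ofReal ((locLik G φ x).x j v ^ 2 + l ^ 2) ∂(dataLaw G ν φ) := by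
  rcases j with i | i
  -- The outcome mean depends on the data through `(C, A, M)` only, so the slot of `Y` may be filled
  -- with `0`; in the mediator case those of `M` and `Y`.
  · have hm : Measurable fun c : (Fin N → Fin p → ℝ) × (Fin N → ℝ) × (Fin N → ℝ) =>
        (locLik G φ (c.1, c.2.1, c.2.2, 0)).x (Sum.inl i) v :=
      (measurable_locLik_x (G := G) (φ := φ) (Sum.inl i) v).comp
        (g := fun x : Data p N => (locLik G φ x).x (Sum.inl i) v)
        (f := fun c : (Fin N → Fin p → ℝ) × (Fin N → ℝ) × (Fin N → ℝ) => (c.1, c.2.1, c.2.2, 0))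
        (by fun_prop)
    have h := lintegral_outcome_noise (G := G) (ν := ν) hφ
      (F := fun c => ENNReal.ofReal (((locLik G φ (c.1.1, c.1.2.1, c.1.2.2, 0)).x (Sum.inl i) v
        + l * c.2 i) ^ 2)) (by
          have : Measurable fun c : ((Fin N → Fin p → ℝ) × (Fin N → ℝ) × (Fin N → ℝ))
              × (Fin N → ℝ) => (locLik G φ (c.1.1, c.1.2.1, c.1.2.2, 0)).x (Sum.inl i) v :=
            hm.comp measurable_fst
          exact ((this.add ((by fun_prop : Measurable fun c : ((Fin N → Fin p → ℝ) ×
            (Fin N → ℝ) × (Fin N → ℝ)) × (Fin N → ℝ) => l * c.2 i))).pow_const 2).ennreal_ofReal)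
    simp only [lintegral_add_mul_sq_gaussVec] at h
    exact h
  · have hm : Measurable fun c : (Fin N → Fin p → ℝ) × (Fin N → ℝ) =>
        (locLik G φ (c.1, c.2, 0, 0)).x (Sum.inr i) v :=
      (measurable_locLik_x (G := G) (φ := φ) (Sum.inr i) v).comp
        (g := fun x : Data p N => (locLik G φ x).x (Sum.inr i) v)
        (f := fun c : (Fin N → Fin p → ℝ) × (Fin N → ℝ) => (c.1, c.2, 0, 0))
        (by fun_prop)
    have h := lintegral_mediator_noise (G := G) (ν := ν) hφ
      (F := fun c => ENNReal.ofReal (((locLik G φ (c.1.1, c.1.2, 0, 0)).x (Sum.inr i) v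
        + l * c.2 i) ^ 2)) (by
          have : Measurable fun c : ((Fin N → Fin p → ℝ) × (Fin N → ℝ)) × (Fin N → ℝ) =>
              (locLik G φ (c.1.1, c.1.2, 0, 0)).x (Sum.inr i) v := hm.comp measurable_fst
          exact ((this.add ((by fun_prop : Measurable fun c : ((Fin N → Fin p → ℝ) ×
            (Fin N → ℝ)) × (Fin N → ℝ) => l * c.2 i))).pow_const 2).ennreal_ofReal)
    simp only [lintegral_add_mul_sq_gaussVec] at h
    exact h

/-- The information at the true parameter in a direction `v`. -/
theorem qf_obsInfo_self (hφ : ∀ k, 0 < sigmaSq φ k) (x : Data p N) (v : Param p) :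
    qf (obsInfo G x φ) v.ofLp
      = (∑ j, (((locLik G φ x).x j v + (locLik G φ x).L j v * (locLik G φ x).ξ j) ^ 2
          - 1 / 2 * (locLik G φ x).L j v ^ 2))
        + ∑ i, expitDeriv (logit x.1 i φ) * logit x.1 i v ^ 2 := by
  have h := qf_obsInfo (w := 0) x (resVar_pos G hφ) (by simpa using resVar_pos G hφ) v
  rw [add_zero] at h
  rw [h]
  simp [LocalLik.gaussInfo, LocalLik.logitInfo, locLik]

/-- The integral of a non-integrable function is zero by convention, which a positive definite
matrix does not allow on its diagonal. All moment bounds on the confounders come from here. -/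
theorem integrable_obsInfo_diag (hB : (fisherInfo G ν φ).PosDef) (k : ParamIdx p) :
    Integrable (fun x => obsInfo G x φ k k) (dataLaw G ν φ) := by
  by_contra h
  have h1 : fisherInfo G ν φ k k = 0 := by
    simp only [fisherInfo, Matrix.of_apply]
    exact integral_undef h
  exact (hB.diag_pos (i := k)).ne' h1

theorem qf_single (A : Matrix (ParamIdx p) (ParamIdx p) ℝ) (k : ParamIdx p) :
    qf A (Pi.single k 1) = A k k := by
  simp [qf]

theorem meanPart_single (k : ParamIdx p) (hk : isMean k = true) :
    meanPart (EuclideanSpace.single k (1 : ℝ)) = EuclideanSpace.single k 1 := by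
  ext l
  rw [coordRestrict_apply]
  by_cases h : l = k
  · subst h; simp [hk]
  · simp [h]

theorem meanPart_single_eq_zero (k : ParamIdx p) (hk : isMean k = false) :
    meanPart (EuclideanSpace.single k (1 : ℝ)) = 0 := by
  ext l
  rw [coordRestrict_apply]
  by_cases h : l = k
  · subst h; simp [hk]
  · simp [h]

theorem alphaPart_single (k : ParamIdx p) (hk : isAlpha k = true) :
    alphaPart (EuclideanSpace.single k (1 : ℝ)) = EuclideanSpace.single k 1 := by
  ext l
  rw [coordRestrict_apply]
  by_cases h : l = k
  · subst h; simp [hk]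
  · simp [h]

theorem alphaPart_single_eq_zero (k : ParamIdx p) (hk : isAlpha k = false) :
    alphaPart (EuclideanSpace.single k (1 : ℝ)) = 0 := by
  ext l
  rw [coordRestrict_apply]
  by_cases h : l = k
  · subst h; simp [hk]
  · simp [h]

theorem memLp_of_sum_sq_integrable {Ω ι : Type*} [MeasurableSpace Ω] {μ : Measure Ω} [Fintype ι]
    {f : ι → Ω → ℝ} (hf : ∀ j, Measurable (f j)) (h : Integrable (fun x => ∑ j, f j x ^ 2) μ)
    (j : ι) : MemLp (f j) 2 μ := by
  refine (memLp_two_iff_integrable_sq (hf j).aestronglyMeasurable).2 ?_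
  refine h.mono ((hf j).pow_const 2).aestronglyMeasurable (Eventually.of_forall fun x => ?_)
  rw [Real.norm_of_nonneg (sq_nonneg _),
    Real.norm_of_nonneg (Finset.sum_nonneg fun _ _ => sq_nonneg _)]
  exact Finset.single_le_sum (f := fun j => f j x ^ 2) (fun _ _ => sq_nonneg _)
    (Finset.mem_univ j)

/-- For a mean coordinate the diagonal entry of the observed information is exactly `∑ x_j²`, so its
integrability bounds every summand. Other coordinates do not move the means, and linearity gives all
directions. -/
theorem memLp_locLik_x (hφ : ∀ k, 0 < sigmaSq φ k) (hB : (fisherInfo G ν φ).PosDef)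
    (j : Fin N ⊕ Fin N) (v : Param p) :
    MemLp (fun x : Data p N => (locLik G φ x).x j v) 2 (dataLaw G ν φ) := by
  have hk : ∀ k, MemLp (fun x : Data p N =>
      (locLik G φ x).x j (EuclideanSpace.single k 1)) 2 (dataLaw G ν φ) := fun k => by
    cases hm : isMean k with
    | false =>
      have : ∀ x : Data p N, (locLik G φ x).x j (EuclideanSpace.single k 1) = 0 := fun x => by
        simp only [locLik, LinearMap.smul_apply]
        rw [← rotMean_meanPart, meanPart_single_eq_zero k hm]
        simp
      simp only [this]
      exact memLp_const 0
    | true =>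
      refine memLp_of_sum_sq_integrable
        (f := fun j (x : Data p N) => (locLik G φ x).x j (EuclideanSpace.single k 1))
        (fun j => measurable_locLik_x j _) ?_ j
      refine (integrable_obsInfo_diag hB k).congr (Eventually.of_forall fun x => ?_)
      have h := qf_obsInfo_self (G := G) hφ x (EuclideanSpace.single k 1)
      have hs : (EuclideanSpace.single k (1 : ℝ) : Param p).ofLp = Pi.single k 1 := rfl
      rw [hs, qf_single] at h
      have hL : ∀ j, (locLik G φ x).L j (EuclideanSpace.single k 1) = 0 := fun j => by
        simp only [locLik, LinearMap.smul_apply]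
        rw [← meanPart_single k hm, resVar_meanPart]
        simp
      have ht : ∀ i, logit x.1 i (EuclideanSpace.single k 1) = 0 := fun i => by
        rw [← meanPart_single k hm, logit_meanPart]
      simp only [hL, ht] at h
      simpa using h
  have e : (fun x : Data p N => (locLik G φ x).x j v)
      = fun x => ∑ k, v k * (locLik G φ x).x j (EuclideanSpace.single k 1) := by
    ext x
    conv_lhs => rw [← single_sum v]
    simp
  rw [e]
  exact memLp_finsetSum _ fun k _ => (hk k).const_mul (v k)

/-- The same device applied to the coordinates of `α`, whose diagonal entries are the weighted sums
of squared logits. -/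
theorem memLp_sqrt_expitDeriv_mul_logit (hφ : ∀ k, 0 < sigmaSq φ k)
    (hB : (fisherInfo G ν φ).PosDef) (i : Fin N) (v : Param p) :
    MemLp (fun x : Data p N => Real.sqrt (expitDeriv (logit x.1 i φ)) * logit x.1 i v) 2
      (dataLaw G ν φ) := by
  have hmeas : ∀ i (v : Param p), Measurable fun x : Data p N =>
      Real.sqrt (expitDeriv (logit x.1 i φ)) * logit x.1 i v := fun i v =>
    (measurable_expitDeriv.comp ((measurable_logit i φ).comp measurable_fst)).sqrt.mul
      ((measurable_logit i v).comp measurable_fst)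
  have hk : ∀ k, MemLp (fun x : Data p N => Real.sqrt (expitDeriv (logit x.1 i φ))
      * logit x.1 i (EuclideanSpace.single k 1)) 2 (dataLaw G ν φ) := fun k => by
    cases hm : isAlpha k with
    | false =>
      have : ∀ x : Data p N, logit x.1 i (EuclideanSpace.single k 1) = 0 := fun x => by
        rw [← logit_alphaPart, alphaPart_single_eq_zero k hm, map_zero]
      simp only [this, mul_zero]
      exact memLp_const 0
    | true =>
      refine memLp_of_sum_sq_integrable
        (f := fun i (x : Data p N) => Real.sqrt (expitDeriv (logit x.1 i φ))
          * logit x.1 i (EuclideanSpace.single k 1)) (fun i => hmeas i _) ?_ i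
      refine (integrable_obsInfo_diag hB k).congr (Eventually.of_forall fun x => ?_)
      have h := qf_obsInfo_self (G := G) hφ x (EuclideanSpace.single k 1)
      have hs : (EuclideanSpace.single k (1 : ℝ) : Param p).ofLp = Pi.single k 1 := rfl
      rw [hs, qf_single] at h
      have hL : ∀ j, (locLik G φ x).L j (EuclideanSpace.single k 1) = 0 := fun j => by
        simp only [locLik, LinearMap.smul_apply]
        rw [← alphaPart_single k hm, resVar_alphaPart]
        simp
      have hx : ∀ j, (locLik G φ x).x j (EuclideanSpace.single k 1) = 0 := fun j => by
        simp only [locLik, LinearMap.smul_apply]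
        rw [← alphaPart_single k hm, rotMean_alphaPart]
        simp
      simp only [hL, hx] at h
      simp only [mul_pow, Real.sq_sqrt (expitDeriv_pos _).le]
      simpa using h
  have e : (fun x : Data p N => Real.sqrt (expitDeriv (logit x.1 i φ)) * logit x.1 i v)
      = fun x => ∑ k, v k * (Real.sqrt (expitDeriv (logit x.1 i φ))
        * logit x.1 i (EuclideanSpace.single k 1)) := by
    ext x
    conv_lhs => rw [← single_sum v]
    simp only [map_sum, map_smul, smul_eq_mul, Finset.mul_sum]
    exact Finset.sum_congr rfl fun k _ => by ring
  rw [e]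
  exact memLp_finsetSum _ fun k _ => (hk k).const_mul (v k)

theorem integrable_expitDeriv_mul_logit (hφ : ∀ k, 0 < sigmaSq φ k)
    (hB : (fisherInfo G ν φ).PosDef) (i : Fin N) (v : Param p) :
    Integrable (fun x : Data p N => expitDeriv (logit x.1 i φ) * logit x.1 i v ^ 2)
      (dataLaw G ν φ) := by
  have := (memLp_sqrt_expitDeriv_mul_logit hφ hB i v).integrable_sq
  simpa only [mul_pow, Real.sq_sqrt (expitDeriv_pos _).le] using this

theorem memLp_locLik_x_add (hφ : ∀ k, 0 < sigmaSq φ k) (hB : (fisherInfo G ν φ).PosDef)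
    (j : Fin N ⊕ Fin N) (v : Param p) (l : ℝ) :
    MemLp (fun x : Data p N => (locLik G φ x).x j v + l * (locLik G φ x).ξ j) 2
      (dataLaw G ν φ) :=
  (memLp_locLik_x hφ hB j v).add ((memLp_locLik_ξ hφ j).const_mul l)

/-- The relative change of the variances does not depend on the data. -/
noncomputable def relVar (G : SimpleGraph (Fin N)) (φ : Param p) (j : Fin N ⊕ Fin N) :
    Param p →ₗ[ℝ] ℝ := (1 / resVar G j φ) • resVar G j

theorem locLik_L (x : Data p N) : (locLik G φ x).L = relVar G φ := rfl

theorem integrable_qf_obsInfo (hφ : ∀ k, 0 < sigmaSq φ k) (hB : (fisherInfo G ν φ).PosDef)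
    (v : Param p) : Integrable (fun x => qf (obsInfo G x φ) v.ofLp) (dataLaw G ν φ) := by
  simp only [qf_obsInfo_self hφ, locLik_L]
  refine Integrable.add (integrable_finsetSum _ fun j _ => ?_)
    (integrable_finsetSum _ fun i _ => integrable_expitDeriv_mul_logit hφ hB i v)
  exact (memLp_locLik_x_add hφ hB j v _).integrable_sq.sub (integrable_const _)

theorem integrable_obsInfo (hφ : ∀ k, 0 < sigmaSq φ k) (hB : (fisherInfo G ν φ).PosDef)
    (k l : ParamIdx p) : Integrable (fun x => obsInfo G x φ k l) (dataLaw G ν φ) := by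
  have e : (fun x => obsInfo G x φ k l) = fun x =>
      (qf (obsInfo G x φ) (EuclideanSpace.single k 1 + EuclideanSpace.single l 1 : Param p).ofLp
        - qf (obsInfo G x φ) (EuclideanSpace.single k 1 : Param p).ofLp
        - qf (obsInfo G x φ) (EuclideanSpace.single l 1 : Param p).ofLp) / 2 :=
    funext fun x => obsInfo_apply_eq x (resVar_pos G hφ) k l
  rw [e]
  exact (((integrable_qf_obsInfo hφ hB _).sub (integrable_qf_obsInfo hφ hB _)).sub
    (integrable_qf_obsInfo hφ hB _)).div_const 2

theorem qf_fisherInfo_eq_integral (hφ : ∀ k, 0 < sigmaSq φ k) (hB : (fisherInfo G ν φ).PosDef)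
    (v : Param p) :
    qf (fisherInfo G ν φ) v.ofLp = ∫ x, qf (obsInfo G x φ) v.ofLp ∂(dataLaw G ν φ) := by
  have hint := integrable_obsInfo hφ hB
  simp only [qf, dotProduct, Matrix.mulVec]
  rw [integral_finsetSum _ fun k _ => (integrable_finsetSum _ fun l _ =>
    (hint k l).mul_const _).const_mul _]
  refine Finset.sum_congr rfl fun k _ => ?_
  rw [integral_const_mul, integral_finsetSum _ fun l _ => (hint k l).mul_const _]
  congr 1
  refine Finset.sum_congr rfl fun l _ => ?_
  rw [integral_mul_const]
  rfl

theorem integral_locLik_x_add_sq (hφ : ∀ k, 0 < sigmaSq φ k) (hB : (fisherInfo G ν φ).PosDef)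
    (j : Fin N ⊕ Fin N) (v : Param p) (l : ℝ) :
    ∫ x, ((locLik G φ x).x j v + l * (locLik G φ x).ξ j) ^ 2 ∂(dataLaw G ν φ)
      = ∫ x, (locLik G φ x).x j v ^ 2 ∂(dataLaw G ν φ) + l ^ 2 := by
  have hx := (memLp_locLik_x (G := G) (ν := ν) hφ hB j v).integrable_sq
  have hxl : Integrable (fun x => (locLik G φ x).x j v ^ 2 + l ^ 2) (dataLaw G ν φ) :=
    hx.add (integrable_const _)
  have h := lintegral_locLik_x_add_ξ (G := G) (ν := ν) hφ j v l
  rw [← ofReal_integral_eq_lintegral_ofReal (memLp_locLik_x_add hφ hB j v l).integrable_sq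
    (Eventually.of_forall fun x => sq_nonneg _),
    ← ofReal_integral_eq_lintegral_ofReal hxl
    (Eventually.of_forall fun x => by positivity)] at h
  rw [ENNReal.ofReal_eq_ofReal_iff (integral_nonneg fun x => sq_nonneg _)
    (integral_nonneg fun x => by positivity), integral_add hx (integrable_const _)] at h
  simpa using h

/-- Explicit form of the Fisher information. -/
theorem qf_fisherInfo_eq (hφ : ∀ k, 0 < sigmaSq φ k) (hB : (fisherInfo G ν φ).PosDef)
    (v : Param p) :
    qf (fisherInfo G ν φ) v.ofLp
      = ∑ j, ∫ x, (locLik G φ x).x j v ^ 2 ∂(dataLaw G ν φ)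
        + 1 / 2 * ∑ j, relVar G φ j v ^ 2
        + ∑ i, ∫ x, expitDeriv (logit x.1 i φ) * logit x.1 i v ^ 2 ∂(dataLaw G ν φ) := by
  rw [qf_fisherInfo_eq_integral hφ hB]
  simp only [qf_obsInfo_self hφ, locLik_L]
  have h1 : ∀ j, Integrable (fun x : Data p N => ((locLik G φ x).x j v
      + relVar G φ j v * (locLik G φ x).ξ j) ^ 2 - 1 / 2 * relVar G φ j v ^ 2)
      (dataLaw G ν φ) := fun j =>
    (memLp_locLik_x_add hφ hB j v _).integrable_sq.sub (integrable_const _)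
  have h2 := fun i => integrable_expitDeriv_mul_logit (G := G) (ν := ν) hφ hB i v
  rw [integral_add (integrable_finsetSum _ fun j _ => h1 j) (integrable_finsetSum _ fun i _ => h2 i),
    integral_finsetSum _ fun j _ => h1 j, integral_finsetSum _ fun i _ => h2 i]
  congr 1
  rw [Finset.mul_sum, ← Finset.sum_add_distrib]
  refine Finset.sum_congr rfl fun j _ => ?_
  rw [integral_sub (memLp_locLik_x_add hφ hB j v _).integrable_sq (integrable_const _),
    integral_locLik_x_add_sq hφ hB]
  simp
  ring

theorem qf_fisherInfo_meanPart (hφ : ∀ k, 0 < sigmaSq φ k) (hB : (fisherInfo G ν φ).PosDef)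
    (v : Param p) :
    qf (fisherInfo G ν φ) (meanPart v).ofLp
      = ∑ j, ∫ x, (locLik G φ x).x j v ^ 2 ∂(dataLaw G ν φ) := by
  rw [qf_fisherInfo_eq hφ hB]
  simp only [relVar, locLik, LinearMap.smul_apply, resVar_meanPart, rotMean_meanPart,
    logit_meanPart]
  simp

theorem qf_fisherInfo_alphaPart (hφ : ∀ k, 0 < sigmaSq φ k) (hB : (fisherInfo G ν φ).PosDef)
    (v : Param p) :
    qf (fisherInfo G ν φ) (alphaPart v).ofLp
      = ∑ i, ∫ x, expitDeriv (logit x.1 i φ) * logit x.1 i v ^ 2 ∂(dataLaw G ν φ) := by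
  rw [qf_fisherInfo_eq hφ hB]
  simp only [relVar, locLik, LinearMap.smul_apply, resVar_alphaPart, rotMean_alphaPart,
    logit_alphaPart]
  simp

/-- Centred residuals remove the covariance between mean and variance directions, and the exposure
likelihood shares no parameter with the other two. -/
theorem splits_locLik (hφ : ∀ k, 0 < sigmaSq φ k) (hB : (fisherInfo G ν φ).PosDef)
    (x : Data p N) :
    (locLik G φ x).Splits (fun v => qf (fisherInfo G ν φ) v.ofLp) meanPart alphaPart where
  b_nonneg v := qf_nonneg hB _
  b_quad u v := ⟨u.ofLp ⬝ᵥ (fisherInfo G ν φ *ᵥ v.ofLp) + v.ofLp ⬝ᵥ (fisherInfo G ν φ *ᵥ u.ofLp),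
    fun r => by
      simp only [qf, WithLp.ofLp_add, WithLp.ofLp_smul, Matrix.mulVec_add, Matrix.mulVec_smul,
        dotProduct_add, add_dotProduct, smul_dotProduct, dotProduct_smul, smul_eq_mul]
      ring⟩
  b_split v := by
    rw [qf_fisherInfo_meanPart hφ hB, qf_fisherInfo_alphaPart hφ hB, qf_fisherInfo_eq hφ hB]
    rfl
  L_Pm j v := by simp [locLik, resVar_meanPart]
  x_Pm j v := by simp [locLik, rotMean_meanPart]
  t_Pm i v := by simp [locLik, logit_meanPart]
  L_Pa j v := by simp [locLik, resVar_alphaPart]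
  x_Pa j v := by simp [locLik, rotMean_alphaPart]
  t_Pa i v := by simp [locLik, logit_alphaPart]
  Pm_Pm v := by
    ext k; simp only [coordRestrict_apply]; split_ifs <;> rfl
  Pa_Pa v := by
    ext k; simp only [coordRestrict_apply]; split_ifs <;> rfl
  Pm_Pa v := by
    ext k
    rcases k with k | k | k | k <;> simp [coordRestrict_apply, isMean, isAlpha]
  Pa_Pm v := by
    ext k
    rcases k with k | k | k | k <;> simp [coordRestrict_apply, isMean, isAlpha]

end Fisher

/-! ### Uniform bounds for the score -/

section Score

variable {p N : ℕ}

/-- A geometrically weighted sum controlling `∑ i, a i / (1 - c * q i)` for all `c ≤ r`. -/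
noncomputable def geoSum (r : ℝ) (q a : Fin N → ℝ) : ENNReal :=
  ∑' n : ℕ, ENNReal.ofReal (r ^ n * |∑ i, a i * q i ^ n|)

theorem measurable_geoSum {Ω : Type*} [MeasurableSpace Ω] (r : ℝ) (q : Fin N → ℝ)
    {A : Ω → Fin N → ℝ} (hA : ∀ i, Measurable fun x => A x i) :
    Measurable fun x => geoSum r q (A x) := by
  unfold geoSum
  refine Measurable.tsum fun n => ?_
  have : Measurable fun x => ∑ i, A x i * q i ^ n :=
    Finset.measurable_fun_sum _ fun i _ => (hA i).mul_const _
  exact ((this.abs).const_mul _).ennreal_ofReal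

theorem lintegral_abs_le_one_add_sq {Ω : Type*} [MeasurableSpace Ω] {μ : Measure Ω}
    [IsProbabilityMeasure μ] {T : Ω → ℝ} {V : ℝ} (hV : 0 ≤ V)
    (h : ∫⁻ x, ENNReal.ofReal (T x ^ 2) ∂μ ≤ ENNReal.ofReal V) :
    ∫⁻ x, ENNReal.ofReal |T x| ∂μ ≤ ENNReal.ofReal (1 + V) := by
  calc ∫⁻ x, ENNReal.ofReal |T x| ∂μ ≤ ∫⁻ x, (1 + ENNReal.ofReal (T x ^ 2)) ∂μ := by
        refine lintegral_mono fun x => ?_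
        simp only
        rw [← ENNReal.ofReal_one, ← ENNReal.ofReal_add zero_le_one (sq_nonneg _)]
        refine ENNReal.ofReal_le_ofReal ?_
        have := sq_abs (T x)
        nlinarith [sq_nonneg (|T x| - 1), abs_nonneg (T x)]
    _ = 1 + ∫⁻ x, ENNReal.ofReal (T x ^ 2) ∂μ := by
        rw [lintegral_add_left measurable_const]; simp
    _ ≤ ENNReal.ofReal (1 + V) := by
        rw [ENNReal.ofReal_add zero_le_one hV, ENNReal.ofReal_one]
        gcongr

/-- Each absolute moment has mean at most `1 + V`, by `|T| ≤ 1 + T²`, and the geometric weights sum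
to `1 / (1 - r)`. -/
theorem lintegral_geoSum_le {Ω : Type*} [MeasurableSpace Ω] {μ : Measure Ω}
    [IsProbabilityMeasure μ] {r V : ℝ} (hr0 : 0 ≤ r) (hr1 : r < 1) (hV : 0 ≤ V) (q : Fin N → ℝ)
    {A : Ω → Fin N → ℝ} (hA : ∀ i, Measurable fun x => A x i)
    (h : ∀ n : ℕ, ∫⁻ x, ENNReal.ofReal ((∑ i, A x i * q i ^ n) ^ 2) ∂μ ≤ ENNReal.ofReal V) :
    ∫⁻ x, geoSum r q (A x) ∂μ ≤ ENNReal.ofReal ((1 + V) / (1 - r)) := by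
  have hm : ∀ n : ℕ, Measurable fun x => ∑ i, A x i * q i ^ n := fun n =>
    Finset.measurable_fun_sum _ fun i _ => (hA i).mul_const _
  unfold geoSum
  rw [lintegral_tsum fun n => (((hm n).abs).const_mul _).ennreal_ofReal.aemeasurable]
  have hs : Summable fun n : ℕ => r ^ n * (1 + V) :=
    (summable_geometric_of_lt_one hr0 hr1).mul_right _
  calc _ ≤ ∑' n : ℕ, ENNReal.ofReal (r ^ n * (1 + V)) := by
        refine ENNReal.tsum_le_tsum fun n => ?_
        have hrn : 0 ≤ r ^ n := pow_nonneg hr0 n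
        simp only [ENNReal.ofReal_mul hrn]
        rw [lintegral_const_mul _ ((hm n).abs.ennreal_ofReal)]
        gcongr
        exact lintegral_abs_le_one_add_sq hV (h n)
    _ = ENNReal.ofReal ((1 + V) / (1 - r)) := by
        rw [← ENNReal.ofReal_tsum_of_nonneg (fun n => by positivity) hs, tsum_mul_right,
          tsum_geometric_of_lt_one hr0 hr1]
        congr 1
        field_simp

variable {G : SimpleGraph (Fin N)} {ν : Measure (Fin N → Fin p → ℝ)} [IsProbabilityMeasure ν]
  {φ : Param p}

theorem lintegral_sum_chi_inl (hφ : ∀ k, 0 < sigmaSq φ k) (c : Fin N → ℝ) :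
    ∫⁻ x, ENNReal.ofReal ((∑ i, c i * ((locLik G φ x).ξ (Sum.inl i) ^ 2 - 1)) ^ 2)
      ∂(dataLaw G ν φ) = ENNReal.ofReal (chiVar * ∑ i, c i ^ 2) := by
  have h := lintegral_outcome_noise (G := G) (ν := ν) hφ
    (F := fun y => ENNReal.ofReal ((∑ i, c i * (y.2 i ^ 2 - 1)) ^ 2)) (by fun_prop)
  simp only [lintegral_sum_mul_chi, lintegral_const, measure_univ, mul_one] at h
  exact h

theorem lintegral_sum_chi_inr (hφ : ∀ k, 0 < sigmaSq φ k) (c : Fin N → ℝ) :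
    ∫⁻ x, ENNReal.ofReal ((∑ i, c i * ((locLik G φ x).ξ (Sum.inr i) ^ 2 - 1)) ^ 2)
      ∂(dataLaw G ν φ) = ENNReal.ofReal (chiVar * ∑ i, c i ^ 2) := by
  have h := lintegral_mediator_noise (G := G) (ν := ν) hφ
    (F := fun y => ENNReal.ofReal ((∑ i, c i * (y.2 i ^ 2 - 1)) ^ 2)) (by fun_prop)
  simp only [lintegral_sum_mul_chi, lintegral_const, measure_univ, mul_one] at h
  exact h

/-- Conditionally on `(C, A, M)` the score is a linear form in standard normal variables, with the
means as coefficients. -/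
theorem lintegral_sum_score_inl (hφ : ∀ k, 0 < sigmaSq φ k) (v : Param p) (c : Fin N → ℝ) :
    ∫⁻ x, ENNReal.ofReal ((∑ i, (c i * (locLik G φ x).x (Sum.inl i) v)
        * (locLik G φ x).ξ (Sum.inl i)) ^ 2) ∂(dataLaw G ν φ)
      = ∫⁻ x, ENNReal.ofReal (∑ i, (c i * (locLik G φ x).x (Sum.inl i) v) ^ 2)
        ∂(dataLaw G ν φ) := by
  have hm : ∀ i, Measurable fun y : ((Fin N → Fin p → ℝ) × (Fin N → ℝ) × (Fin N → ℝ))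
      × (Fin N → ℝ) => (locLik G φ (y.1.1, y.1.2.1, y.1.2.2, 0)).x (Sum.inl i) v := fun i =>
    (measurable_locLik_x (G := G) (φ := φ) (Sum.inl i) v).comp
      (g := fun x : Data p N => (locLik G φ x).x (Sum.inl i) v)
      (f := fun y : ((Fin N → Fin p → ℝ) × (Fin N → ℝ) × (Fin N → ℝ)) × (Fin N → ℝ) =>
        (y.1.1, y.1.2.1, y.1.2.2, 0)) (by fun_prop)
  have hF : Measurable fun y : ((Fin N → Fin p → ℝ) × (Fin N → ℝ) × (Fin N → ℝ))
      × (Fin N → ℝ) => ∑ i, (c i * (locLik G φ (y.1.1, y.1.2.1, y.1.2.2, 0)).x (Sum.inl i) v)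
        * y.2 i :=
    Finset.measurable_fun_sum _ fun i _ => ((hm i).const_mul (c i)).mul (by fun_prop)
  have h := lintegral_outcome_noise (G := G) (ν := ν) hφ (hF.pow_const 2).ennreal_ofReal
  simp only [lintegral_sum_mul_gaussVec] at h
  exact h

theorem lintegral_sum_score_inr (hφ : ∀ k, 0 < sigmaSq φ k) (v : Param p) (c : Fin N → ℝ) :
    ∫⁻ x, ENNReal.ofReal ((∑ i, (c i * (locLik G φ x).x (Sum.inr i) v)
        * (locLik G φ x).ξ (Sum.inr i)) ^ 2) ∂(dataLaw G ν φ)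
      = ∫⁻ x, ENNReal.ofReal (∑ i, (c i * (locLik G φ x).x (Sum.inr i) v) ^ 2)
        ∂(dataLaw G ν φ) := by
  have hm : ∀ i, Measurable fun y : ((Fin N → Fin p → ℝ) × (Fin N → ℝ))
      × (Fin N → ℝ) => (locLik G φ (y.1.1, y.1.2, 0, 0)).x (Sum.inr i) v := fun i =>
    (measurable_locLik_x (G := G) (φ := φ) (Sum.inr i) v).comp
      (g := fun x : Data p N => (locLik G φ x).x (Sum.inr i) v)
      (f := fun y : ((Fin N → Fin p → ℝ) × (Fin N → ℝ)) × (Fin N → ℝ) =>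
        (y.1.1, y.1.2, 0, 0)) (by fun_prop)
  have hF : Measurable fun y : ((Fin N → Fin p → ℝ) × (Fin N → ℝ)) × (Fin N → ℝ) =>
      ∑ i, (c i * (locLik G φ (y.1.1, y.1.2, 0, 0)).x (Sum.inr i) v) * y.2 i :=
    Finset.measurable_fun_sum _ fun i _ => ((hm i).const_mul (c i)).mul (by fun_prop)
  have h := lintegral_mediator_noise (G := G) (ν := ν) hφ (hF.pow_const 2).ennreal_ofReal
  simp only [lintegral_sum_mul_gaussVec] at h
  exact h

theorem expit_mul_one_sub (t : ℝ) : expit t * (1 - expit t) = expitDeriv t := by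
  unfold expit expitDeriv
  have := one_add_exp_pos t
  field_simp
  ring

/-- Given the confounders the exposures are independent Bernoulli variables, whose variances `π (1 -
π)` are the weights of the logistic information. -/
theorem lintegral_logit_score (hφ : ∀ k, 0 < sigmaSq φ k) (hB : (fisherInfo G ν φ).PosDef)
    (v : Param p) :
    ∫⁻ x, ENNReal.ofReal ((∑ i, (locLik G φ x).a i * (locLik G φ x).t i v) ^ 2) ∂(dataLaw G ν φ)
      = ENNReal.ofReal (qf (fisherInfo G ν φ) (alphaPart v).ofLp) := by
  have hl : ∀ i (u : Param p), Measurable fun y : (Fin N → Fin p → ℝ) × (Fin N → ℝ) =>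
      logit y.1 i u := fun i u => (measurable_logit i u).comp measurable_fst
  have hF : Measurable fun y : (Fin N → Fin p → ℝ) × (Fin N → ℝ) =>
      ∑ i, (y.2 i - expit (logit y.1 i φ)) * logit y.1 i v :=
    Finset.measurable_fun_sum _ fun i _ =>
      ((by fun_prop : Measurable fun y : (Fin N → Fin p → ℝ) × (Fin N → ℝ) => y.2 i).sub
        (measurable_expit.comp (hl i φ))).mul (hl i v)
  have h := lintegral_exposure (G := G) (ν := ν) (φ := φ) (hF.pow_const 2).ennreal_ofReal
  have hb : ∀ C : Fin N → Fin p → ℝ, ∫⁻ e, ENNReal.ofReal ((∑ i, (genA φ C e i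
      - expit (logit C i φ)) * logit C i v) ^ 2) ∂(unifVec N)
      = ENNReal.ofReal (∑ i, expitDeriv (logit C i φ) * logit C i v ^ 2) := fun C => by
    have := lintegral_sum_mul_bernoulli (fun i => logit C i v) (fun i => expit (logit C i φ))
      (fun i => expit_nonneg _) (fun i => expit_le_one _)
    simp only [expit_mul_one_sub] at this
    calc _ = _ := by
          refine lintegral_congr fun e => ?_
          congr 2
          refine Finset.sum_congr rfl fun i _ => ?_
          rw [mul_comm]; rfl
      _ = _ := this
      _ = _ := by
          congr 1
          exact Finset.sum_congr rfl fun i _ => mul_comm _ _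
  simp only [hb] at h
  have hm : Measurable fun C : Fin N → Fin p → ℝ =>
      ∑ i, expitDeriv (logit C i φ) * logit C i v ^ 2 :=
    Finset.measurable_fun_sum _ fun i _ =>
      (measurable_expitDeriv.comp (measurable_logit i φ)).mul ((measurable_logit i v).pow_const 2)
  rw [← lintegral_confounder (G := G) (φ := φ) hm.ennreal_ofReal] at h
  refine h.trans ?_
  have hi := fun i => integrable_expitDeriv_mul_logit (G := G) (ν := ν) hφ hB i v
  rw [qf_fisherInfo_alphaPart hφ hB, ← integral_finsetSum _ fun i _ => hi i,
    ofReal_integral_eq_lintegral_ofReal (integrable_finsetSum _ fun i _ => hi i)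
    (Eventually.of_forall fun x => Finset.sum_nonneg fun i _ =>
      mul_nonneg (expitDeriv_pos _).le (sq_nonneg _))]

end Score

/-! ### Score bounds simultaneous in the parameter. -/

section ScoreBound

variable {p N : ℕ}

/-- The ratios of the geometric expansion of the inverse variances. -/
noncomputable def geoRatio (G : SimpleGraph (Fin N)) (a b : ℝ) (i : Fin N) : ℝ :=
  b / a * eigVal G i ^ 2 / (1 + b / a * eigVal G i ^ 2)

/-- The weights of the geometric expansion of the inverse variances. -/
noncomputable def geoWeight (G : SimpleGraph (Fin N)) (a b : ℝ) (φ : Param p)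
    (j : Fin N ⊕ Fin N) : ℝ :=
  resVar G j φ / (1 + b / a * Sum.elim (eigVal G) (eigVal G) j ^ 2)

variable {G : SimpleGraph (Fin N)} {a b : ℝ}

theorem geoRatio_nonneg (ha : 0 < a) (hab : a ≤ b) (i : Fin N) : 0 ≤ geoRatio G a b i := by
  have hb := ha.trans_le hab
  unfold geoRatio; positivity

theorem geoRatio_le_one (ha : 0 < a) (hab : a ≤ b) (i : Fin N) : geoRatio G a b i ≤ 1 := by
  have hb := ha.trans_le hab
  unfold geoRatio
  rw [div_le_one (by positivity)]
  linarith

theorem add_mul_div_le {a b s t d : ℝ} (ha : 0 < a) (hab : a ≤ b) (hs : s ≤ b) (ht : t ≤ b)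
    (hd : 0 ≤ d) : (s + t * d) / (1 + b / a * d) ≤ b := by
  have hb := ha.trans_le hab
  have h1 : 1 ≤ b / a := (one_le_div ha).2 hab
  rw [div_le_iff₀ (by positivity)]
  have h2 : t * d ≤ b * d := by gcongr
  have h3 : b * d ≤ b * (b / a * d) := by
    refine mul_le_mul_of_nonneg_left ?_ hb.le
    nlinarith
  linarith

theorem geoWeight_nonneg (ha : 0 < a) (hab : a ≤ b) {φ : Param p} (hφ : ∀ k, 0 < sigmaSq φ k)
    (j : Fin N ⊕ Fin N) : 0 ≤ geoWeight G a b φ j := by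
  have hb := ha.trans_le hab
  have := resVar_pos G hφ j
  unfold geoWeight; positivity

theorem geoWeight_le (ha : 0 < a) (hab : a ≤ b) {φ : Param p} (hφ : ∀ k, sigmaSq φ k ≤ b)
    (j : Fin N ⊕ Fin N) : geoWeight G a b φ j ≤ b := by
  rcases j with i | i
  · exact add_mul_div_le ha hab (hφ 0) (hφ 1) (sq_nonneg _)
  · exact add_mul_div_le ha hab (hφ 2) (hφ 3) (sq_nonneg _)

/-- With `d = λ_i²` and `q = (b/a) d / (1 + (b/a) d)`, one has `s + t d = s (1 + (b/a) d) (1 - c q)`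
for `c = 1 - (t/s)(a/b)`. The bounds on `s` and `t` give `0 ≤ c ≤ 1 - (a/b)² < 1`, so the inverse
variance is a geometric series in `c q`, and replacing `c` by its upper bound removes the dependence
on `s, t`. -/
theorem abs_sum_div_variance_le (ha : 0 < a) (hab : a ≤ b) {s t M : ℝ} (hs : a ≤ s) (hsb : s ≤ b)
    (ht : a ≤ t) (htb : t ≤ b) (hM : 0 ≤ M) (s₀ η : Fin N → ℝ)
    (h : geoSum (1 - (a / b) ^ 2) (geoRatio G a b)
      (fun i => η i * (s₀ i / (1 + b / a * eigVal G i ^ 2))) ≤ ENNReal.ofReal M) :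
    |∑ i, η i * (s₀ i / (s + t * eigVal G i ^ 2))| ≤ M / a := by
  have hb := ha.trans_le hab
  have hs0 := ha.trans_le hs
  have ht0 := ha.trans_le ht
  set c := 1 - t / s * (a / b) with hc
  have hts : t / s ≤ b / a := div_le_div₀ hb.le htb ha hs
  have hts' : a / b ≤ t / s := div_le_div₀ ht0.le ht hs0 hsb
  have hab1 : 0 < a / b := by positivity
  have hc0 : 0 ≤ c := by
    have : t / s * (a / b) ≤ b / a * (a / b) := by gcongr
    have e : b / a * (a / b) = 1 := by field_simp
    linarith
  have hcr : c ≤ 1 - (a / b) ^ 2 := by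
    have : a / b * (a / b) ≤ t / s * (a / b) := by gcongr
    rw [sq]; linarith
  have key := abs_sum_div_one_sub_le _ (geoRatio G a b) (geoRatio_nonneg ha hab)
    (geoRatio_le_one ha hab) hc0 hcr (by have : 0 < (a / b) ^ 2 := by positivity
                                         linarith) hM h
  have e : ∑ i, η i * (s₀ i / (s + t * eigVal G i ^ 2))
      = 1 / s * ∑ i, η i * (s₀ i / (1 + b / a * eigVal G i ^ 2))
        / (1 - c * geoRatio G a b i) := by
    rw [Finset.mul_sum]
    refine Finset.sum_congr rfl fun i _ => ?_
    set d := eigVal G i ^ 2 with hd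
    have hd0 : 0 ≤ d := sq_nonneg _
    have h1 : 0 < 1 + b / a * d := by positivity
    have h2 : 0 < s + t * d := by positivity
    have e1 : 1 - c * geoRatio G a b i = (s + t * d) / (s * (1 + b / a * d)) := by
      rw [geoRatio, ← hd, hc]
      field_simp
      ring
    rw [e1]
    field_simp
  rw [e, one_div, abs_mul, abs_of_pos (inv_pos.2 hs0), div_eq_inv_mul M]
  have : s⁻¹ ≤ a⁻¹ := inv_anti₀ ha hs
  calc s⁻¹ * _ ≤ s⁻¹ * M := by gcongr
    _ ≤ a⁻¹ * M := by gcongr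

variable {ν : Measure (Fin N → Fin p → ℝ)} [IsProbabilityMeasure ν] {φ : Param p}

/-- The part of the score statistic belonging to a block and noise weights `η`. -/
noncomputable def blockStat (G : SimpleGraph (Fin N)) (a b : ℝ) (φ : Param p)
    (η : Fin N ⊕ Fin N → ℝ) : ENNReal :=
  geoSum (1 - (a / b) ^ 2) (geoRatio G a b) (fun i => η (Sum.inl i) * geoWeight G a b φ (Sum.inl i))
  + geoSum (1 - (a / b) ^ 2) (geoRatio G a b)
    (fun i => η (Sum.inr i) * geoWeight G a b φ (Sum.inr i))

theorem abs_sum_div_one_add_L_le (ha : 0 < a) (hab : a ≤ b) (hφ : ∀ k, 0 < sigmaSq φ k)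
    {v : Param p} (hv : ∀ k, a ≤ sigmaSq (φ + v) k) (hv' : ∀ k, sigmaSq (φ + v) k ≤ b)
    (x : Data p N) {M : ℝ} (hM : 0 ≤ M) (η : Fin N ⊕ Fin N → ℝ)
    (h : blockStat G a b φ η ≤ ENNReal.ofReal M) :
    |∑ j, η j / (1 + (locLik G φ x).L j v)| ≤ 2 * M / a := by
  have h0 : ∀ j, η j / (1 + (locLik G φ x).L j v)
      = η j * (resVar G j φ / resVar G j (φ + v)) := fun j => by
    rw [locLik_one_add_L x (resVar_pos G hφ j), div_div_eq_mul_div, mul_div_assoc]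
  simp only [h0, Fintype.sum_sum_type]
  have h1 := abs_sum_div_variance_le (G := G) ha hab (hv 0) (hv' 0) (hv 1) (hv' 1) hM
    (fun i => resVar G (Sum.inl i) φ) (fun i => η (Sum.inl i)) (le_self_add.trans h)
  have h2 := abs_sum_div_variance_le (G := G) ha hab (hv 2) (hv' 2) (hv 3) (hv' 3) hM
    (fun i => resVar G (Sum.inr i) φ) (fun i => η (Sum.inr i)) (le_add_self.trans h)
  refine (abs_add_le _ _).trans ((add_le_add h1 h2).trans (le_of_eq ?_))
  ring

theorem measurable_blockStat {η : Data p N → Fin N ⊕ Fin N → ℝ}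
    (h : ∀ j, Measurable fun x => η x j) : Measurable fun x => blockStat G a b φ (η x) :=
  (measurable_geoSum _ _ fun _ => (h _).mul_const _).add
    (measurable_geoSum _ _ fun _ => (h _).mul_const _)

theorem lintegral_blockStat_le (ha : 0 < a) (hab : a ≤ b) {V : ℝ} (hV : 0 ≤ V)
    {η : Data p N → Fin N ⊕ Fin N → ℝ} (hm : ∀ j, Measurable fun x => η x j)
    (h1 : ∀ n : ℕ, ∫⁻ x, ENNReal.ofReal ((∑ i, η x (Sum.inl i) * geoWeight G a b φ (Sum.inl i)
      * geoRatio G a b i ^ n) ^ 2) ∂(dataLaw G ν φ) ≤ ENNReal.ofReal V)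
    (h2 : ∀ n : ℕ, ∫⁻ x, ENNReal.ofReal ((∑ i, η x (Sum.inr i) * geoWeight G a b φ (Sum.inr i)
      * geoRatio G a b i ^ n) ^ 2) ∂(dataLaw G ν φ) ≤ ENNReal.ofReal V) :
    ∫⁻ x, blockStat G a b φ (η x) ∂(dataLaw G ν φ)
      ≤ ENNReal.ofReal (2 * ((1 + V) / (a / b) ^ 2)) := by
  have hb := ha.trans_le hab
  have hpos : 0 < (a / b) ^ 2 := by positivity
  have hle : (a / b) ^ 2 ≤ 1 := pow_le_one₀ (by positivity) ((div_le_one hb).2 hab)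
  have hr : 1 - (1 - (a / b) ^ 2) = (a / b) ^ 2 := by ring
  have k1 := lintegral_geoSum_le (μ := dataLaw G ν φ) (r := 1 - (a / b) ^ 2) (by linarith)
    (by linarith) hV (geoRatio G a b)
    (A := fun x i => η x (Sum.inl i) * geoWeight G a b φ (Sum.inl i))
    (fun _ => (hm _).mul_const _) h1
  have k2 := lintegral_geoSum_le (μ := dataLaw G ν φ) (r := 1 - (a / b) ^ 2) (by linarith)
    (by linarith) hV (geoRatio G a b)
    (A := fun x i => η x (Sum.inr i) * geoWeight G a b φ (Sum.inr i))
    (fun _ => (hm _).mul_const _) h2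
  rw [hr] at k1 k2
  unfold blockStat
  rw [lintegral_add_left (measurable_geoSum _ _ fun i => (hm _).mul_const _), two_mul,
    ENNReal.ofReal_add (by positivity) (by positivity)]
  exact add_le_add k1 k2

theorem sq_mul_weight_le {l g q B : ℝ} (hg : 0 ≤ g) (hgB : g ≤ B) (hq : 0 ≤ q) (hq1 : q ≤ 1)
    (n : ℕ) : (l * g * q ^ n) ^ 2 ≤ B ^ 2 * l ^ 2 := by
  have h1 : q ^ n ≤ 1 := pow_le_one₀ hq hq1
  have h0 : 0 ≤ q ^ n := pow_nonneg hq n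
  have h2 : 0 ≤ g * q ^ n := mul_nonneg hg h0
  have h3 : g * q ^ n ≤ B := by nlinarith
  have h4 : (g * q ^ n) ^ 2 ≤ B ^ 2 := pow_le_pow_left₀ h2 h3 2
  calc _ = (g * q ^ n) ^ 2 * l ^ 2 := by ring
    _ ≤ _ := by gcongr

theorem sum_relVar_sq_le (hφ : ∀ k, 0 < sigmaSq φ k) (hB : (fisherInfo G ν φ).PosDef)
    (v : Param p) : ∑ j, relVar G φ j v ^ 2 ≤ 2 * qf (fisherInfo G ν φ) v.ofLp := by
  have h := (splits_locLik (G := G) (ν := ν) hφ hB 0).b_split v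
  have h1 := qf_nonneg hB (meanPart v).ofLp
  have h2 := qf_nonneg hB (alphaPart v).ofLp
  simp only [locLik_L] at h
  linarith

theorem qf_meanPart_le (hφ : ∀ k, 0 < sigmaSq φ k) (hB : (fisherInfo G ν φ).PosDef)
    (v : Param p) :
    qf (fisherInfo G ν φ) (meanPart v).ofLp ≤ qf (fisherInfo G ν φ) v.ofLp := by
  have h := (splits_locLik (G := G) (ν := ν) hφ hB 0).b_split v
  have h2 := qf_nonneg hB (alphaPart v).ofLp
  have h3 : 0 ≤ ∑ j, (locLik G φ 0).L j v ^ 2 := Finset.sum_nonneg fun _ _ => sq_nonneg _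
  linarith

theorem qf_alphaPart_le (hφ : ∀ k, 0 < sigmaSq φ k) (hB : (fisherInfo G ν φ).PosDef)
    (v : Param p) :
    qf (fisherInfo G ν φ) (alphaPart v).ofLp ≤ qf (fisherInfo G ν φ) v.ofLp := by
  have h := (splits_locLik (G := G) (ν := ν) hφ hB 0).b_split v
  have h2 := qf_nonneg hB (meanPart v).ofLp
  have h3 : 0 ≤ ∑ j, (locLik G φ 0).L j v ^ 2 := Finset.sum_nonneg fun _ _ => sq_nonneg _
  linarith

/-- The variables `ξ² - 1` are independent within each equation with variance `chiVar`. The weights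
are at most `b`, the ratios at most one, and `∑ L² ≤ 2` in a direction of information at most one.
-/
theorem lintegral_blockStat_chi_le (ha : 0 < a) (hab : a ≤ b) (hφ : ∀ k, 0 < sigmaSq φ k)
    (hφb : ∀ k, sigmaSq φ k ≤ b) (hB : (fisherInfo G ν φ).PosDef) {w : Param p}
    (hw : qf (fisherInfo G ν φ) w.ofLp ≤ 1) :
    ∫⁻ x, blockStat G a b φ (fun j => ((locLik G φ x).ξ j ^ 2 - 1) * (locLik G φ x).L j w)
      ∂(dataLaw G ν φ) ≤ ENNReal.ofReal (2 * ((1 + b ^ 2 * (2 * chiVar)) / (a / b) ^ 2)) := by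
  have hχ := chiVar_nonneg
  have hL := sum_relVar_sq_le hφ hB w
  rw [Fintype.sum_sum_type] at hL
  have hL1 : 0 ≤ ∑ i, relVar G φ (Sum.inl i) w ^ 2 := Finset.sum_nonneg fun _ _ => sq_nonneg _
  have hL2 : 0 ≤ ∑ i, relVar G φ (Sum.inr i) w ^ 2 := Finset.sum_nonneg fun _ _ => sq_nonneg _
  have bound : ∀ (f : Fin N → Fin N ⊕ Fin N) (n : ℕ), ∑ i, relVar G φ (f i) w ^ 2 ≤ 2 →
      chiVar * ∑ i, (relVar G φ (f i) w * geoWeight G a b φ (f i) * geoRatio G a b i ^ n) ^ 2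
        ≤ b ^ 2 * (2 * chiVar) := fun f n hf => by
    have : ∑ i, (relVar G φ (f i) w * geoWeight G a b φ (f i) * geoRatio G a b i ^ n) ^ 2
        ≤ b ^ 2 * ∑ i, relVar G φ (f i) w ^ 2 := by
      rw [Finset.mul_sum]
      exact Finset.sum_le_sum fun i _ => sq_mul_weight_le (geoWeight_nonneg ha hab hφ _)
        (geoWeight_le ha hab hφb _) (geoRatio_nonneg ha hab i) (geoRatio_le_one ha hab i) n
    calc _ ≤ chiVar * (b ^ 2 * 2) := by
          refine mul_le_mul_of_nonneg_left (this.trans ?_) hχ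
          gcongr
      _ = _ := by ring
  refine lintegral_blockStat_le ha hab (by positivity)
    (fun j => (((measurable_locLik_ξ j).pow_const 2).sub_const 1).mul_const _) (fun n => ?_)
    fun n => ?_
  · have h := lintegral_sum_chi_inl (G := G) (ν := ν) hφ
      (fun i => relVar G φ (Sum.inl i) w * geoWeight G a b φ (Sum.inl i) * geoRatio G a b i ^ n)
    refine le_trans (le_of_eq ?_) (h.le.trans (ENNReal.ofReal_le_ofReal
      (bound Sum.inl n (by linarith))))
    refine lintegral_congr fun x => ?_
    congr 2
    refine Finset.sum_congr rfl fun i _ => ?_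
    rw [locLik_L]; ring
  · have h := lintegral_sum_chi_inr (G := G) (ν := ν) hφ
      (fun i => relVar G φ (Sum.inr i) w * geoWeight G a b φ (Sum.inr i) * geoRatio G a b i ^ n)
    refine le_trans (le_of_eq ?_) (h.le.trans (ENNReal.ofReal_le_ofReal
      (bound Sum.inr n (by linarith))))
    refine lintegral_congr fun x => ?_
    congr 2
    refine Finset.sum_congr rfl fun i _ => ?_
    rw [locLik_L]; ring

theorem lintegral_sum_locLik_x_sq_le (hφ : ∀ k, 0 < sigmaSq φ k)
    (hB : (fisherInfo G ν φ).PosDef) {w : Param p}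
    (hw : qf (fisherInfo G ν φ) w.ofLp ≤ 1) :
    ∫⁻ x, ENNReal.ofReal (∑ j, (locLik G φ x).x j w ^ 2) ∂(dataLaw G ν φ) ≤ 1 := by
  have hi := fun j => (memLp_locLik_x (G := G) (ν := ν) hφ hB j w).integrable_sq
  rw [← ofReal_integral_eq_lintegral_ofReal (integrable_finsetSum _ fun j _ => hi j)
    (Eventually.of_forall fun x => Finset.sum_nonneg fun i _ => sq_nonneg _),
    integral_finsetSum _ fun j _ => hi j, ← qf_fisherInfo_meanPart hφ hB]
  exact ENNReal.ofReal_le_one.2 ((qf_meanPart_le hφ hB w).trans hw)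

/-- Conditioning on the means leaves `∑ x²` times squared weights at most `b²`, and the mean of `∑
x²` is the mean part of the information. -/
theorem lintegral_blockStat_score_le (ha : 0 < a) (hab : a ≤ b) (hφ : ∀ k, 0 < sigmaSq φ k)
    (hφb : ∀ k, sigmaSq φ k ≤ b) (hB : (fisherInfo G ν φ).PosDef) {w : Param p}
    (hw : qf (fisherInfo G ν φ) w.ofLp ≤ 1) :
    ∫⁻ x, blockStat G a b φ (fun j => (locLik G φ x).ξ j * (locLik G φ x).x j w)
      ∂(dataLaw G ν φ) ≤ ENNReal.ofReal (2 * ((1 + b ^ 2) / (a / b) ^ 2)) := by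
  have hX := lintegral_sum_locLik_x_sq_le (G := G) (ν := ν) hφ hB hw
  have bound : ∀ (f : Fin N → Fin N ⊕ Fin N) (n : ℕ), (∀ x : Data p N,
      ∑ i, (locLik G φ x).x (f i) w ^ 2 ≤ ∑ j, (locLik G φ x).x j w ^ 2) →
      ∫⁻ x, ENNReal.ofReal (∑ i, (geoWeight G a b φ (f i) * geoRatio G a b i ^ n
        * (locLik G φ x).x (f i) w) ^ 2) ∂(dataLaw G ν φ) ≤ ENNReal.ofReal (b ^ 2) :=
      fun f n hf => by
    calc _ ≤ ∫⁻ x, ENNReal.ofReal (b ^ 2) * ENNReal.ofReal (∑ j, (locLik G φ x).x j w ^ 2)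
          ∂(dataLaw G ν φ) := by
          refine lintegral_mono fun x => ?_
          rw [← ENNReal.ofReal_mul (sq_nonneg _)]
          refine ENNReal.ofReal_le_ofReal ?_
          refine le_trans ?_ (mul_le_mul_of_nonneg_left (hf x) (sq_nonneg b))
          rw [Finset.mul_sum]
          refine Finset.sum_le_sum fun i _ => ?_
          have := sq_mul_weight_le (l := (locLik G φ x).x (f i) w)
            (geoWeight_nonneg (G := G) ha hab hφ (f i)) (geoWeight_le ha hab hφb _)
            (geoRatio_nonneg (G := G) ha hab i) (geoRatio_le_one ha hab i) n
          refine le_trans (le_of_eq ?_) this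
          ring
      _ = ENNReal.ofReal (b ^ 2) * ∫⁻ x, ENNReal.ofReal (∑ j, (locLik G φ x).x j w ^ 2)
          ∂(dataLaw G ν φ) := by
          refine lintegral_const_mul _ (Measurable.ennreal_ofReal ?_)
          exact Finset.measurable_fun_sum _ fun j _ => (measurable_locLik_x j w).pow_const 2
      _ ≤ ENNReal.ofReal (b ^ 2) * 1 := by gcongr
      _ = _ := mul_one _
  refine lintegral_blockStat_le ha hab (by positivity)
    (fun j => (measurable_locLik_ξ j).mul (measurable_locLik_x j w)) (fun n => ?_)
    fun n => ?_
  · have h := lintegral_sum_score_inl (G := G) (ν := ν) hφ w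
      (fun i => geoWeight G a b φ (Sum.inl i) * geoRatio G a b i ^ n)
    refine le_trans (le_of_eq ?_) (h.le.trans (bound Sum.inl n fun x => ?_))
    · refine lintegral_congr fun x => ?_
      congr 2
      exact Finset.sum_congr rfl fun i _ => by ring
    · rw [Fintype.sum_sum_type]
      exact le_add_of_nonneg_right (Finset.sum_nonneg fun _ _ => sq_nonneg _)
  · have h := lintegral_sum_score_inr (G := G) (ν := ν) hφ w
      (fun i => geoWeight G a b φ (Sum.inr i) * geoRatio G a b i ^ n)
    refine le_trans (le_of_eq ?_) (h.le.trans (bound Sum.inr n fun x => ?_))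
    · refine lintegral_congr fun x => ?_
      congr 2
      exact Finset.sum_congr rfl fun i _ => by ring
    · rw [Fintype.sum_sum_type]
      exact le_add_of_nonneg_left (Finset.sum_nonneg fun _ _ => sq_nonneg _)

/-- A statistic which controls the score along the directions `w k`. -/
noncomputable def scoreStat (G : SimpleGraph (Fin N)) (a b : ℝ) (φ : Param p)
    (w : ParamIdx p → Param p) (x : Data p N) : ENNReal :=
  ∑ k, (blockStat G a b φ (fun j => ((locLik G φ x).ξ j ^ 2 - 1) * (locLik G φ x).L j (w k))
    + (blockStat G a b φ (fun j => (locLik G φ x).ξ j * (locLik G φ x).x j (w k))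
      + ENNReal.ofReal |∑ i, (locLik G φ x).a i * (locLik G φ x).t i (w k)|))

/-- The bound for the mean of the score statistic. -/
noncomputable def scoreConst (p : ℕ) (a b : ℝ) : ℝ :=
  dimParam p * (2 * ((1 + b ^ 2 * (2 * chiVar)) / (a / b) ^ 2)
    + (2 * ((1 + b ^ 2) / (a / b) ^ 2) + (1 + 1)))

theorem measurable_sum_locLik_a_mul_t (w : Param p) :
    Measurable fun x : Data p N => ∑ i, (locLik G φ x).a i * (locLik G φ x).t i w :=
  Finset.measurable_fun_sum _ fun i _ =>
    (measurable_locLik_a i).mul ((measurable_logit i w).comp measurable_fst)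

theorem measurable_scoreStat (w : ParamIdx p → Param p) :
    Measurable (scoreStat G a b φ w) := by
  refine Finset.measurable_fun_sum _ fun k _ => Measurable.add ?_ (Measurable.add ?_ ?_)
  · exact measurable_blockStat fun j =>
      (((measurable_locLik_ξ j).pow_const 2).sub_const 1).mul_const _
  · exact measurable_blockStat fun j => (measurable_locLik_ξ j).mul (measurable_locLik_x j _)
  · exact (measurable_sum_locLik_a_mul_t _).abs.ennreal_ofReal

theorem lintegral_scoreStat_le (ha : 0 < a) (hab : a ≤ b) (hφ : ∀ k, 0 < sigmaSq φ k)
    (hφb : ∀ k, sigmaSq φ k ≤ b) (hB : (fisherInfo G ν φ).PosDef) {w : ParamIdx p → Param p}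
    (hw : ∀ k, qf (fisherInfo G ν φ) (w k).ofLp ≤ 1) :
    ∫⁻ x, scoreStat G a b φ w x ∂(dataLaw G ν φ) ≤ ENNReal.ofReal (scoreConst p a b) := by
  have hχ := chiVar_nonneg
  have hb := ha.trans_le hab
  have hm1 : ∀ k, Measurable fun x : Data p N => blockStat G a b φ
      (fun j => ((locLik G φ x).ξ j ^ 2 - 1) * (locLik G φ x).L j (w k)) := fun k =>
    measurable_blockStat fun j => (((measurable_locLik_ξ j).pow_const 2).sub_const 1).mul_const _
  have hm2 : ∀ k, Measurable fun x : Data p N => blockStat G a b φ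
      (fun j => (locLik G φ x).ξ j * (locLik G φ x).x j (w k)) := fun k =>
    measurable_blockStat fun j => (measurable_locLik_ξ j).mul (measurable_locLik_x j _)
  have hm3 : ∀ k, Measurable fun x : Data p N => ENNReal.ofReal
      |∑ i, (locLik G φ x).a i * (locLik G φ x).t i (w k)| := fun k =>
    (measurable_sum_locLik_a_mul_t _).abs.ennreal_ofReal
  have hm : ∀ k, Measurable fun x : Data p N => blockStat G a b φ
      (fun j => ((locLik G φ x).ξ j ^ 2 - 1) * (locLik G φ x).L j (w k))
    + (blockStat G a b φ (fun j => (locLik G φ x).ξ j * (locLik G φ x).x j (w k))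
      + ENNReal.ofReal |∑ i, (locLik G φ x).a i * (locLik G φ x).t i (w k)|) := fun k =>
    (hm1 k).add ((hm2 k).add (hm3 k))
  unfold scoreStat
  rw [lintegral_finsetSum _ fun k _ => hm k]
  have hk : ∀ k, ∫⁻ x, (blockStat G a b φ
      (fun j => ((locLik G φ x).ξ j ^ 2 - 1) * (locLik G φ x).L j (w k))
    + (blockStat G a b φ (fun j => (locLik G φ x).ξ j * (locLik G φ x).x j (w k))
      + ENNReal.ofReal |∑ i, (locLik G φ x).a i * (locLik G φ x).t i (w k)|)) ∂(dataLaw G ν φ)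
      ≤ ENNReal.ofReal (2 * ((1 + b ^ 2 * (2 * chiVar)) / (a / b) ^ 2)
    + (2 * ((1 + b ^ 2) / (a / b) ^ 2) + (1 + 1))) := fun k => by
    rw [lintegral_add_left (hm1 k), lintegral_add_left (hm2 k),
      ENNReal.ofReal_add (by positivity) (by positivity),
      ENNReal.ofReal_add (by positivity) (by positivity)]
    refine add_le_add (lintegral_blockStat_chi_le ha hab hφ hφb hB (hw k))
      (add_le_add (lintegral_blockStat_score_le ha hab hφ hφb hB (hw k))
        (lintegral_abs_le_one_add_sq zero_le_one ?_))
    rw [lintegral_logit_score hφ hB]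
    exact ENNReal.ofReal_le_ofReal ((qf_alphaPart_le hφ hB _).trans (hw k))
  refine (Finset.sum_le_sum fun k _ => hk k).trans (le_of_eq ?_)
  rw [Finset.sum_const, Finset.card_univ, nsmul_eq_mul, scoreConst,
    ENNReal.ofReal_mul (by positivity), ENNReal.ofReal_natCast]

theorem abs_le_of_linear {ι : Type*} [Fintype ι] (f : Param p → ℝ) (c : ι → ℝ) (w : ι → Param p)
    (hf : f (∑ k, c k • w k) = ∑ k, c k * f (w k)) {M : ℝ}
    (h : ∀ k, |f (w k)| ≤ M) :
    |f (∑ k, c k • w k)| ≤ Fintype.card ι * M * Real.sqrt (c ⬝ᵥ c) := by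
  rw [hf]
  calc |∑ k, c k * f (w k)| ≤ ∑ k, |c k * f (w k)| := Finset.abs_sum_le_sum_abs _ _
    _ ≤ ∑ _k : ι, Real.sqrt (c ⬝ᵥ c) * M := by
        refine Finset.sum_le_sum fun k _ => ?_
        rw [abs_mul]
        refine mul_le_mul ?_ (h k) (abs_nonneg _) (Real.sqrt_nonneg _)
        refine Real.abs_le_sqrt ?_
        rw [dotProduct_self_eq_sum_sq]
        exact Finset.single_le_sum (f := fun k => c k ^ 2) (fun _ _ => sq_nonneg _)
          (Finset.mem_univ k)
    _ = _ := by rw [Finset.sum_const, Finset.card_univ, nsmul_eq_mul]; ring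

/-- With the denominators held fixed, each score sum is linear in its numerator direction, so `v`
can be expanded along the finitely many `w k`. The dependence of the denominators on `v` is already
covered by `scoreStat`, which does not involve `v`. -/
theorem score_bounds (ha : 0 < a) (hab : a ≤ b) (hφ : ∀ k, 0 < sigmaSq φ k)
    {w : ParamIdx p → Param p} {c : ParamIdx p → ℝ} {v : Param p} (hvw : v = ∑ k, c k • w k)
    (hv : ∀ k, a ≤ sigmaSq (φ + v) k) (hv' : ∀ k, sigmaSq (φ + v) k ≤ b)
    {x : Data p N} {M : ℝ} (hM : 0 ≤ M) (h : scoreStat G a b φ w x ≤ ENNReal.ofReal M) :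
    |∑ j, ((locLik G φ x).ξ j ^ 2 - 1) * (locLik G φ x).L j v / (1 + (locLik G φ x).L j v)|
      ≤ dimParam p * (2 * M / a + M) * Real.sqrt (c ⬝ᵥ c) ∧
    |∑ j, (locLik G φ x).ξ j * (locLik G φ x).x j v / (1 + (locLik G φ x).L j v)|
      ≤ dimParam p * (2 * M / a + M) * Real.sqrt (c ⬝ᵥ c) ∧
    |∑ i, (locLik G φ x).a i * (locLik G φ x).t i v|
      ≤ dimParam p * (2 * M / a + M) * Real.sqrt (c ⬝ᵥ c) := by
  have hMa : 0 ≤ 2 * M / a := by positivity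
  have hk := fun k => (Finset.single_le_sum (f := fun k => blockStat G a b φ
      (fun j => ((locLik G φ x).ξ j ^ 2 - 1) * (locLik G φ x).L j (w k))
    + (blockStat G a b φ (fun j => (locLik G φ x).ξ j * (locLik G φ x).x j (w k))
      + ENNReal.ofReal |∑ i, (locLik G φ x).a i * (locLik G φ x).t i (w k)|))
      (fun _ _ => zero_le) (Finset.mem_univ k)).trans h
  -- Linearity is in `u`; the denominators stay at `v`.
  have lin : ∀ (e : Fin N ⊕ Fin N → ℝ) (ℓ : Fin N ⊕ Fin N → Param p →ₗ[ℝ] ℝ),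
      (fun u => ∑ j, e j * ℓ j u / (1 + (locLik G φ x).L j v)) (∑ k, c k • w k)
      = ∑ k, c k * (fun u => ∑ j, e j * ℓ j u / (1 + (locLik G φ x).L j v)) (w k) :=
    fun e ℓ => by
      simp only [map_sum, map_smul, smul_eq_mul, Finset.mul_sum, Finset.sum_div]
      rw [Finset.sum_comm]
      exact Finset.sum_congr rfl fun k _ => Finset.sum_congr rfl fun j _ => by ring
  refine ⟨?_, ?_, ?_⟩
  · have := abs_le_of_linear (M := 2 * M / a + M) (fun u => ∑ j, ((locLik G φ x).ξ j ^ 2 - 1)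
        * (locLik G φ x).L j u / (1 + (locLik G φ x).L j v)) c w
      (lin (fun j => (locLik G φ x).ξ j ^ 2 - 1) (locLik G φ x).L)
      fun k => (abs_sum_div_one_add_L_le ha hab hφ hv hv' x hM _
        (le_self_add.trans (hk k))).trans (by linarith)
    rwa [← hvw] at this
  · have := abs_le_of_linear (M := 2 * M / a + M) (fun u => ∑ j, (locLik G φ x).ξ j
        * (locLik G φ x).x j u / (1 + (locLik G φ x).L j v)) c w
      (lin (fun j => (locLik G φ x).ξ j) (locLik G φ x).x)
      fun k => (abs_sum_div_one_add_L_le ha hab hφ hv hv' x hM _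
        ((le_self_add.trans le_add_self).trans (hk k))).trans (by linarith)
    rwa [← hvw] at this
  · have := abs_le_of_linear (M := 2 * M / a + M) (fun u => ∑ i, (locLik G φ x).a i * (locLik G φ x).t i u) c w
      (by
        simp only [map_sum, map_smul, smul_eq_mul, Finset.mul_sum]
        rw [Finset.sum_comm]
        exact Finset.sum_congr rfl fun k _ => Finset.sum_congr rfl fun j _ => by ring)
      fun k => ((ENNReal.ofReal_le_ofReal_iff hM).1
        ((le_add_self.trans le_add_self).trans (hk k))).trans (by linarith)
    rwa [← hvw] at this

end ScoreBound

/-! ### The logistic part of the log-likelihood ratio -/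

section LogitRem

theorem continuous_expitDeriv : Continuous expitDeriv := by
  unfold expitDeriv
  exact Real.continuous_exp.div ((continuous_const.add Real.continuous_exp).pow 2)
    fun t => (pow_pos (one_add_exp_pos t) 2).ne'

/-- Taylor's formula with integral remainder, from the primitive `(1 - τ) expit(t + τ s) s +
softplus(t + τ s)`. It turns the remainder into an average of logistic informations. -/
theorem softplus_taylor (t s : ℝ) :
    softplus (t + s) - softplus t - expit t * s
      = ∫ τ in (0 : ℝ)..1, (1 - τ) * (expitDeriv (t + τ * s) * s ^ 2) := by
  have hd : ∀ τ ∈ Set.uIcc (0 : ℝ) 1, HasDerivAt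
      (fun τ => (1 - τ) * (expit (t + τ * s) * s) + softplus (t + τ * s))
      ((1 - τ) * (expitDeriv (t + τ * s) * s ^ 2)) τ := fun τ _ => by
    have h1 : HasDerivAt (fun τ : ℝ => t + τ * s) s τ := by
      simpa using ((hasDerivAt_id τ).mul_const s).const_add t
    have h2 : HasDerivAt (fun τ : ℝ => 1 - τ) (-1) τ := by
      simpa using (hasDerivAt_id τ).const_sub 1
    have h3 := (h2.mul (((hasDerivAt_expit _).comp τ h1).mul_const s)).add
      ((hasDerivAt_softplus _).comp τ h1)
    refine h3.congr_deriv ?_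
    simp only [Function.comp_apply]
    ring
  have hc : Continuous fun τ : ℝ => (1 - τ) * (expitDeriv (t + τ * s) * s ^ 2) := by
    have := continuous_expitDeriv
    fun_prop
  rw [intervalIntegral.integral_eq_sub_of_hasDerivAt hd (hc.intervalIntegrable 0 1)]
  simp
  ring

theorem LocalLik.logitRem_eq_integral {V ι κ : Type*} [AddCommGroup V] [Module ℝ V] [Fintype ι]
    [Fintype κ] (m : LocalLik V ι κ) (v : V) :
    m.logitRem v = ∫ τ in (0 : ℝ)..1, (1 - τ) * m.logitInfo (τ • v) v := by
  have hc : ∀ i, Continuous fun τ : ℝ =>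
      (1 - τ) * (expitDeriv (m.t₀ i + τ * m.t i v) * m.t i v ^ 2) := fun i => by
    have := continuous_expitDeriv
    fun_prop
  simp only [LocalLik.logitRem, LocalLik.logitInfo, softplus_taylor, map_smul, smul_eq_mul,
    Finset.mul_sum]
  rw [intervalIntegral.integral_finsetSum fun i _ => (hc i).intervalIntegrable 0 1]

/-- Since `1 - τ` has integral `1/2`, the constant `β / 2` is a weighted average of `β`; afterwards
the weight is bounded by one. -/
theorem LocalLik.ofReal_abs_logitRem_sub_le {V ι κ : Type*} [AddCommGroup V] [Module ℝ V]
    [Fintype ι] [Fintype κ] (m : LocalLik V ι κ) (v : V) (β : ℝ) :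
    ENNReal.ofReal |m.logitRem v - β / 2|
      ≤ ∫⁻ τ in Set.Ioc (0 : ℝ) 1, ENNReal.ofReal |m.logitInfo (τ • v) v - β| := by
  have hc : Continuous fun τ : ℝ => m.logitInfo (τ • v) v := by
    simp only [LocalLik.logitInfo, map_smul, smul_eq_mul]
    have := continuous_expitDeriv
    fun_prop
  have hβ : β / 2 = ∫ τ in (0 : ℝ)..1, (1 - τ) * β := by
    rw [intervalIntegral.integral_mul_const, intervalIntegral.integral_sub (by simp) (by simp)]
    simp
    ring
  have h1 : Continuous fun τ : ℝ => (1 - τ) * m.logitInfo (τ • v) v := by fun_prop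
  have h2 : Continuous fun τ : ℝ => (1 - τ) * β := by fun_prop
  rw [m.logitRem_eq_integral, hβ, ← intervalIntegral.integral_sub (h1.intervalIntegrable 0 1)
    (h2.intervalIntegrable 0 1), intervalIntegral.integral_of_le zero_le_one,
    ← Real.norm_eq_abs, ofReal_norm]
  refine (enorm_integral_le_lintegral_enorm _).trans ?_
  refine setLIntegral_mono' measurableSet_Ioc fun τ hτ => ?_
  rw [← ofReal_norm, Real.norm_eq_abs, ← mul_sub, abs_mul]
  refine ENNReal.ofReal_le_ofReal ?_
  have : |1 - τ| ≤ 1 := by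
    rw [abs_le]; constructor <;> linarith [hτ.1, hτ.2]
  calc _ ≤ 1 * |m.logitInfo (τ • v) v - β| := by gcongr
    _ = _ := one_mul _

variable {p N : ℕ} {G : SimpleGraph (Fin N)} {ν : Measure (Fin N → Fin p → ℝ)}
  [IsProbabilityMeasure ν] {φ : Param p}

theorem sigmaSq_add (φ ψ : Param p) (k : Fin 4) :
    sigmaSq (φ + ψ) k = sigmaSq φ k + sigmaSq ψ k := rfl

theorem sigmaSq_smul (c : ℝ) (φ : Param p) (k : Fin 4) :
    sigmaSq (c • φ) k = c * sigmaSq φ k := rfl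

theorem qf_obsInfo_alphaPart (hφ : ∀ k, 0 < sigmaSq φ k) {w : Param p}
    (hw : ∀ k, 0 < sigmaSq (φ + w) k) (x : Data p N) (v : Param p) :
    qf (obsInfo G x (φ + w)) (alphaPart v).ofLp = (locLik G φ x).logitInfo w v := by
  rw [qf_obsInfo x (resVar_pos G hφ) (resVar_pos G hw)]
  simp only [LocalLik.gaussInfo, LocalLik.logitInfo, locLik, LinearMap.smul_apply,
    resVar_alphaPart, rotMean_alphaPart, logit_alphaPart]
  simp

/-- The logistic information at `φ + w` is a function of the confounders, so its mean deviation may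
be computed under the law at `φ + w`, where stability holds. Continuity of the expected information
then returns from `φ + w` to `φ`. -/
theorem lintegral_abs_logitInfo_sub_le (hφ : ∀ k, 0 < sigmaSq φ k)
    (hB : (fisherInfo G ν φ).PosDef) {w : Param p} (hw : ∀ k, 0 < sigmaSq (φ + w) k)
    (hBw : (fisherInfo G ν (φ + w)).PosDef) {κ : ℝ} (hκ : 0 < κ) (hκ1 : κ ≤ 1)
    (h1 : frob (minvsqrt (fisherInfo G ν φ) * msqrt (fisherInfo G ν (φ + w)) - 1) ≤ κ)
    (h2 : ∫⁻ x, ENNReal.ofReal (frob (minvsqrt (fisherInfo G ν (φ + w)) * obsInfo G x (φ + w)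
      * minvsqrt (fisherInfo G ν (φ + w)) - 1) ^ 2) ∂(dataLaw G ν (φ + w))
      ≤ ENNReal.ofReal (κ ^ 2)) (v : Param p) :
    ∫⁻ x, ENNReal.ofReal |(locLik G φ x).logitInfo w v
        - qf (fisherInfo G ν φ) (alphaPart v).ofLp| ∂(dataLaw G ν φ)
      ≤ ENNReal.ofReal (11 * κ * qf (fisherInfo G ν φ) (alphaPart v).ofLp) := by
  set b := qf (fisherInfo G ν φ) (alphaPart v).ofLp with hb
  have hb0 : 0 ≤ b := qf_nonneg hB _
  have hm : Measurable fun C : Fin N → Fin p → ℝ =>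
      ∑ i, expitDeriv (logit C i φ + logit C i w) * logit C i v ^ 2 :=
    Finset.measurable_fun_sum _ fun i _ => (measurable_expitDeriv.comp
      ((measurable_logit i φ).add (measurable_logit i w))).mul ((measurable_logit i v).pow_const 2)
  have hF : Measurable fun C : Fin N → Fin p → ℝ => ENNReal.ofReal
      |∑ i, expitDeriv (logit C i φ + logit C i w) * logit C i v ^ 2 - b| :=
    (hm.sub_const b).abs.ennreal_ofReal
  have e : ∫⁻ x, ENNReal.ofReal |(locLik G φ x).logitInfo w v - b| ∂(dataLaw G ν φ)
      = ∫⁻ x, ENNReal.ofReal |(locLik G φ x).logitInfo w v - b| ∂(dataLaw G ν (φ + w)) :=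
    (lintegral_confounder (G := G) (ν := ν) (φ := φ) hF).trans
      (lintegral_confounder (G := G) (ν := ν) (φ := φ + w) hF).symm
  rw [e]
  have hB' := abs_qf_sub_le_of_msqrt hB hBw hκ1 h1 (alphaPart v).ofLp
  rw [← hb] at hB'
  have hpt : ∀ x : Data p N, ENNReal.ofReal |(locLik G φ x).logitInfo w v - b|
      ≤ ENNReal.ofReal (7 * κ * b) + ENNReal.ofReal (4 * b / κ) * ENNReal.ofReal
        (frob (minvsqrt (fisherInfo G ν (φ + w)) * obsInfo G x (φ + w)
          * minvsqrt (fisherInfo G ν (φ + w)) - 1) ^ 2) := fun x => by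
    rw [← ENNReal.ofReal_mul (by positivity), ← ENNReal.ofReal_add (by positivity) (by positivity)]
    refine ENNReal.ofReal_le_ofReal ?_
    have hJ := abs_qf_sub_le_of_standardized hBw (obsInfo G x (φ + w)) (alphaPart v).ofLp
    rw [qf_obsInfo_alphaPart hφ hw] at hJ
    set f := frob (minvsqrt (fisherInfo G ν (φ + w)) * obsInfo G x (φ + w)
          * minvsqrt (fisherInfo G ν (φ + w)) - 1) with hf
    have hf0 : 0 ≤ f := frob_nonneg _
    set b' := qf (fisherInfo G ν (φ + w)) (alphaPart v).ofLp
    have hb' : b' ≤ 4 * b := by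
      have := (abs_le.1 hB').2
      nlinarith
    have hb'0 : 0 ≤ b' := qf_nonneg hBw _
    -- Only the second moment of `f` is controlled; this converts it into a first moment of order
    -- `κ`.
    have hfκ : f ≤ κ + f ^ 2 / κ := by
      have e : κ + f ^ 2 / κ - f = ((f - κ / 2) ^ 2 + 3 / 4 * κ ^ 2) / κ := by field_simp; ring
      have : 0 ≤ κ + f ^ 2 / κ - f := by rw [e]; positivity
      linarith
    calc |(locLik G φ x).logitInfo w v - b|
        ≤ |(locLik G φ x).logitInfo w v - b'| + |b' - b| := abs_sub_le _ _ _
      _ ≤ f * b' + 3 * κ * b := add_le_add hJ hB'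
      _ ≤ (κ + f ^ 2 / κ) * (4 * b) + 3 * κ * b := by gcongr
      _ = _ := by field_simp; ring
  refine (lintegral_mono hpt).trans ?_
  rw [lintegral_add_left measurable_const, lintegral_const_mul' _ _ ENNReal.ofReal_ne_top]
  simp only [lintegral_const, measure_univ, mul_one]
  calc _ ≤ ENNReal.ofReal (7 * κ * b) + ENNReal.ofReal (4 * b / κ) * ENNReal.ofReal (κ ^ 2) := by
        gcongr
    _ = _ := by
        rw [← ENNReal.ofReal_mul (by positivity),
          ← ENNReal.ofReal_add (by positivity) (by positivity)]
        congr 1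
        field_simp
        ring

theorem lintegral_abs_logitRem_sub_le (hφ : ∀ k, 0 < sigmaSq φ k)
    (hB : (fisherInfo G ν φ).PosDef) {v : Param p} {κ : ℝ} (hκ : 0 < κ) (hκ1 : κ ≤ 1)
    (h : ∀ τ ∈ Set.Ioc (0 : ℝ) 1, (fisherInfo G ν (φ + τ • alphaPart v)).PosDef ∧
      frob (minvsqrt (fisherInfo G ν φ) * msqrt (fisherInfo G ν (φ + τ • alphaPart v)) - 1) ≤ κ ∧
      ∫⁻ x, ENNReal.ofReal (frob (minvsqrt (fisherInfo G ν (φ + τ • alphaPart v))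
        * obsInfo G x (φ + τ • alphaPart v)
        * minvsqrt (fisherInfo G ν (φ + τ • alphaPart v)) - 1) ^ 2)
          ∂(dataLaw G ν (φ + τ • alphaPart v)) ≤ ENNReal.ofReal (κ ^ 2)) :
    ∫⁻ x, ENNReal.ofReal |(locLik G φ x).logitRem v
        - qf (fisherInfo G ν φ) (alphaPart v).ofLp / 2| ∂(dataLaw G ν φ)
      ≤ ENNReal.ofReal (11 * κ * qf (fisherInfo G ν φ) (alphaPart v).ofLp) := by
  set b := qf (fisherInfo G ν φ) (alphaPart v).ofLp with hb
  -- Logits see only the exposure coordinates, so the path may be taken along `alphaPart v`, where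
  -- the variances do not change and remain positive.
  have hinfo : ∀ (x : Data p N) (τ : ℝ), (locLik G φ x).logitInfo (τ • v) v
      = (locLik G φ x).logitInfo (τ • alphaPart v) v := fun x τ => by
    simp only [LocalLik.logitInfo, locLik, map_smul, logit_alphaPart]
  have hl : ∀ i (u : Param p), Measurable fun y : Data p N × ℝ => logit y.1.1 i u := fun i u =>
    (measurable_logit i u).comp (measurable_fst.comp measurable_fst)
  have hm : Measurable fun y : Data p N × ℝ => ENNReal.ofReal
      |∑ i, expitDeriv (logit y.1.1 i φ + y.2 * logit y.1.1 i v) * logit y.1.1 i v ^ 2 - b| := by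
    refine ((Finset.measurable_fun_sum _ fun i _ => ?_).sub_const b).abs.ennreal_ofReal
    exact (measurable_expitDeriv.comp ((hl i φ).add (measurable_snd.mul (hl i v)))).mul
      ((hl i v).pow_const 2)
  have hm' : Measurable fun y : Data p N × ℝ => ENNReal.ofReal
      |(locLik G φ y.1).logitInfo (y.2 • v) v - b| := by
    simpa only [LocalLik.logitInfo, locLik, map_smul, smul_eq_mul] using hm
  calc _ ≤ ∫⁻ x, (∫⁻ τ in Set.Ioc (0 : ℝ) 1, ENNReal.ofReal
          |(locLik G φ x).logitInfo (τ • v) v - b|) ∂(dataLaw G ν φ) :=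
        lintegral_mono fun x => LocalLik.ofReal_abs_logitRem_sub_le _ _ _
    _ = ∫⁻ τ in Set.Ioc (0 : ℝ) 1, (∫⁻ x, ENNReal.ofReal
          |(locLik G φ x).logitInfo (τ • v) v - b| ∂(dataLaw G ν φ)) :=
        lintegral_lintegral_swap hm'.aemeasurable
    _ ≤ ∫⁻ _τ in Set.Ioc (0 : ℝ) 1, ENNReal.ofReal (11 * κ * b) := by
        refine setLIntegral_mono' measurableSet_Ioc fun τ hτ => ?_
        obtain ⟨h1, h2, h3⟩ := h τ hτ
        simp only [hinfo]
        refine lintegral_abs_logitInfo_sub_le hφ hB (fun k => ?_) h1 hκ hκ1 h2 h3 v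
        rw [sigmaSq_add, sigmaSq_smul, sigmaSq_alphaPart, mul_zero, add_zero]
        exact hφ k
    _ = _ := by simp

end LogitRem

/-! ### Quadratic approximation of the logistic remainder in a fixed standardized direction. -/

section Asymptotic

variable {p : ℕ} {G : ∀ N : ℕ, SimpleGraph (Fin N)} {ν : ∀ N : ℕ, Measure (Fin N → Fin p → ℝ)}
  {Θ : Set (Param p)} {φ₀ : Param p}

theorem InfoStable.eventually_le (hs : InfoStable G ν Θ) {c : ENNReal} (hc : 0 < c) :
    ∀ᶠ N in atTop, ∀ φ ∈ Θ, ∫⁻ x, ENNReal.ofReal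
      (frob (minvsqrt (fisherInfo (G N) (ν N) φ) * obsInfo (G N) x φ
        * minvsqrt (fisherInfo (G N) (ν N) φ) - 1) ^ 2) ∂(dataLaw (G N) (ν N) φ) ≤ c := by
  filter_upwards [ENNReal.tendsto_nhds_zero.1 hs c hc] with N hN φ hφ
  exact (le_iSup₂ (f := fun φ (_ : φ ∈ Θ) => ∫⁻ x, ENNReal.ofReal
      (frob (minvsqrt (fisherInfo (G N) (ν N) φ) * obsInfo (G N) x φ
        * minvsqrt (fisherInfo (G N) (ν N) φ) - 1) ^ 2) ∂(dataLaw (G N) (ν N) φ)) φ hφ).trans hN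

/-- The vector with standardized coordinates `u`. -/
noncomputable def unstd (B : Matrix (ParamIdx p) (ParamIdx p) ℝ) (u : Param p) : Param p :=
  WithLp.toLp 2 (minvsqrt B *ᵥ u.ofLp)

theorem qf_unstd {B : Matrix (ParamIdx p) (ParamIdx p) ℝ} (hB : B.PosDef) (u : Param p) :
    qf B (unstd B u).ofLp = ‖u‖ ^ 2 := by
  rw [unstd, qf_minvsqrt hB, norm_sq_eq_dotProduct]

theorem norm_sq_le_qf {B : Matrix (ParamIdx p) (ParamIdx p) ℝ} (hB : B.PosDef) (v : Param p) :
    ‖v‖ ^ 2 ≤ frob B⁻¹ * qf B v.ofLp := by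
  rw [norm_sq_eq_dotProduct]; exact dotProduct_self_le_qf hB _

theorem norm_msqrt_mulVec_sq {B : Matrix (ParamIdx p) (ParamIdx p) ℝ} (hB : B.PosDef)
    (v : ParamIdx p → ℝ) : ‖WithLp.toLp 2 ((msqrt B)ᵀ *ᵥ v)‖ ^ 2 = qf B v := by
  rw [norm_toLp_sq, transpose_msqrt, ← qf_eq_msqrt hB]

theorem qf_smul {ι : Type*} [Fintype ι] (B : Matrix ι ι ℝ) (c : ℝ) (v : ι → ℝ) :
    qf B (c • v) = c ^ 2 * qf B v := by
  simp only [qf, Matrix.mulVec_smul, dotProduct_smul, smul_dotProduct, smul_eq_mul]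
  ring

/-- A fixed standardized vector corresponds to a displacement of norm tending to zero, since `B_N⁻¹`
does. Hence the path stays in `Θ` and in the region where continuity of the expected information
applies. -/
theorem eventually_lintegral_logitRem_le (hν : ∀ N, IsProbabilityMeasure (ν N))
    (hΘpos : ∀ φ ∈ Θ, ∀ k, 0 < sigmaSq φ k) (hφ₀ : φ₀ ∈ interior Θ)
    (hgrowth : InfoGrowth G ν Θ) (hstable : InfoStable G ν Θ) (hcont : InfoContinuity G ν Θ)
    (u : Param p) {ε : ℝ} (hε : 0 < ε) :
    ∀ᶠ N in atTop, ∫⁻ x, ENNReal.ofReal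
      |(locLik (G N) φ₀ x).logitRem (unstd (fisherInfo (G N) (ν N) φ₀) u)
        - qf (fisherInfo (G N) (ν N) φ₀)
          (alphaPart (unstd (fisherInfo (G N) (ν N) φ₀) u)).ofLp / 2|
        ∂(dataLaw (G N) (ν N) φ₀) ≤ ENNReal.ofReal ε := by
  obtain ⟨ρ, hρ, hball⟩ := Metric.isOpen_iff.1 isOpen_interior φ₀ hφ₀
  have hΘ₀ := interior_subset hφ₀
  -- The added one keeps `R` positive when `u = 0`.
  set R := ‖u‖ + 1 with hR
  have hR0 : 0 < R := by positivity
  set κ := min 1 (ε / (11 * R ^ 2)) with hκ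
  have hκ0 : 0 < κ := by positivity
  have hκ1 : κ ≤ 1 := min_le_left _ _
  have hκε : 11 * κ * R ^ 2 ≤ ε := by
    calc 11 * κ * R ^ 2 ≤ 11 * (ε / (11 * R ^ 2)) * R ^ 2 := by
          gcongr; exact min_le_right _ _
      _ = ε := by field_simp
  filter_upwards [hgrowth.1, hgrowth.2 (ρ ^ 2 / (2 * R ^ 2)) (by positivity),
    hstable.eventually_le (c := ENNReal.ofReal (κ ^ 2)) (ENNReal.ofReal_pos.2 (by positivity)),
    hcont R hR0 κ hκ0] with N h1 h2 h3 h4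
  have := hν N
  have hB := h1.1 φ₀ hΘ₀
  set B := fisherInfo (G N) (ν N) φ₀ with hBdef
  set v := unstd B u with hv
  have hqv : qf B v.ofLp ≤ R ^ 2 := by
    rw [hv, qf_unstd hB]
    have := norm_nonneg u
    gcongr
    linarith
  have hqa : qf B (alphaPart v).ofLp ≤ R ^ 2 :=
    (qf_alphaPart_le (hΘpos φ₀ hΘ₀) hB v).trans hqv
  have hqa0 : 0 ≤ qf B (alphaPart v).ofLp := qf_nonneg hB _
  refine (lintegral_abs_logitRem_sub_le (hΘpos φ₀ hΘ₀) hB hκ0 hκ1 fun τ hτ => ?_).trans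
    (ENNReal.ofReal_le_ofReal ?_)
  · have hτ2 : τ ^ 2 ≤ 1 := pow_le_one₀ hτ.1.le hτ.2
    have hqτ : qf B (τ • alphaPart v).ofLp ≤ R ^ 2 := by
      rw [WithLp.ofLp_smul, qf_smul]
      nlinarith
    have hmem : φ₀ + τ • alphaPart v ∈ Θ := by
      refine interior_subset (hball ?_)
      rw [Metric.mem_ball, dist_eq_norm, add_sub_cancel_left]
      refine lt_of_pow_lt_pow_left₀ 2 hρ.le ?_
      calc ‖τ • alphaPart v‖ ^ 2 ≤ frob B⁻¹ * qf B (τ • alphaPart v).ofLp := norm_sq_le_qf hB _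
        _ ≤ ρ ^ 2 / (2 * R ^ 2) * R ^ 2 :=
            mul_le_mul (h2 φ₀ hΘ₀) hqτ (qf_nonneg hB _) (by positivity)
        _ = ρ ^ 2 / 2 := by field_simp
        _ < ρ ^ 2 := by linarith [pow_pos hρ 2]
    refine ⟨h1.1 _ hmem, h4 φ₀ hΘ₀ _ hmem ?_, h3 _ hmem⟩
    refine le_of_sq_le_sq ?_ hR0.le
    have e : (φ₀ - (φ₀ + τ • alphaPart v)).ofLp = (-1 : ℝ) • (τ • alphaPart v).ofLp := by
      rw [sub_add_cancel_left, WithLp.ofLp_neg, neg_one_smul]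
    rw [norm_msqrt_mulVec_sq hB, e, qf_smul]
    linarith
  · calc 11 * κ * qf B (alphaPart v).ofLp ≤ 11 * κ * R ^ 2 := by gcongr
      _ ≤ ε := hκε

end Asymptotic

/-! ### The maximum likelihood estimator on a good event -/

section Deterministic

variable {p N : ℕ} {G : SimpleGraph (Fin N)} {ν : Measure (Fin N → Fin p → ℝ)}
  [IsProbabilityMeasure ν] {φ₀ : Param p}

theorem resVar_div_resVar_le {a b : ℝ} (ha : 0 < a) (hb : 0 < b) {φ ψ : Param p} (hφ : ∀ k, a ≤ sigmaSq φ k)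
    (hψ : ∀ k, sigmaSq ψ k ≤ b) (j : Fin N ⊕ Fin N) :
    resVar G j ψ / resVar G j φ ≤ b / a := by
  have hpos := resVar_pos G (fun k => ha.trans_le (hφ k)) j
  have key : ∀ s t s' t' d : ℝ, a ≤ s → a ≤ t → s' ≤ b → t' ≤ b → 0 ≤ d →
      (s' + t' * d) * a ≤ b * (s + t * d) := fun s t s' t' d h1 h2 h3 h4 hd => by
    have e1 : s' * a ≤ b * s := (mul_le_mul_of_nonneg_right h3 ha.le).trans (by gcongr)
    have e2 : t' * a ≤ b * t := (mul_le_mul_of_nonneg_right h4 ha.le).trans (by gcongr)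
    nlinarith
  rw [div_le_div_iff₀ hpos ha]
  rcases j with i | i
  · exact key _ _ _ _ _ (hφ 0) (hφ 1) (hψ 0) (hψ 1) (sq_nonneg _)
  · exact key _ _ _ _ _ (hφ 2) (hφ 3) (hψ 2) (hψ 3) (sq_nonneg _)

/-- Numerator and denominator are combinations of two variance coordinates with the same nonnegative
weights, so the ratio is at most `‖u‖ / a` whatever the eigenvalue. -/
theorem relVar_sq_le {a : ℝ} (ha : 0 < a) {φ : Param p} (hφ : ∀ k, a ≤ sigmaSq φ k)
    (j : Fin N ⊕ Fin N) (u : Param p) : relVar G φ j u ^ 2 ≤ ‖u‖ ^ 2 / a ^ 2 := by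
  have hpos := resVar_pos G (fun k => ha.trans_le (hφ k)) j
  have hn : ∀ k, |sigmaSq u k| ≤ ‖u‖ := fun k => PiLp.norm_apply_le u _
  have key : ∀ s t s' t' d : ℝ, a ≤ s → a ≤ t → |s'| ≤ ‖u‖ → |t'| ≤ ‖u‖ → 0 ≤ d →
      |s' + t' * d| * a ≤ ‖u‖ * (s + t * d) := fun s t s' t' d h1 h2 h3 h4 hd => by
    have h5 : |s' + t' * d| ≤ ‖u‖ + ‖u‖ * d := by
      refine (abs_add_le _ _).trans (add_le_add h3 ?_)
      rw [abs_mul, abs_of_nonneg hd]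
      gcongr
    have hu := norm_nonneg u
    have h6 : a + a * d ≤ s + t * d := by gcongr
    calc |s' + t' * d| * a ≤ (‖u‖ + ‖u‖ * d) * a := by gcongr
      _ = ‖u‖ * (a + a * d) := by ring
      _ ≤ _ := by gcongr
  have h : |resVar G j u| * a ≤ ‖u‖ * resVar G j φ := by
    rcases j with i | i
    · exact key _ _ _ _ _ (hφ 0) (hφ 1) (hn 0) (hn 1) (sq_nonneg _)
    · exact key _ _ _ _ _ (hφ 2) (hφ 3) (hn 2) (hn 3) (sq_nonneg _)
  have e : relVar G φ j u = resVar G j u / resVar G j φ := by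
    simp [relVar, div_eq_inv_mul]
  rw [e, ← div_pow, ← sq_abs, abs_div, abs_of_pos hpos]
  refine pow_le_pow_left₀ (by positivity) ?_ 2
  rw [div_le_div_iff₀ hpos ha]
  exact h

/-- The radius of the ball, in the norm of the information, which contains the maximum likelihood
estimator. -/
noncomputable def mleRadius (p : ℕ) (a b M : ℝ) : ℝ :=
  2 * (12 * (dimParam p * (2 * M / a + M)) + 2
    + 24 * (dimParam p * (2 * M / a + M)) * (b / a * (1 + b / a) ^ 2))

theorem dimParam_pos (p : ℕ) : 0 < dimParam p :=
  Fintype.card_pos_iff.2 ⟨Sum.inl (Sum.inl 0)⟩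

/-- Coordinates with respect to `unstd`. -/
theorem unstd_std {B : Matrix (ParamIdx p) (ParamIdx p) ℝ} (hB : B.PosDef) (v : Param p) :
    unstd B (WithLp.toLp 2 (msqrt B *ᵥ v.ofLp)) = v := by
  simp only [unstd]
  rw [minvsqrt_mulVec_msqrt hB]

/-- `unstd` as a linear map. -/
noncomputable def unstdLin (B : Matrix (ParamIdx p) (ParamIdx p) ℝ) : Param p →ₗ[ℝ] Param p where
  toFun := unstd B
  map_add' u v := by simp [unstd, Matrix.mulVec_add]
  map_smul' c u := by simp [unstd, Matrix.mulVec_smul]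

/-- All randomness sits in the three bounds `h1`, `h2`, `h3`. They feed the localization, which
places `ψ` within `mleRadius` in the norm of the information, and then the curvature bound there;
`f` converts that norm into the Euclidean one. -/
theorem mle_local {a b M κ R f : ℝ} (ha : 0 < a) (hab : a ≤ b) (hM : 0 < M)
    (hφ : ∀ k, a ≤ sigmaSq φ₀ k)
    (hB : (fisherInfo G ν φ₀).PosDef)
    (hR1 : 12 * (dimParam p * (2 * M / a + M)) + 2 ≤ R)
    (hR2 : 2 * mleRadius p a b M ^ 2 + 18 ≤ R ^ 2) (hκ0 : 0 ≤ κ)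
    (hκ : κ * mleRadius p a b M ≤ 1 / 6400) (hf0 : 0 < f)
    (hf : frob (fisherInfo G ν φ₀)⁻¹ ≤ f) (hfκ : f ≤ κ ^ 2 * a ^ 2) {x : Data p N}
    (h1 : scoreStat G a b φ₀ (fun k => unstd (fisherInfo G ν φ₀) (EuclideanSpace.single k 1)) x
      ≤ ENNReal.ofReal M)
    (h2 : frob (minvsqrt (fisherInfo G ν φ₀) * obsInfo G x φ₀ * minvsqrt (fisherInfo G ν φ₀) - 1)
      ≤ κ)
    (h3 : ∀ u, ‖u‖ ≤ R → |(locLik G φ₀ x).logitRem (unstd (fisherInfo G ν φ₀) u)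
        - qf (fisherInfo G ν φ₀) (alphaPart (unstd (fisherInfo G ν φ₀) u)).ofLp / 2| ≤ 1 / 100)
    {ψ : Param p} (hψ : ∀ k, a ≤ sigmaSq ψ k) (hψb : ∀ k, sigmaSq ψ k ≤ b)
    (hmax : logLik G x φ₀ ≤ logLik G x ψ) :
    ‖ψ - φ₀‖ ^ 2 ≤ f * mleRadius p a b M ^ 2 ∧
      ∀ u, LocalLik.curvConst / f * (u ⬝ᵥ u) ≤ qf (obsInfo G x ψ) u := by
  set B := fisherInfo G ν φ₀ with hBdef
  set R₀ := mleRadius p a b M with hR₀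
  set M' : ℝ := dimParam p * (2 * M / a + M) with hM'
  have hdim : (0 : ℝ) < dimParam p := by exact_mod_cast dimParam_pos p
  have hM'0 : 0 < M' := by positivity
  have hb := ha.trans_le hab
  have hR₀1 : 1 ≤ R₀ := by
    have : 0 ≤ 24 * M' * (b / a * (1 + b / a) ^ 2) := by positivity
    rw [hR₀, mleRadius, ← hM']
    linarith
  have hφp : ∀ k, 0 < sigmaSq φ₀ k := fun k => ha.trans_le (hφ k)
  have hψp : ∀ k, 0 < sigmaSq ψ k := fun k => ha.trans_le (hψ k)
  have hs := splits_locLik (G := G) (ν := ν) hφp hB x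
  rw [← hBdef] at hs
  set m := locLik G φ₀ x with hm
  set v := ψ - φ₀ with hv
  have hψv : φ₀ + v = ψ := by rw [hv]; abel
  have hκ1 : κ ≤ 1 / 6400 := by nlinarith
  have hinfo : ∀ u, |m.gaussInfo 0 u + m.logitInfo 0 u - qf B u.ofLp| ≤ κ * qf B u.ofLp :=
    fun u => by
      have e := qf_obsInfo (w := 0) x (resVar_pos G hφp) (by simpa using resVar_pos G hφp) u
      rw [add_zero, ← hm] at e
      rw [← e]
      refine (abs_qf_sub_le_of_standardized hB _ _).trans ?_
      exact mul_le_mul_of_nonneg_right h2 (qf_nonneg hB _)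
  -- The hypothesis `h3` is used at the standardized coordinates of `alphaPart u`, as the bound on
  -- `u` concerns that part only and the remainder depends on nothing else.
  have hrem : ∀ u, qf B (alphaPart u).ofLp ≤ R ^ 2 →
      |m.logitRem u - qf B (alphaPart u).ofLp / 2| ≤ 1 / 100 := fun u hu => by
    have hR0 : 0 ≤ R := by linarith
    have h := h3 (WithLp.toLp 2 (msqrt B *ᵥ (alphaPart u).ofLp)) (by
      refine le_of_sq_le_sq ?_ hR0
      rw [norm_toLp_sq, ← qf_eq_msqrt hB]
      exact hu)
    rw [unstd_std hB, hs.Pa_Pa, hs.logitRem_Pa] at h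
    exact h
  have hρ : ∀ j, 1 + m.L j v = resVar G j ψ / resVar G j φ₀ := fun j => by
    rw [hm, locLik_one_add_L x (resVar_pos G hφp j), hψv]
  have hc : (msqrt B *ᵥ v.ofLp) ⬝ᵥ (msqrt B *ᵥ v.ofLp) = qf B v.ofLp := (qf_eq_msqrt hB _).symm
  -- Expansion along the columns of `B^{-1/2}`: the coefficients `B^{1/2} v` have squared length `qf
  -- B v`, the scale in which the score must be bounded.
  have hvw : v = ∑ k, (msqrt B *ᵥ v.ofLp) k • unstd B (EuclideanSpace.single k 1) := by
    have e := congrArg (unstdLin B) (single_sum (WithLp.toLp 2 (msqrt B *ᵥ v.ofLp)))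
    rw [map_sum] at e
    simp only [map_smul] at e
    exact (unstd_std hB v).symm.trans e.symm
  obtain ⟨s1, s2, s3⟩ := score_bounds ha hab hφp hvw (by rwa [hψv]) (by rwa [hψv]) hM.le h1
  rw [hc, ← hM'] at s1 s2 s3
  have hdiff : 0 ≤ m.diff v := by
    rw [hm, ← logLik_sub_eq_diff x (resVar_pos G hφp) (by rw [hψv]; exact resVar_pos G hψp), hψv]
    linarith
  have hbv : qf B v.ofLp ≤ R₀ ^ 2 :=
    hs.b_le_of_diff_nonneg ((one_le_div ha).2 hab) hM'0 hR1 (by linarith) hinfo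
      (fun j => by rw [hρ]; exact div_pos (resVar_pos G hψp j) (resVar_pos G hφp j))
      (fun j => by rw [hρ]; exact resVar_div_resVar_le ha hb hφ hψb j) s1 s2 s3 hrem hdiff
  have hnorm : ∀ u : Param p, ‖u‖ ^ 2 ≤ f * qf B u.ofLp := fun u =>
    (norm_sq_le_qf hB u).trans (mul_le_mul_of_nonneg_right hf (qf_nonneg hB _))
  -- The choice `f ≤ κ² a²` makes relative changes of the variances small compared with the norm of
  -- the information.
  have hLκ : ∀ u j, m.L j u ^ 2 ≤ κ ^ 2 * qf B u.ofLp := fun u j => by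
    refine (relVar_sq_le ha hφ j u).trans ?_
    rw [div_le_iff₀ (by positivity)]
    calc ‖u‖ ^ 2 ≤ f * qf B u.ofLp := hnorm u
      _ ≤ κ ^ 2 * a ^ 2 * qf B u.ofLp := mul_le_mul_of_nonneg_right hfκ (qf_nonneg hB _)
      _ = _ := by ring
  refine ⟨(hnorm v).trans (by gcongr), fun u => ?_⟩
  have hge := hs.info_ge hR₀1 hbv hR2 hκ0 hκ hinfo hLκ hrem (WithLp.toLp 2 u)
  have e := qf_obsInfo (w := v) x (resVar_pos G hφp) (by rw [hψv]; exact resVar_pos G hψp)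
    (WithLp.toLp 2 u)
  rw [hψv, ← hm] at e
  rw [← e] at hge
  have hu := hnorm (WithLp.toLp 2 u)
  rw [norm_toLp_sq] at hu
  have hcc := LocalLik.curvConst_pos
  calc LocalLik.curvConst / f * (u ⬝ᵥ u) ≤ LocalLik.curvConst / f * (f * qf B u) := by gcongr
    _ = LocalLik.curvConst * qf B u := by field_simp
    _ ≤ _ := hge

end Deterministic

/-! ### Uniform bounds for the gradients near the true parameter. -/

section Gradient

variable {p : ℕ}

theorem norm_fderiv_fderiv_le_frob {f : Param p → ℝ} {φ : Param p} (h : ContDiffAt ℝ 2 f φ) :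
    ‖fderiv ℝ (fderiv ℝ f) φ‖ ≤ frob (hess f φ) := by
  refine ContinuousLinearMap.opNorm_le_bound _ (frob_nonneg _) fun v => ?_
  refine ContinuousLinearMap.opNorm_le_bound _ (mul_nonneg (frob_nonneg _) (norm_nonneg _))
    fun w => ?_
  have e := dotProduct_hess_mulVec h v w
  rw [← e, Real.norm_eq_abs]
  refine (abs_dotProduct_mulVec_le _ _ _).trans (le_of_eq ?_)
  rw [← norm_sq_eq_dotProduct, ← norm_sq_eq_dotProduct, Real.sqrt_sq (norm_nonneg _),
    Real.sqrt_sq (norm_nonneg _)]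

theorem norm_gradient_eq (f : Param p → ℝ) (φ : Param p) : ‖gradient f φ‖ = ‖fderiv ℝ f φ‖ := by
  unfold gradient
  exact LinearIsometryEquiv.norm_map _ _

theorem grad_dotProduct_self (f : Param p → ℝ) (φ : Param p) :
    grad f φ ⬝ᵥ grad f φ = ‖gradient f φ‖ ^ 2 := (norm_sq_eq_dotProduct _).symm

/-- Mean value inequality on a ball inside `Θ`: the operator norm of the second derivative is at
most the Frobenius norm of the Hessian. -/
theorem SmoothFunctional.exists_gradient_bound {Θ : Set (Param p)} {φ₀ : Param p}
    {g : ℕ → Param p → ℝ} (hg : SmoothFunctional Θ φ₀ g) (hφ₀ : φ₀ ∈ interior Θ) :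
    ∃ ρ > 0, ∃ C : ℝ, 0 ≤ C ∧ ∀ N, ∀ φ ∈ Metric.ball φ₀ ρ, grad (g N) φ ⬝ᵥ grad (g N) φ ≤ C := by
  obtain ⟨han, -, ⟨C₁, hC₁⟩, ε, hε, C₂, hC₂⟩ := hg
  obtain ⟨r, hr, hball⟩ := Metric.isOpen_iff.1 isOpen_interior φ₀ hφ₀
  set ρ := min ε r with hρ
  have hρ0 : 0 < ρ := lt_min hε hr
  have hsub : Metric.ball φ₀ ρ ⊆ Metric.ball φ₀ ε ∩ Θ := fun φ hφ =>
    ⟨Metric.ball_subset_ball (min_le_left _ _) hφ,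
      interior_subset (hball (Metric.ball_subset_ball (min_le_right _ _) hφ))⟩
  have h0 : φ₀ ∈ Metric.ball φ₀ ρ := Metric.mem_ball_self hρ0
  have hC₂0 : 0 ≤ C₂ := (frob_nonneg _).trans (hC₂ 0 φ₀ (hsub h0))
  refine ⟨ρ, hρ0, (C₁ + C₂ * ρ) ^ 2, sq_nonneg _, fun N φ hφ => ?_⟩
  have hcd : ∀ ψ ∈ Metric.ball φ₀ ρ, ContDiffAt ℝ 2 (g N) ψ := fun ψ hψ =>
    (han N ψ (hsub hψ).2).contDiffAt
  have hdiff : ∀ ψ ∈ Metric.ball φ₀ ρ, DifferentiableAt ℝ (fderiv ℝ (g N)) ψ := fun ψ hψ =>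
    ((hcd ψ hψ).fderiv_right (m := 1) (by norm_num)).differentiableAt (by norm_num)
  have h1 := (convex_ball φ₀ ρ).norm_image_sub_le_of_norm_fderiv_le hdiff
    (fun ψ hψ => (norm_fderiv_fderiv_le_frob (hcd ψ hψ)).trans (hC₂ N ψ (hsub hψ))) h0 hφ
  have h2 : ‖fderiv ℝ (g N) φ‖ ≤ C₁ + C₂ * ρ := by
    have h3 : ‖fderiv ℝ (g N) φ‖ ≤ ‖fderiv ℝ (g N) φ₀‖
        + ‖fderiv ℝ (g N) φ - fderiv ℝ (g N) φ₀‖ := norm_le_insert' _ _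
    have h4 := hC₁ N
    rw [norm_gradient_eq] at h4
    have h5 : C₂ * ‖φ - φ₀‖ ≤ C₂ * ρ := by
      gcongr
      rw [← dist_eq_norm]
      exact (Metric.mem_ball.1 hφ).le
    linarith
  rw [grad_dotProduct_self, norm_gradient_eq]
  exact pow_le_pow_left₀ (norm_nonneg _) h2 2

end Gradient

/-! ### Consistency -/

section Probability

theorem meas_lt_le_of_lintegral_le {Ω : Type*} [MeasurableSpace Ω] {μ : Measure Ω}
    {F : Ω → ENNReal} (hF : AEMeasurable F μ) {t s : ℝ} (ht : 0 < t)
    (h : ∫⁻ x, F x ∂μ ≤ ENNReal.ofReal (t * s)) :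
    μ {x | ¬ F x ≤ ENNReal.ofReal t} ≤ ENNReal.ofReal s := by
  have h1 := (mul_meas_ge_le_lintegral₀ hF (ENNReal.ofReal t)).trans h
  rw [ENNReal.ofReal_mul ht.le] at h1
  refine le_trans (measure_mono fun x hx => ?_)
    ((ENNReal.mul_le_mul_iff_right (ENNReal.ofReal_pos.2 ht).ne' ENNReal.ofReal_ne_top).1 h1)
  exact (not_le.1 hx).le

variable {p N : ℕ} {G : SimpleGraph (Fin N)} {ν : Measure (Fin N → Fin p → ℝ)}
  [IsProbabilityMeasure ν] {φ : Param p}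

theorem aemeasurable_frob {Ω ι : Type*} [MeasurableSpace Ω] {μ : Measure Ω} [Fintype ι]
    {A : Ω → Matrix ι ι ℝ} (hA : ∀ k l, AEMeasurable (fun x => A x k l) μ) :
    AEMeasurable (fun x => frob (A x)) μ := by
  have e : (fun x => frob (A x)) = fun x => Real.sqrt (∑ k, ∑ l, A x k l ^ 2) := by
    ext x
    rw [← frob_sq, Real.sqrt_sq (frob_nonneg _)]
  rw [e]
  exact (Finset.aemeasurable_fun_sum _ fun k _ => Finset.aemeasurable_fun_sum _ fun l _ =>
    (hA k l).pow_const 2).sqrt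

theorem aemeasurable_frob_standardized (hφ : ∀ k, 0 < sigmaSq φ k)
    (hB : (fisherInfo G ν φ).PosDef) (W : Matrix (ParamIdx p) (ParamIdx p) ℝ) :
    AEMeasurable (fun x => frob (W * obsInfo G x φ * W - 1)) (dataLaw G ν φ) := by
  refine aemeasurable_frob fun k l => ?_
  simp only [Matrix.sub_apply, Matrix.mul_apply]
  refine AEMeasurable.sub_const (Finset.aemeasurable_fun_sum _ fun i _ => AEMeasurable.mul_const
    (Finset.aemeasurable_fun_sum _ fun j _ => AEMeasurable.const_mul ?_ _) _) _
  exact (integrable_obsInfo hφ hB j i).aestronglyMeasurable.aemeasurable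

theorem measurable_logitRem (v : Param p) :
    Measurable fun x : Data p N => (locLik G φ x).logitRem v := by
  have hl : ∀ i (u : Param p), Measurable fun x : Data p N => logit x.1 i u := fun i u =>
    (measurable_logit i u).comp measurable_fst
  exact Finset.measurable_fun_sum _ fun i _ => ((measurable_softplus.comp
    ((hl i φ).add (hl i v))).sub (measurable_softplus.comp (hl i φ))).sub
      ((measurable_expit.comp (hl i φ)).mul (hl i v))

theorem convexOn_qf {B : Matrix (ParamIdx p) (ParamIdx p) ℝ} (hB : B.PosDef) :
    ConvexOn ℝ Set.univ fun v : Param p => qf B v.ofLp / 2 := by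
  refine ⟨convex_univ, fun u _ v _ α β hα hβ hαβ => ?_⟩
  have h := qf_nonneg hB (u - v).ofLp
  have e : α * qf B u.ofLp + β * qf B v.ofLp - qf B (α • u + β • v).ofLp
      = α * β * qf B (u - v).ofLp := by
    obtain rfl : β = 1 - α := by linarith
    simp only [qf, WithLp.ofLp_add, WithLp.ofLp_smul, WithLp.ofLp_sub, Matrix.mulVec_add,
      Matrix.mulVec_sub, Matrix.mulVec_smul, dotProduct_add, add_dotProduct, dotProduct_sub,
      sub_dotProduct, smul_dotProduct, dotProduct_smul, smul_eq_mul]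
    ring
  have : 0 ≤ α * β * qf B (u - v).ofLp := by positivity
  simp only [smul_eq_mul]
  linarith

end Probability

/-! ### Localization and curvature with high probability. -/

section Main

variable {p : ℕ} {G : ∀ N : ℕ, SimpleGraph (Fin N)} {ν : ∀ N : ℕ, Measure (Fin N → Fin p → ℝ)}
  {Θ : Set (Param p)} {φ₀ : Param p}

/-- The nonlinear part of the logistic log-likelihood ratio is uniformly close to its quadratic
approximation outside an event of small probability. -/
theorem eventually_exists_logitRem_bad (hν : ∀ N, IsProbabilityMeasure (ν N))
    (hΘpos : ∀ φ ∈ Θ, ∀ k, 0 < sigmaSq φ k) (hφ₀ : φ₀ ∈ interior Θ)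
    (hgrowth : InfoGrowth G ν Θ) (hstable : InfoStable G ν Θ) (hcont : InfoContinuity G ν Θ)
    {R η d : ℝ} (hR : 0 < R) (hη : 0 < η) (hd : 0 < d) :
    ∀ᶠ N in atTop, dataLaw (G N) (ν N) φ₀ {x | ¬ ∀ u, ‖u‖ ≤ R →
      |(locLik (G N) φ₀ x).logitRem (unstd (fisherInfo (G N) (ν N) φ₀) u)
        - qf (fisherInfo (G N) (ν N) φ₀)
          (alphaPart (unstd (fisherInfo (G N) (ν N) φ₀) u)).ofLp / 2| ≤ η}
      ≤ ENNReal.ofReal d := by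
  have hΘ₀ := interior_subset hφ₀
  obtain ⟨T, η', hη', hT⟩ := exists_finset_uniform_of_convexOn (ParamIdx p) hR hη
  -- The added one avoids division by zero when `T` is empty.
  set s : ℝ := d / (T.card + 1) with hs
  have hs0 : 0 < s := by positivity
  have hev : ∀ᶠ N in atTop, ∀ u ∈ T, ∫⁻ x, ENNReal.ofReal
      |(locLik (G N) φ₀ x).logitRem (unstd (fisherInfo (G N) (ν N) φ₀) u)
        - qf (fisherInfo (G N) (ν N) φ₀)
          (alphaPart (unstd (fisherInfo (G N) (ν N) φ₀) u)).ofLp / 2|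
        ∂(dataLaw (G N) (ν N) φ₀) ≤ ENNReal.ofReal (η' * s) :=
    (eventually_all_finset T).2 fun u _ =>
      eventually_lintegral_logitRem_le hν hΘpos hφ₀ hgrowth hstable hcont u (by positivity)
  filter_upwards [hev, hgrowth.1] with N hN hN1
  have := hν N
  have hB := hN1.1 φ₀ hΘ₀
  set B := fisherInfo (G N) (ν N) φ₀ with hBdef
  have hsub : {x | ¬ ∀ u, ‖u‖ ≤ R → |(locLik (G N) φ₀ x).logitRem (unstd B u)
        - qf B (alphaPart (unstd B u)).ofLp / 2| ≤ η}
      ⊆ ⋃ u ∈ T, {x | ¬ ENNReal.ofReal |(locLik (G N) φ₀ x).logitRem (unstd B u)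
        - qf B (alphaPart (unstd B u)).ofLp / 2| ≤ ENNReal.ofReal η'} := fun x hx => by
    by_contra hnot
    simp only [Set.mem_iUnion, Set.mem_ofPred_eq, not_exists, not_not] at hnot
    -- The comparison function is half the exposure part of `b`, at most `‖u‖² / 2` in standardized
    -- coordinates.
    refine hx (hT _ _ ((LocalLik.convexOn_logitRem).comp_linearMap (unstdLin B))
      ((convexOn_qf hB).comp_linearMap (alphaPart ∘ₗ unstdLin B))
      (fun u => LocalLik.logitRem_nonneg _)
      (fun u => div_nonneg (qf_nonneg hB _) (by norm_num)) (fun u => ?_)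
      fun u hu => (ENNReal.ofReal_le_ofReal_iff hη'.le).1 (hnot u hu))
    have h1 := qf_alphaPart_le (hΘpos φ₀ hΘ₀) hB (unstd B u)
    rw [← hBdef, qf_unstd hB] at h1
    exact div_le_div_of_nonneg_right h1 (by norm_num)
  refine (measure_mono hsub).trans ((measure_biUnion_finset_le _ _).trans ?_)
  calc _ ≤ ∑ _u ∈ T, ENNReal.ofReal s := Finset.sum_le_sum fun u hu =>
        meas_lt_le_of_lintegral_le
          ((measurable_logitRem _).sub_const _).abs.ennreal_ofReal.aemeasurable hη' (hN u hu)
    _ = ENNReal.ofReal (T.card * s) := by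
        rw [Finset.sum_const, nsmul_eq_mul, ENNReal.ofReal_mul (by positivity),
          ENNReal.ofReal_natCast]
    _ ≤ ENNReal.ofReal d := by
        refine ENNReal.ofReal_le_ofReal ?_
        rw [hs, mul_div_assoc', div_le_iff₀ (by positivity)]
        nlinarith

theorem exists_variance_bounds (hΘ : IsCompact Θ) (hΘpos : ∀ φ ∈ Θ, ∀ k, 0 < sigmaSq φ k)
    (hφ₀ : φ₀ ∈ Θ) :
    ∃ a b : ℝ, 0 < a ∧ a ≤ b ∧ (∀ φ ∈ Θ, ∀ k, a ≤ sigmaSq φ k) ∧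
      ∀ φ ∈ Θ, ∀ k, sigmaSq φ k ≤ b := by
  have hc : ∀ k, Continuous fun φ : Param p => sigmaSq φ k := fun k => by
    unfold sigmaSq; fun_prop
  have hlow : ∀ k, ∃ a, 0 < a ∧ ∀ φ ∈ Θ, a ≤ sigmaSq φ k := fun k =>
    hΘ.exists_forall_le' (hc k).continuousOn fun φ hφ => hΘpos φ hφ k
  choose a ha hale using hlow
  obtain ⟨k₀, hk₀⟩ := Finite.exists_min a
  obtain ⟨b, hb⟩ := hΘ.isBounded.exists_norm_le
  have hup : ∀ φ ∈ Θ, ∀ k, sigmaSq φ k ≤ b := fun φ hφ k =>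
    (le_abs_self _).trans ((PiLp.norm_apply_le φ _).trans (hb φ hφ))
  exact ⟨a k₀, b, ha k₀, (hale k₀ φ₀ hφ₀).trans (hup φ₀ hφ₀ k₀),
    fun φ hφ k => (hk₀ k).trans (hale k φ hφ), hup⟩

theorem scoreConst_nonneg (p : ℕ) {a b : ℝ} (ha : 0 < a) (hab : a ≤ b) :
    0 ≤ scoreConst p a b := by
  have := chiVar_nonneg
  have hb := ha.trans_le hab
  unfold scoreConst
  positivity

/-- Outside an event of small probability, every parameter with a likelihood at least that of the
true parameter is close to it, and the observed information there is large. -/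
theorem eventually_meas_not_mle_local (hν : ∀ N, IsProbabilityMeasure (ν N)) (hΘ : IsCompact Θ)
    (hΘpos : ∀ φ ∈ Θ, ∀ k, 0 < sigmaSq φ k) (hφ₀ : φ₀ ∈ interior Θ)
    (hgrowth : InfoGrowth G ν Θ) (hstable : InfoStable G ν Θ) (hcont : InfoContinuity G ν Θ)
    {ρ Λ d : ℝ} (hρ : 0 < ρ) (hΛ : 0 < Λ) (hd : 0 < d) :
    ∀ᶠ N in atTop, dataLaw (G N) (ν N) φ₀ {x | ¬ ∀ ψ ∈ Θ,
      logLik (G N) x φ₀ ≤ logLik (G N) x ψ →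
        ψ ∈ Metric.ball φ₀ ρ ∧ ∀ u, Λ * (u ⬝ᵥ u) ≤ qf (obsInfo (G N) x ψ) u}
      ≤ ENNReal.ofReal d := by
  have hΘ₀ := interior_subset hφ₀
  obtain ⟨a, b, ha, hab, hlow, hup⟩ := exists_variance_bounds hΘ hΘpos hΘ₀
  have hb := ha.trans_le hab
  have hsc := scoreConst_nonneg p ha hab
  -- By Markov's inequality the score statistic exceeds `M` with probability at most `d / 3`. The
  -- other constants follow in order: the radius from `M`, then `κ` and `R` from the radius, then
  -- `f`; none depends on `N`.
  set M : ℝ := 3 * (scoreConst p a b + 1) / d with hM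
  have hM0 : 0 < M := by positivity
  set M' : ℝ := dimParam p * (2 * M / a + M) with hM'
  have hdim : (0 : ℝ) < dimParam p := by exact_mod_cast dimParam_pos p
  have hM'0 : 0 < M' := by positivity
  set R₀ := mleRadius p a b M with hR₀
  have hR₀0 : 0 < R₀ := by
    rw [hR₀, mleRadius, ← hM']
    positivity
  set R := 12 * M' + 2 * R₀ + 18 with hR
  set κ := 1 / (6400 * R₀) with hκ
  have hκ0 : 0 < κ := by positivity
  have hκR : κ * R₀ ≤ 1 / 6400 := le_of_eq (by rw [hκ]; field_simp)
  have hcc := LocalLik.curvConst_pos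
  -- The three requirements are small relative changes of the variances, localization in the ball of
  -- radius `ρ`, and curvature at least `Λ`.
  set f := min (κ ^ 2 * a ^ 2) (min (ρ ^ 2 / (2 * R₀ ^ 2)) (LocalLik.curvConst / Λ)) with hf
  have hf0 : 0 < f := by positivity
  have hfρ : f * R₀ ^ 2 < ρ ^ 2 := by
    calc f * R₀ ^ 2 ≤ ρ ^ 2 / (2 * R₀ ^ 2) * R₀ ^ 2 := by
          gcongr; exact (min_le_right _ _).trans (min_le_left _ _)
      _ = ρ ^ 2 / 2 := by field_simp
      _ < ρ ^ 2 := by linarith [pow_pos hρ 2]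
  have hfΛ : Λ ≤ LocalLik.curvConst / f := by
    rw [le_div_iff₀ hf0, mul_comm, ← le_div_iff₀ hΛ]
    exact (min_le_right _ _).trans (min_le_right _ _)
  filter_upwards [hgrowth.1, hgrowth.2 f hf0,
    hstable.eventually_le (c := ENNReal.ofReal (κ ^ 2 * (d / 3)))
      (ENNReal.ofReal_pos.2 (by positivity)),
    eventually_exists_logitRem_bad hν hΘpos hφ₀ hgrowth hstable hcont (R := R) (η := 1 / 100)
      (d := d / 3) (by positivity) (by norm_num) (by positivity)] with N h1 h2 h3 h4
  have := hν N
  have hB := h1.1 φ₀ hΘ₀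
  have hφp := hΘpos φ₀ hΘ₀
  set B := fisherInfo (G N) (ν N) φ₀ with hBdef
  set w : ParamIdx p → Param p := fun k => unstd B (EuclideanSpace.single k 1) with hw
  have hsub : {x | ¬ ∀ ψ ∈ Θ, logLik (G N) x φ₀ ≤ logLik (G N) x ψ →
        ψ ∈ Metric.ball φ₀ ρ ∧ ∀ u, Λ * (u ⬝ᵥ u) ≤ qf (obsInfo (G N) x ψ) u}
      ⊆ ({x | ¬ scoreStat (G N) a b φ₀ w x ≤ ENNReal.ofReal M}
        ∪ {x | ¬ ENNReal.ofReal (frob (minvsqrt B * obsInfo (G N) x φ₀ * minvsqrt B - 1) ^ 2)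
          ≤ ENNReal.ofReal (κ ^ 2)})
        ∪ {x | ¬ ∀ u, ‖u‖ ≤ R → |(locLik (G N) φ₀ x).logitRem (unstd B u)
          - qf B (alphaPart (unstd B u)).ofLp / 2| ≤ 1 / 100} := fun x hx => by
    by_contra hnot
    simp only [Set.mem_union, Set.mem_ofPred_eq, not_or, not_not] at hnot
    obtain ⟨⟨g1, g2⟩, g3⟩ := hnot
    refine hx fun ψ hψ hmax => ?_
    have g2' := le_of_sq_le_sq ((ENNReal.ofReal_le_ofReal_iff (sq_nonneg κ)).1 g2) hκ0.le
    obtain ⟨k1, k2⟩ := mle_local ha hab hM0 (hlow φ₀ hΘ₀) hB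
      (by rw [hR]; linarith) (by rw [hR]; nlinarith) hκ0.le hκR hf0 (h2 φ₀ hΘ₀)
      (min_le_left _ _) g1 g2' g3 (hlow ψ hψ) (hup ψ hψ) hmax
    refine ⟨?_, fun u => (mul_le_mul_of_nonneg_right hfΛ (dotProduct_self_nonneg' u)).trans (k2 u)⟩
    rw [Metric.mem_ball, dist_eq_norm]
    exact lt_of_pow_lt_pow_left₀ 2 hρ.le (k1.trans_lt hfρ)
  have b1 : dataLaw (G N) (ν N) φ₀ {x | ¬ scoreStat (G N) a b φ₀ w x ≤ ENNReal.ofReal M}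
      ≤ ENNReal.ofReal (d / 3) := by
    refine meas_lt_le_of_lintegral_le (measurable_scoreStat w).aemeasurable hM0 ?_
    refine (lintegral_scoreStat_le ha hab hφp (hup φ₀ hΘ₀) hB fun k => ?_).trans
      (ENNReal.ofReal_le_ofReal ?_)
    · rw [hw, qf_unstd hB]
      simp
    · have : M * (d / 3) = scoreConst p a b + 1 := by rw [hM]; field_simp
      linarith
  have b2 : dataLaw (G N) (ν N) φ₀ {x | ¬ ENNReal.ofReal
      (frob (minvsqrt B * obsInfo (G N) x φ₀ * minvsqrt B - 1) ^ 2) ≤ ENNReal.ofReal (κ ^ 2)}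
      ≤ ENNReal.ofReal (d / 3) :=
    meas_lt_le_of_lintegral_le
      ((aemeasurable_frob_standardized hφp hB _).pow_const 2).ennreal_ofReal (by positivity)
      (h3 φ₀ hΘ₀)
  calc _ ≤ _ := measure_mono hsub
    _ ≤ ENNReal.ofReal (d / 3) + ENNReal.ofReal (d / 3) + ENNReal.ofReal (d / 3) :=
        (measure_union_le _ _).trans
          (add_le_add ((measure_union_le _ _).trans (add_le_add b1 b2)) h4)
    _ = ENNReal.ofReal d := by
        rw [← ENNReal.ofReal_add (by positivity) (by positivity),
          ← ENNReal.ofReal_add (by positivity) (by positivity)]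
        congr 1
        ring

end Main

end RENSEM

theorem theorem5p3 (p : ℕ)
    (G : ∀ N : ℕ, SimpleGraph (Fin N))
    (hG : ∀ᶠ N in atTop, ∀ i : Fin N, 0 < deg (G N) i)
    (ν : ∀ N : ℕ, Measure (Fin N → Fin p → ℝ)) (hν : ∀ N, IsProbabilityMeasure (ν N))
    (Θ : Set (Param p)) (hΘ : IsCompact Θ) (hΘpos : ∀ φ ∈ Θ, ∀ k, 0 < sigmaSq φ k)
    (φ₀ : Param p) (hφ₀ : φ₀ ∈ interior Θ)
    (hgrowth : InfoGrowth G ν Θ) (hstable : InfoStable G ν Θ)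
    (hcont : InfoContinuity G ν Θ) (hobs : ObsInfoContinuity G ν Θ)
    (g : ℕ → Param p → ℝ) (hg : SmoothFunctional Θ φ₀ g)
    (hspec : SpectralCondition (fun N => fisherInfo (G N) (ν N) φ₀)
      (fun N => gradient (g N) φ₀))
    (φhat : ∀ N : ℕ, Data p N → Param p) (hmle : ∀ N, IsMLE (G N) Θ (φhat N))
    (hposdef : Tendsto (fun N => dataLaw (G N) (ν N) φ₀
      {x | ¬ ((obsInfo (G N) x φ₀).PosDef ∧ (obsInfo (G N) x (φhat N x)).PosDef)})
      atTop (𝓝 0))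
    (hhess : ∃ ε > 0, ∃ C : ℝ, ∀ N, ∀ φ' ∈ Metric.ball φ₀ ε ∩ Θ,
      frob (hess (fun φ => grad (g N) φ ⬝ᵥ grad (g N) φ) φ') ≤ C) :
    ∀ ε > 0, Tendsto (fun N => dataLaw (G N) (ν N) φ₀
      {x | ε ≤ |sandwichEst (G N) x (g N) (φhat N x) - sandwichVar (G N) (ν N) (g N) φ₀|})
      atTop (𝓝 0) := by
  intro ε hε
  have hΘ₀ := interior_subset hφ₀
  obtain ⟨ρ, hρ, C, hC, hgrad⟩ := hg.exists_gradient_bound hφ₀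
  refine ENNReal.tendsto_nhds_zero.2 fun δ hδ => ?_
  -- Truncation at one keeps the real number meaningful when `δ` is infinite.
  have hd : 0 < (min δ 1).toReal := ENNReal.toReal_pos (by simp [hδ.ne']) (by simp)
  have hΛ : 0 < 3 * (C + 1) / ε := by positivity
  filter_upwards [hgrowth.2 (ε / (3 * (C + 1))) (by positivity),
    eventually_meas_not_mle_local hν hΘ hΘpos hφ₀ hgrowth hstable hcont hρ hΛ hd] with N h1 h2
  rw [ENNReal.ofReal_toReal (by simp)] at h2
  refine le_trans (measure_mono fun x hx => ?_) (h2.trans (min_le_left _ _))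
  intro hgood
  -- The maximizer enters only through its likelihood being at least that of `φ₀`.
  obtain ⟨hmem, hJ⟩ := hgood (φhat N x) ((hmle N).mem x) ((hmle N).isMaxOn x hΘ₀)
  have e1 : |sandwichEst (G N) x (g N) (φhat N x)| ≤ ε / 3 := by
    refine (abs_dotProduct_inv_mulVec_le hΛ hJ _).trans ?_
    rw [div_le_iff₀ hΛ]
    calc _ ≤ C := hgrad N _ hmem
      _ ≤ C + 1 := by linarith
      _ = _ := by field_simp
  -- The target tends to zero by itself, so on the good event the difference is at most `2ε/3 < ε`.
  have e2 : |sandwichVar (G N) (ν N) (g N) φ₀| ≤ ε / 3 := by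
    refine (abs_qf_le _ _).trans ?_
    calc _ ≤ ε / (3 * (C + 1)) * (C + 1) := by
          refine mul_le_mul (h1 φ₀ hΘ₀) ?_ (dotProduct_self_nonneg' _) (by positivity)
          exact (hgrad N _ (Metric.mem_ball_self hρ)).trans (by linarith)
      _ = ε / 3 := by field_simp
  have hx' : ε ≤ |sandwichEst (G N) x (g N) (φhat N x) - sandwichVar (G N) (ν N) (g N) φ₀| := hx
  have := abs_sub (sandwichEst (G N) x (g N) (φhat N x)) (sandwichVar (G N) (ν N) (g N) φ₀)
  linarith
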